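/- A canonical box is a nonempty set $[x_1,+\infty)\times[y_1,y_2)\times[z_1,z_2)$ with $x_1,y_1,z_1\in\mathbb R$ and $y_2,z_2\in\mathbb R\cup\{+\infty\}$. Given $n$ canonical boxes and an integer $\lambda\in[2,n]$, consider the following structure. * Top layer: an interval tree over the $z$-ranges of all boxes. (Each node of an interval tree over a set of intervals stores the lower median $m$ of their endpoints and is assigned the intervals containing $m$; its left and right subtrees are built over the intervals entirely to the left, resp. right, of $m$.) * Middle layer: for each top-layer node, an interval tree over the $y$-ranges of the boxes assigned to it. * Bottom layer: for each middle-layer node, four 3D dominance structures, over the corners $(x_1,y_1,z_1)$, $(x_1,y_1,z_2)$, $(x_1,y_2,z_1)$, $(x_1,y_2,z_2)$ of the boxes assigned to it. A 3D dominance structure is a balanced $\lambda$-ary range tree over the points sorted by $z$, each node of which carries a balanced binary range tree over its leaf descendants sorted by $y$. The bottom list of a node of such a binary range tree is the list of the boxes whose points are its leaf descendants, sorted by $x$-coordinate (ties are broken by index). The model is the word RAM with words of $w\ge c\lg n$ bits; a coordinate occupies one word and can only be compared with a coordinate of the query point. Lemma. For every constant $\epsilon>0$ there are a constant $c$, fixed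 programs (depending only on $\epsilon$), and $O(\cdot)$ constants (depending only on $\epsilon$) such that for all integers $2\le\lambda\le n$, all $w\ge c\lg n$ and all $n$ canonical boxes, the structure can be stored in $O(n\log_\lambda n)$ words in such a way that 1. each bottom list can be accessed: given a word naming its node and an index $i$, its $i$-th box is found in $O(\lg^\epsilon n)$ time; 2. for every query point $q\in\mathbb R^3$, the number $k$ of boxes containing $q$ is computed in $O(\lambda\lg^3 n\,\log_\lambda n)$ time; 3. for every $q\in\mathbb R^3$, the boxes containing $q$ are reported, each exactly once, in $O(\lambda\lg^3 n\,\log_\lambda n+k\lg^\epsilon n)$ time. The reported boxes are the union of $O(\lambda\lg^3 n\,\log_\lambda n)$ pairwise disjoint sets, each of which is a nonempty prefix of some bottom list, and they are output prefix by prefix, in list order. -/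

import Mathlib

/-! ### Canonical boxes -/

/-- A coordinate: a real number or `+∞`. -/
abbrev Coord := WithTop ℝ

/-- A (nonempty) canonical box `[x₁, +∞) × [y₁, y₂) × [z₁, z₂)`. -/
structure CanonicalBox where
  x₁ : ℝ
  y₁ : ℝ
  y₂ : Coord
  z₁ : ℝ
  z₂ : Coord
  y_lt : (y₁ : Coord) < y₂
  z_lt : (z₁ : Coord) < z₂

/-- The point `(q 0, q 1, q 2)` lies in the box. -/
def CanonicalBox.Contains (b : CanonicalBox) (q : Fin 3 → ℝ) : Prop :=
  b.x₁ ≤ q 0 ∧ (b.y₁ ≤ q 1 ∧ (q 1 : Coord) < b.y₂) ∧ (b.z₁ ≤ q 2 ∧ (q 2 : Coord) < b.z₂)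

open Classical in
/-- The number of boxes of the family that contain `q`. -/
noncomputable def stabCount {n : ℕ} (B : Fin n → CanonicalBox) (q : Fin 3 → ℝ) : ℕ :=
  (Finset.univ.filter fun i => (B i).Contains q).card

/-! ### Interval trees -/

/-- A node stores its median and the set of (indices of) the intervals containing the median. -/
inductive IntervalTree (ι : Type) where
  | nil : IntervalTree ι
  | node (median : Coord) (assigned : Finset ι) (left right : IntervalTree ι) : IntervalTree ι

/-- The (lower) median of the `2 |S|` endpoints of the intervals `[lo i, hi i)`, `i ∈ S`. -/
noncomputable def endpointMedian {ι : Type} (lo hi : ι → Coord) (S : Finset ι) : Coord :=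
  ((S.val.map lo + S.val.map hi).sort (· ≤ ·)).getD (S.card - 1) ⊤

/-- Top-down construction with at most `k` levels below the current node: the intervals containing
the median stay at the node, those entirely to its left (right) go to the left (right) subtree. -/
noncomputable def intervalTreeAux {ι : Type} (lo hi : ι → Coord) :
    ℕ → Finset ι → IntervalTree ι
  | 0, _ => .nil
  | k + 1, S =>
    open Classical in
    let m := endpointMedian lo hi S
    if S = ∅ then .nil
    else .node m (S.filter fun i => lo i ≤ m ∧ m < hi i)
      (intervalTreeAux lo hi k (S.filter fun i => hi i ≤ m))
      (intervalTreeAux lo hi k (S.filter fun i => m < lo i))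

/-- The interval tree over the intervals `[lo i, hi i)`, `i ∈ S`. Both subtrees of a node hold fewer
intervals than the node's own tree, so `|S|` levels always suffice. -/
noncomputable def intervalTree {ι : Type} (lo hi : ι → Coord) (S : Finset ι) : IntervalTree ι :=
  intervalTreeAux lo hi S.card S

/-- The sets of intervals assigned to the nodes of an interval tree. -/
def IntervalTree.nodeSets {ι : Type} : IntervalTree ι → List (Finset ι)
  | .nil => []
  | .node _ I l r => I :: (l.nodeSets ++ r.nodeSets)

/-! ### Range trees and bottom lists -/

/-- The elements of `S` in increasing order of `key` (ties are broken by index). -/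
noncomputable def sortByKey {n : ℕ} (key : Fin n → Coord) (S : Finset (Fin n)) : List (Fin n) :=
  open Classical in
  ((S.image fun i => toLex (key i, i)).sort (· ≤ ·)).map fun p => (ofLex p).2

/-- The balanced `d`-ary range tree with leaves, from left to right, `L`: the nodes at height `j`
span the consecutive blocks of `d ^ j` leaves (the last block may be shorter), and the height of the
root is `⌈log_d |L|⌉`. Every node is given by the list of its leaf descendants. -/
def rangeTreeNodes {α : Type} (d : ℕ) (L : List α) : List (List α) :=
  (List.range (Nat.clog d L.length + 1)).flatMap fun j => L.toChunks (d ^ j)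

/-- The bottom lists of the binary range tree that represents a planar point set (given by the key
`x` and the key `y`): its leaves are sorted by `y`, and each node carries its leaf descendants
sorted by `x`. -/
noncomputable def planarLists {n : ℕ} (x y : Fin n → Coord) (S : Finset (Fin n)) :
    List (List (Fin n)) :=
  (rangeTreeNodes 2 (sortByKey y S)).map fun W => sortByKey x W.toFinset

/-- The bottom lists of the three-dimensional dominance structure: a `lam`-ary range tree over the
`z`-keys, each node of which carries a binary range tree over its leaf descendants. -/
noncomputable def dominanceLists {n : ℕ} (lam : ℕ) (x y z : Fin n → Coord) (S : Finset (Fin n)) :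
    List (List (Fin n)) :=
  (rangeTreeNodes lam (sortByKey z S)).flatMap fun V => planarLists x y V.toFinset

/-- All bottom lists of the stabbing structure for the boxes `B`: the top layer is an interval tree
over the `z`-ranges of all boxes; each of its nodes has a middle-layer interval tree over the
`y`-ranges of the boxes assigned to it; each node of a middle-layer tree has four dominance
structures, over the corners `(x₁, y₁, z₁)`, `(x₁, y₁, z₂)`, `(x₁, y₂, z₁)`, `(x₁, y₂, z₂)` of the
boxes assigned to it. A point of a list is given by the index of its box. -/
noncomputable def bottomLists {n : ℕ} (lam : ℕ) (B : Fin n → CanonicalBox) :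
    List (List (Fin n)) :=
  let x : Fin n → Coord := fun i => (B i).x₁
  let ylo : Fin n → Coord := fun i => (B i).y₁
  let yhi : Fin n → Coord := fun i => (B i).y₂
  let zlo : Fin n → Coord := fun i => (B i).z₁
  let zhi : Fin n → Coord := fun i => (B i).z₂
  (intervalTree zlo zhi Finset.univ).nodeSets.flatMap fun I =>
    (intervalTree ylo yhi I).nodeSets.flatMap fun J =>
      dominanceLists lam x ylo zlo J ++ dominanceLists lam x ylo zhi J ++
        dominanceLists lam x yhi zlo J ++ dominanceLists lam x yhi zhi J

/-! ### The word RAM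

Words have `w` bits. A memory cell holds a word or a coordinate; coordinates can only be compared
with the coordinates of the query point. A query has read-only access to the memory that holds the
data structure, and it uses only the finitely many registers named in its program. -/

/-- A memory cell of a word RAM with word length `w`. -/
inductive Cell (w : ℕ) where
  | word (v : BitVec w) : Cell w
  | coord (c : Coord) : Cell w

/-- Arithmetic, bitwise, shift and comparison operations on words. -/
inductive WordOp where
  | add | sub | mul | div | mod | and | or | xor | shl | shr | lt | eq

/-- The value of an operation; arithmetic is modulo `2 ^ w`, tests yield `1` or `0`. -/
def WordOp.eval {w : ℕ} (a b : BitVec w) : WordOp → BitVec w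
  | .add => a + b
  | .sub => a - b
  | .mul => a * b
  | .div => a / b
  | .mod => a % b
  | .and => a &&& b
  | .or => a ||| b
  | .xor => a ^^^ b
  | .shl => a <<< b
  | .shr => a >>> b
  | .lt => if a.toNat < b.toNat then 1 else 0
  | .eq => if a = b then 1 else 0

/-- Programs; registers are named by natural numbers. -/
inductive Prog where
  /-- do nothing -/
  | skip : Prog
  /-- register `r` gets the constant `k` -/
  | const (r k : ℕ) : Prog
  /-- register `r` gets the result of the operation `o` on the registers `a` and `b` -/
  | op (o : WordOp) (r a b : ℕ) : Prog
  /-- register `r` gets the word in the memory cell whose address is in register `a` -/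
  | load (r a : ℕ) : Prog
  /-- register `r` gets `0`, `1` or `2` when the coordinate in the memory cell whose address is in
  register `a` is less than, equal to or greater than the query coordinate on the axis `ax` -/
  | cmp (r a : ℕ) (ax : Fin 3) : Prog
  /-- append register `r` to the output -/
  | emit (r : ℕ) : Prog
  /-- first `p`, then `p'` -/
  | seq (p p' : Prog) : Prog
  /-- `p` if register `r` is nonzero, and `p'` otherwise -/
  | ite (r : ℕ) (p p' : Prog) : Prog
  /-- repeat `p` as long as register `r` is nonzero -/
  | loop (r : ℕ) (p : Prog) : Prog

/-- Contents of the registers, and the output produced so far. -/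
structure RamState (w : ℕ) where
  reg : ℕ → BitVec w
  out : List (BitVec w)

/-- Write the word `v` to register `r`. -/
def RamState.set {w : ℕ} (s : RamState w) (r : ℕ) (v : BitVec w) : RamState w :=
  { s with reg := Function.update s.reg r v }

open Classical in
/-- Three-way comparison of coordinates. -/
noncomputable def compareCoord (w : ℕ) (c c' : Coord) : BitVec w :=
  if c < c' then BitVec.ofNat w 0 else if c = c' then BitVec.ofNat w 1 else BitVec.ofNat w 2

/-- `Exec M q p s t s'`: with memory `M` and query point `q`, the program `p` started in the state
`s` halts after `t` steps in the state `s'`. Every operation and every test costs one step; a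
program that reads outside the memory, or a cell of the wrong sort, does not halt. -/
inductive Exec {w : ℕ} (M : List (Cell w)) (q : Fin 3 → ℝ) :
    Prog → RamState w → ℕ → RamState w → Prop where
  | skip (s : RamState w) : Exec M q .skip s 1 s
  | const (s : RamState w) (r k : ℕ) : Exec M q (.const r k) s 1 (s.set r (BitVec.ofNat w k))
  | op (s : RamState w) (o : WordOp) (r a b : ℕ) :
      Exec M q (.op o r a b) s 1 (s.set r (o.eval (s.reg a) (s.reg b)))
  | load (s : RamState w) (r a : ℕ) (v : BitVec w)
      (hv : M[(s.reg a).toNat]? = some (.word v)) : Exec M q (.load r a) s 1 (s.set r v)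
  | cmp (s : RamState w) (r a : ℕ) (ax : Fin 3) (c : Coord)
      (hc : M[(s.reg a).toNat]? = some (.coord c)) :
      Exec M q (.cmp r a ax) s 1 (s.set r (compareCoord w c (q ax)))
  | emit (s : RamState w) (r : ℕ) :
      Exec M q (.emit r) s 1 { s with out := s.out ++ [s.reg r] }
  | seq {p p' : Prog} {s s₁ s₂ : RamState w} {t t' : ℕ} (h : Exec M q p s t s₁)
      (h' : Exec M q p' s₁ t' s₂) : Exec M q (.seq p p') s (t + t') s₂
  | iteTrue {r : ℕ} {p p' : Prog} {s s₁ : RamState w} {t : ℕ} (hr : s.reg r ≠ 0)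
      (h : Exec M q p s t s₁) : Exec M q (.ite r p p') s (t + 1) s₁
  | iteFalse {r : ℕ} {p p' : Prog} {s s₁ : RamState w} {t : ℕ} (hr : s.reg r = 0)
      (h : Exec M q p' s t s₁) : Exec M q (.ite r p p') s (t + 1) s₁
  | loopDone {r : ℕ} {p : Prog} {s : RamState w} (hr : s.reg r = 0) : Exec M q (.loop r p) s 1 s
  | loopStep {r : ℕ} {p : Prog} {s s₁ s₂ : RamState w} {t t' : ℕ} (hr : s.reg r ≠ 0)
      (h : Exec M q p s t s₁) (h' : Exec M q (.loop r p) s₁ t' s₂) :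
      Exec M q (.loop r p) s (t + t' + 1) s₂

/-- Started with the words `input` in the registers `0, 1, …` (all other registers are `0`), the
program `p` halts within time `T` with output `result`. -/
def Outputs {w : ℕ} (M : List (Cell w)) (q : Fin 3 → ℝ) (p : Prog) (input : List (BitVec w))
    (T : ℝ) (result : List ℕ) : Prop :=
  ∃ (t : ℕ) (s : RamState w), Exec M q p ⟨fun r => input.getD r 0, []⟩ t s ∧ (t : ℝ) ≤ T ∧
    s.out.map BitVec.toNat = result

/-- The memory `M` holds the bottom lists `Ls`: each list has a handle (the word that names its tree
node) from which, with an index `i`, the program `point` finds the `i`-th entry within time `T`. -/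
def HoldsLists {w n : ℕ} (M : List (Cell w)) (point : Prog) (T : ℝ) (Ls : List (List (Fin n))) :
    Prop :=
  ∀ P ∈ Ls, ∃ handle : BitVec w, ∀ (i : ℕ) (hi : i < P.length) (q : Fin 3 → ℝ),
    Outputs M q point [handle, BitVec.ofNat w i] T [(P[i] : ℕ)]

/-! ### Expressions and a program logic -/

/-! The bottom lists are never written down. In a binary range tree an inner node keeps one bit per
entry of its x-sorted list, telling which child holds that entry. The list of a child is the
parent's list filtered, in the same order (`filter_nodeList`), so an entry's index in the child is
its rank among the entries with the same bit (`nodeList_step`). With `b = ⌊lg n⌋` bits packed into a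
word, a rank is a stored sample plus one lookup in a popcount table (`val_rankExpr`). An entry is
decoded by following it down to its leaf, where the box index is stored.

Going down level by level would cost `lg n` steps. Heights are therefore written in a base `B` of
order `lg^ε n`, with `K = ⌈1/ε⌉` digits, and from height `j` one jumps by the place value of the
lowest nonzero digit (`jumpLen`). Each jump lowers the digit sum by one, so `K * B` jumps suffice
(`digits_sum_le`, `wp_loop_stepDown`). For a jump over `d` levels every entry carries a `d`-bit
digit naming the descendant, and its rank within a superblock of `2 ^ d * b` entries. A jump record
is only needed for `d ≥ B`, and then `b ≤ 2 ^ (K * d)`, so `(K + 2) * d` bits are enough. Over all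
heights the jump lengths add up to at most `K * H` (`sum_jumpLen`) and the tables of descendants to
a geometric sum (`sum_pow_jumpLen`). Hence a tree over `m` points takes `O(m)` words
(`tree_cost_le`).

For a query, comparing a coordinate with the median of an interval tree node discards one subtree
and turns containment in an assigned interval into a one-sided condition (`interval_mem_iff`). Both
interval layers have depth `O(lg n)` (`depth_intervalTree_le`), so `O(lg² n)` dominance queries
remain. In each, the rank of the query among the z-keys selects a stored decomposition into at most
`λ` blocks per height (`exists_runs`), hence `O(λ log_λ n)` planar queries. A planar query makes one
binary search by x; on the way down, ranks translate the prefix length at a node into the prefix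
lengths at its children (`cntSym_countP`), and each level yields at most one prefix. Counting and
reporting are one traversal with different actions on the prefixes (`wp_stabQuery`), and `Collects`
records that the prefixes are disjoint, nonempty and exhaustive.

For the space, each box is assigned to one node per interval tree. A dominance structure over `m`
points has `O(log_λ n)` heights, each with planar trees of total size `O(m)`, and its table of
decompositions has one entry per rank and height (`alloc_spatial`). Summing over the interval trees
(`cost_intervalTree_le`) gives `O(n log_λ n)` words.

Programs are verified in a total-correctness logic `WP` whose states carry a clock. Memory contents
are described by predicates on addresses, and `Alloc` constructs a memory that satisfies them within
a cell budget. -/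

/-- Three-address code is generated from expressions whose values are natural numbers. -/
inductive RExpr where
  | reg (r : ℕ) : RExpr
  | lit (k : ℕ) : RExpr
  | op (o : WordOp) (a b : RExpr) : RExpr
  /-- the word in the cell whose address is the sum of the two values -/
  | ld (a b : RExpr) : RExpr
  /-- the comparison of the coordinate in that cell with the query coordinate -/
  | cmp (a b : RExpr) (ax : Fin 3) : RExpr

/-- The code that computes an expression into register `t`, using no register below `t`. -/
def RExpr.comp : RExpr → ℕ → Prog
  | .reg r, t => .op .or t r r
  | .lit k, t => .const t k
  | .op o a b, t => .seq (a.comp t) (.seq (b.comp (t + 1)) (.op o t t (t + 1)))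
  | .ld a b, t =>
    .seq (a.comp t) (.seq (b.comp (t + 1)) (.seq (.op .add t t (t + 1)) (.load t t)))
  | .cmp a b ax, t =>
    .seq (a.comp t) (.seq (b.comp (t + 1)) (.seq (.op .add t t (t + 1)) (.cmp t t ax)))

def RExpr.cost : RExpr → ℕ
  | .reg _ => 1
  | .lit _ => 1
  | .op _ a b => a.cost + b.cost + 1
  | .ld a b => a.cost + b.cost + 2
  | .cmp a b _ => a.cost + b.cost + 2

/-- Assignment of the value of an expression to a register below `100`. -/
def asg (r : ℕ) (e : RExpr) : Prog := .seq (e.comp 100) (.op .or r 100 100)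

/-- `a ;; b` is sequential composition. -/
infixr:60 " ;; " => Prog.seq

/-- The word in a memory cell, as a number. -/
def wordAt {w : ℕ} (M : List (Cell w)) (a : ℕ) : Option ℕ :=
  match M[a]? with
  | some (.word v) => some v.toNat
  | _ => none

/-- The coordinate in a memory cell. -/
def coordAt {w : ℕ} (M : List (Cell w)) (a : ℕ) : Option Coord :=
  match M[a]? with
  | some (.coord c) => some c
  | _ => none

theorem wordAt_eq {w : ℕ} {M : List (Cell w)} {a v : ℕ} (h : wordAt M a = some v) :
    ∃ u : BitVec w, M[a]? = some (.word u) ∧ u.toNat = v := by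
  unfold wordAt at h
  split at h
  · exact ⟨_, by assumption, by simpa using h⟩
  · simp at h

theorem coordAt_eq {w : ℕ} {M : List (Cell w)} {a : ℕ} {c : Coord} (h : coordAt M a = some c) :
    M[a]? = some (.coord c) := by
  unfold coordAt at h
  split at h
  · simp_all
  · simp at h

theorem wordAt_lt {w : ℕ} {M : List (Cell w)} {a v : ℕ} (h : wordAt M a = some v) : v < 2 ^ w := by
  obtain ⟨u, -, rfl⟩ := wordAt_eq h
  exact u.isLt

theorem wordAt_addr_lt {w : ℕ} {M : List (Cell w)} {a v : ℕ} (h : wordAt M a = some v) :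
    a < M.length := by
  obtain ⟨u, hu, -⟩ := wordAt_eq h
  exact (List.getElem?_eq_some_iff.1 hu).1

theorem coordAt_addr_lt {w : ℕ} {M : List (Cell w)} {a : ℕ} {c : Coord}
    (h : coordAt M a = some c) : a < M.length :=
  (List.getElem?_eq_some_iff.1 (coordAt_eq h)).1

/-- Registers below `100` as numbers, the output, and the time spent. -/
structure AState where
  env : ℕ → ℕ
  out : List ℕ
  time : ℕ

def AState.upd (σ : AState) (r v k : ℕ) : AState :=
  ⟨Function.update σ.env r v, σ.out, σ.time + k⟩

def AState.tick (σ : AState) (k : ℕ) : AState := ⟨σ.env, σ.out, σ.time + k⟩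

@[simp] theorem AState.upd_env (σ : AState) (r v k x : ℕ) :
    (σ.upd r v k).env x = if x = r then v else σ.env x := by
  simp [AState.upd, Function.update_apply]
@[simp] theorem AState.upd_out (σ : AState) (r v k : ℕ) : (σ.upd r v k).out = σ.out := rfl
@[simp] theorem AState.upd_time (σ : AState) (r v k : ℕ) : (σ.upd r v k).time = σ.time + k := rfl
@[simp] theorem AState.tick_env (σ : AState) (k : ℕ) : (σ.tick k).env = σ.env := rfl
@[simp] theorem AState.tick_out (σ : AState) (k : ℕ) : (σ.tick k).out = σ.out := rfl
@[simp] theorem AState.tick_time (σ : AState) (k : ℕ) : (σ.tick k).time = σ.time + k := rfl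

/-- The word operations used on numbers; only an addition may overflow. -/
def WordOp.spec (w : ℕ) : WordOp → ℕ → ℕ → ℕ → Prop
  | .add, x, y, v => v = (x + y) % 2 ^ w
  | .sub, x, y, v => v = x - y ∧ y ≤ x
  | .mul, x, y, v => v = x * y ∧ x * y < 2 ^ w
  | .div, x, y, v => v = x / y
  | .mod, x, y, v => v = x % y
  | .shl, x, y, v => v = x * 2 ^ y ∧ x * 2 ^ y < 2 ^ w
  | .shr, x, y, v => v = x / 2 ^ y
  | .lt, x, y, v => v = if x < y then 1 else 0
  | .eq, x, y, v => v = if x = y then 1 else 0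
  | _, _, _, _ => False

/-- The number that `compareCoord` yields. -/
noncomputable def cmpNat (c c' : Coord) : ℕ :=
  open Classical in if c < c' then 0 else if c = c' then 1 else 2

/-- The expression `e` has the value `v`. -/
def RExpr.Val {w : ℕ} (M : List (Cell w)) (q : Fin 3 → ℝ) (env : ℕ → ℕ) : RExpr → ℕ → Prop
  | .reg r, v => r < 100 ∧ v = env r
  | .lit k, v => v = k ∧ k < 2 ^ w
  | .op o a b, v => ∃ x, a.Val M q env x ∧ ∃ y, b.Val M q env y ∧ o.spec w x y v
  | .ld a b, v => ∃ x, a.Val M q env x ∧ ∃ y, b.Val M q env y ∧ wordAt M (x + y) = some v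
  | .cmp a b ax, v => ∃ x, a.Val M q env x ∧ ∃ y, b.Val M q env y ∧
      ∃ c, coordAt M (x + y) = some c ∧ v = cmpNat c (q ax)

/-- The concrete state `s` is described by `σ`. -/
def Sim {w : ℕ} (s : RamState w) (σ : AState) : Prop :=
  (∀ r < 100, (s.reg r).toNat = σ.env r) ∧ s.out.map BitVec.toNat = σ.out

theorem WordOp.eval_of_spec {w : ℕ} (hw : 1 ≤ w) {o : WordOp} {a b : BitVec w} {v : ℕ}
    (h : o.spec w a.toNat b.toNat v) : (o.eval a b).toNat = v := by
  have h1 : 1 % 2 ^ w = 1 := Nat.mod_eq_of_lt (Nat.one_lt_two_pow (by omega))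
  cases o <;> simp only [WordOp.spec] at h <;> simp only [WordOp.eval]
  · rw [BitVec.toNat_add, h]
  · rw [BitVec.toNat_sub, h.1]
    have := a.isLt
    have := b.isLt
    have h2 : 2 ^ w - b.toNat + a.toNat = (a.toNat - b.toNat) + 2 ^ w := by omega
    rw [h2, Nat.add_mod_right, Nat.mod_eq_of_lt (by omega)]
  · rw [BitVec.toNat_mul, Nat.mod_eq_of_lt h.2, h.1]
  · rw [BitVec.toNat_udiv, h]
  · rw [BitVec.toNat_umod, h]
  · rw [BitVec.shiftLeft_eq', BitVec.toNat_shiftLeft, Nat.shiftLeft_eq, Nat.mod_eq_of_lt h.2, h.1]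
  · rw [BitVec.ushiftRight_eq', BitVec.toNat_ushiftRight, Nat.shiftRight_eq_div_pow, h]
  · rw [h]; split <;> simp [h1]
  · rw [h]
    by_cases hab : a = b
    · simp [hab, h1]
    · have : a.toNat ≠ b.toNat := fun h => hab (BitVec.eq_of_toNat_eq h)
      simp [hab, this]

theorem toNat_compareCoord {w : ℕ} (hw : 2 ≤ w) (c c' : Coord) :
    (compareCoord w c c').toNat = cmpNat c c' := by
  have h4 : 2 ^ 2 ≤ 2 ^ w := Nat.pow_le_pow_right (by norm_num) hw
  unfold compareCoord cmpNat
  split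
  · simp
  · split <;> simp only [BitVec.toNat_ofNat] <;> exact Nat.mod_eq_of_lt (by omega)

section
variable {w : ℕ} {M : List (Cell w)} {q : Fin 3 → ℝ}

/-- The registers from `t` on serve as an evaluation stack. That no register below `t` changes keeps
the first operand intact while the second is computed, and keeps the program variables, all below
`100`, untouched. -/
theorem RExpr.exec_comp (hw : 2 ≤ w) (hM : M.length ≤ 2 ^ w) {env : ℕ → ℕ} (e : RExpr) :
    ∀ {v : ℕ}, e.Val M q env v → ∀ (t : ℕ), 100 ≤ t → ∀ s : RamState w,
      (∀ r < 100, (s.reg r).toNat = env r) →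
      ∃ s', Exec M q (e.comp t) s e.cost s' ∧ (s'.reg t).toNat = v ∧
        (∀ r < t, s'.reg r = s.reg r) ∧ s'.out = s.out := by
  induction e with
  | reg r =>
    rintro v ⟨hr, rfl⟩ t ht s hs
    refine ⟨_, Exec.op s .or t r r, ?_, ?_, rfl⟩
    · simp [RamState.set, WordOp.eval, hs r hr]
    · intro r' hr'
      simp [RamState.set, hr'.ne]
  | lit k =>
    rintro v ⟨rfl, hv⟩ t ht s hs
    refine ⟨_, Exec.const s t v, ?_, ?_, rfl⟩
    · simp [RamState.set, Nat.mod_eq_of_lt hv]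
    · intro r' hr'
      simp [RamState.set, hr'.ne]
  | op o a b iha ihb =>
    rintro v ⟨x, hx, y, hy, h⟩ t ht s hs
    obtain ⟨s₁, e₁, v₁, f₁, o₁⟩ := iha hx t ht s hs
    obtain ⟨s₂, e₂, v₂, f₂, o₂⟩ := ihb hy (t + 1) (by omega) s₁
      (fun r hr => by rw [f₁ r (by omega), hs r hr])
    have h1 : (s₂.reg t).toNat = x := by rw [f₂ t (by omega), v₁]
    refine ⟨(s₂.set t (o.eval (s₂.reg t) (s₂.reg (t + 1)))), ?_, ?_, ?_, ?_⟩
    rotate_left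
    · simp only [RamState.set, Function.update_self]
      exact WordOp.eval_of_spec (by omega) (by rwa [h1, v₂])
    · intro r hr
      simp only [RamState.set, Function.update_of_ne hr.ne]
      rw [f₂ r (by omega), f₁ r hr]
    · simp [RamState.set, o₂, o₁]
    · have := e₁.seq (e₂.seq (Exec.op s₂ o t t (t + 1)))
      simpa [RExpr.comp, RExpr.cost, add_assoc] using this
  | ld a b iha ihb =>
    rintro v ⟨x, hx, y, hy, h⟩ t ht s hs
    obtain ⟨s₁, e₁, v₁, f₁, o₁⟩ := iha hx t ht s hs
    obtain ⟨s₂, e₂, v₂, f₂, o₂⟩ := ihb hy (t + 1) (by omega) s₁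
      (fun r hr => by rw [f₁ r (by omega), hs r hr])
    have h1 : (s₂.reg t).toNat = x := by rw [f₂ t (by omega), v₁]
    have hlt := wordAt_addr_lt h
    obtain ⟨u, hu, rfl⟩ := wordAt_eq h
    -- The sum is the address of an existing cell, hence below `2 ^ w`: address arithmetic does not
    -- wrap around.
    have h3 : (s₂.reg t + s₂.reg (t + 1)).toNat = x + y := by
      rw [BitVec.toNat_add, h1, v₂, Nat.mod_eq_of_lt (by omega)]
    refine ⟨((s₂.set t (s₂.reg t + s₂.reg (t + 1))).set t u), ?_, ?_, ?_, ?_⟩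
    rotate_left
    · simp [RamState.set]
    · intro r hr
      simp only [RamState.set, Function.update_of_ne hr.ne]
      rw [f₂ r (by omega), f₁ r hr]
    · simp [RamState.set, o₂, o₁]
    · have := e₁.seq (e₂.seq ((Exec.op s₂ .add t t (t + 1)).seq
        (Exec.load _ t t u (by simpa [RamState.set, WordOp.eval, h3] using hu))))
      simpa [RExpr.comp, RExpr.cost, add_assoc, WordOp.eval] using this
  | cmp a b ax iha ihb =>
    rintro v ⟨x, hx, y, hy, c, h, rfl⟩ t ht s hs
    obtain ⟨s₁, e₁, v₁, f₁, o₁⟩ := iha hx t ht s hs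
    obtain ⟨s₂, e₂, v₂, f₂, o₂⟩ := ihb hy (t + 1) (by omega) s₁
      (fun r hr => by rw [f₁ r (by omega), hs r hr])
    have h1 : (s₂.reg t).toNat = x := by rw [f₂ t (by omega), v₁]
    have hlt := coordAt_addr_lt h
    have hu := coordAt_eq h
    have h3 : (s₂.reg t + s₂.reg (t + 1)).toNat = x + y := by
      rw [BitVec.toNat_add, h1, v₂, Nat.mod_eq_of_lt (by omega)]
    refine ⟨((s₂.set t (s₂.reg t + s₂.reg (t + 1))).set t (compareCoord w c (q ax))), ?_, ?_, ?_, ?_⟩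
    rotate_left
    · simp [RamState.set, toNat_compareCoord hw]
    · intro r hr
      simp only [RamState.set, Function.update_of_ne hr.ne]
      rw [f₂ r (by omega), f₁ r hr]
    · simp [RamState.set, o₂, o₁]
    · have := e₁.seq (e₂.seq ((Exec.op s₂ .add t t (t + 1)).seq
        (Exec.cmp _ t t ax c (by simpa [RamState.set, WordOp.eval, h3] using hu))))
      simpa [RExpr.comp, RExpr.cost, add_assoc, WordOp.eval] using this

/-- Total correctness: started in a state described by `σ`, the program halts in a state described
by some `σ'` with `Q σ'`, and the time it takes is the difference of the two time stamps. -/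
def WP (M : List (Cell w)) (q : Fin 3 → ℝ) (p : Prog) (σ : AState) (Q : AState → Prop) : Prop :=
  ∀ s : RamState w, Sim s σ →
    ∃ t s' σ', Exec M q p s t s' ∧ Sim s' σ' ∧ σ'.time = σ.time + t ∧ Q σ'

theorem WP.mono {p : Prog} {σ : AState} {Q Q' : AState → Prop} (h : WP M q p σ Q)
    (hQ : ∀ σ', Q σ' → Q' σ') : WP M q p σ Q' := fun s hs => by
  obtain ⟨t, s', σ', h1, h2, h3, h4⟩ := h s hs
  exact ⟨t, s', σ', h1, h2, h3, hQ _ h4⟩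

theorem WP.seq {p p' : Prog} {σ : AState} {Q : AState → Prop}
    (h : WP M q p σ fun σ' => WP M q p' σ' Q) : WP M q (p ;; p') σ Q := fun s hs => by
  obtain ⟨t, s', σ', h1, h2, h3, h4⟩ := h s hs
  obtain ⟨t', s'', σ'', h1', h2', h3', h4'⟩ := h4 s' h2
  exact ⟨_, s'', σ'', h1.seq h1', h2', by omega, h4'⟩

theorem WP.skip {σ : AState} {Q : AState → Prop} (h : Q (σ.tick 1)) : WP M q .skip σ Q :=
  fun s hs => ⟨_, s, σ.tick 1, .skip s, hs, rfl, h⟩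

theorem WP.emit {r : ℕ} (hr : r < 100) {σ : AState} {Q : AState → Prop}
    (h : Q ⟨σ.env, σ.out ++ [σ.env r], σ.time + 1⟩) : WP M q (.emit r) σ Q :=
  fun s hs => ⟨_, _, ⟨σ.env, σ.out ++ [σ.env r], σ.time + 1⟩, .emit s r, ⟨hs.1, by simp [hs.2, hs.1 r hr]⟩, rfl, h⟩

theorem WP.asg (hw : 2 ≤ w) (hM : M.length ≤ 2 ^ w) {r v : ℕ} (hr : r < 100) {e : RExpr}
    {σ : AState} {Q : AState → Prop}
    (he : e.Val M q σ.env v) (h : Q (σ.upd r v (e.cost + 1))) : WP M q (asg r e) σ Q :=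
  fun s hs => by
  obtain ⟨s₁, e₁, v₁, f₁, o₁⟩ := e.exec_comp hw hM he 100 le_rfl s hs.1
  refine ⟨_, _, _, e₁.seq (Exec.op s₁ .or r 100 100), ?_, rfl, h⟩
  refine ⟨fun r' hr' => ?_, by simp [RamState.set, o₁, hs.2]⟩
  by_cases h' : r' = r
  · subst h'
    simp [RamState.set, WordOp.eval, v₁]
  · simp [RamState.set, h', f₁ r' hr', hs.1 r' hr']

theorem WP.ite {r : ℕ} (hr : r < 100) {p p' : Prog} {σ : AState} {Q : AState → Prop}
    (h : σ.env r ≠ 0 → WP M q p (σ.tick 1) Q) (h' : σ.env r = 0 → WP M q p' (σ.tick 1) Q) :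
    WP M q (.ite r p p') σ Q := fun s hs => by
  by_cases h0 : σ.env r = 0
  · obtain ⟨t, s', σ', h1, h2, h3, h4⟩ := h' h0 s hs
    have : s.reg r = 0 := BitVec.eq_of_toNat_eq (by simpa using (hs.1 r hr).trans h0)
    exact ⟨_, s', σ', .iteFalse this h1, h2, by simp at h3; omega, h4⟩
  · obtain ⟨t, s', σ', h1, h2, h3, h4⟩ := h h0 s hs
    have : s.reg r ≠ 0 := fun e => h0 (by rw [← hs.1 r hr, e]; simp)
    exact ⟨_, s', σ', .iteTrue this h1, h2, by simp at h3; omega, h4⟩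

theorem WP.loop_done {r : ℕ} (hr : r < 100) {p : Prog} {σ : AState} {Q : AState → Prop}
    (h0 : σ.env r = 0) (h : Q (σ.tick 1)) : WP M q (.loop r p) σ Q := fun s hs => by
  have : s.reg r = 0 := BitVec.eq_of_toNat_eq (by simpa using (hs.1 r hr).trans h0)
  exact ⟨_, s, σ.tick 1, .loopDone this, hs, rfl, h⟩

theorem WP.loop_step {r : ℕ} (hr : r < 100) {p : Prog} {σ : AState} {Q : AState → Prop}
    (h0 : σ.env r ≠ 0) (h : WP M q p (σ.tick 1) fun σ' => WP M q (.loop r p) σ' Q) :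
    WP M q (.loop r p) σ Q := fun s hs => by
  obtain ⟨t, s', σ', h1, h2, h3, h4⟩ := h s hs
  obtain ⟨t', s'', σ'', h1', h2', h3', h4'⟩ := h4 s' h2
  have : s.reg r ≠ 0 := fun e => h0 (by rw [← hs.1 r hr, e]; simp)
  exact ⟨_, s'', σ'', .loopStep this h1 h1', h2', by simp at h3; omega, h4'⟩

/-- A triple about states of the logic yields a statement about runs of the machine. -/
theorem WP.outputs {p : Prog} {input : List (BitVec w)} {T : ℕ} {result : List ℕ}
    (h : WP M q p ⟨fun r => (input.getD r 0).toNat, [], 0⟩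
      fun σ => σ.time ≤ T ∧ σ.out = result) : Outputs M q p input T result := by
  obtain ⟨t, s', σ', h1, h2, h3, h4, h5⟩ :=
    h ⟨fun r => input.getD r 0, []⟩ ⟨fun _ _ => rfl, rfl⟩
  refine ⟨t, s', h1, ?_, h2.2.trans h5⟩
  simp only [zero_add] at h3
  exact_mod_cast h3 ▸ h4

end

/-! ### Sorted lists and blocks of lists -/

/-- The order by which `sortByKey` sorts. -/
def KeyLE {n : ℕ} (key : Fin n → Coord) (i j : Fin n) : Prop :=
  toLex (key i, i) ≤ toLex (key j, j)

theorem KeyLE.key_le {n : ℕ} {key : Fin n → Coord} {i j : Fin n} (h : KeyLE key i j) :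
    key i ≤ key j := by
  rcases (Prod.Lex.toLex_le_toLex).1 h with h | h
  · exact h.le
  · exact h.1.le

theorem KeyLE.antisymm {n : ℕ} {key : Fin n → Coord} {i j : Fin n} (h : KeyLE key i j)
    (h' : KeyLE key j i) : i = j := by
  have := le_antisymm h h'
  simpa using (congrArg (fun p => (ofLex p).2) this)

section sortByKey
variable {n : ℕ} (key : Fin n → Coord) (S : Finset (Fin n))

theorem mem_sortByKey {i : Fin n} : i ∈ sortByKey key S ↔ i ∈ S := by
  simp [sortByKey]

theorem pairwise_sortByKey : (sortByKey key S).Pairwise (KeyLE key) := by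
  unfold sortByKey
  rw [List.pairwise_map]
  refine List.Pairwise.imp_of_mem ?_ (Finset.pairwise_sort _ (· ≤ ·))
  intro a b ha hb hab
  simp only [Finset.mem_sort, Finset.mem_image] at ha hb
  obtain ⟨i, -, rfl⟩ := ha
  obtain ⟨j, -, rfl⟩ := hb
  exact hab

theorem nodup_sortByKey : (sortByKey key S).Nodup := by
  unfold sortByKey
  refine List.Nodup.map_on ?_ (Finset.sort_nodup _ _)
  intro a ha b hb hab
  simp only [Finset.mem_sort, Finset.mem_image] at ha hb
  obtain ⟨i, -, rfl⟩ := ha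
  obtain ⟨j, -, rfl⟩ := hb
  simp only [ofLex_toLex] at hab
  rw [hab]

theorem length_sortByKey : (sortByKey key S).length = S.card := by
  classical
  rw [← List.toFinset_card_of_nodup (nodup_sortByKey key S)]
  congr 1
  ext i
  simp [mem_sortByKey]

-- The tie-breaking by index makes the order antisymmetric, so a sorted duplicate-free enumeration
-- of a set is unique.
variable {key S} in
theorem eq_sortByKey {l : List (Fin n)} (hl : l.Nodup) (hp : l.Pairwise (KeyLE key))
    (hm : ∀ i, i ∈ l ↔ i ∈ S) : l = sortByKey key S := by
  have hperm : l.Perm (sortByKey key S) :=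
    (List.perm_ext_iff_of_nodup hl (nodup_sortByKey key S)).2
      fun i => by rw [hm, mem_sortByKey]
  exact hperm.eq_of_pairwise (fun a b _ _ h h' => h.antisymm h') hp (pairwise_sortByKey key S)

/-- Sorting commutes with filtering; this is what makes the list of a descendant a subsequence of
the list of its ancestor. -/
theorem filter_sortByKey (p : Fin n → Bool) :
    (sortByKey key S).filter p = sortByKey key (S.filter fun i => p i = true) := by
  refine eq_sortByKey ((nodup_sortByKey key S).filter _) ((pairwise_sortByKey key S).filter _) ?_
  intro i
  simp [mem_sortByKey]

end sortByKey

section lists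
variable {α : Type*}

/-- The `t`-th block of `k` consecutive entries of `L`. -/
def List.block (L : List α) (k t : ℕ) : List α := (L.drop (t * k)).take k

/-- The accumulator is the chunk under construction; it is pushed only when one more element
arrives, so a full accumulator is allowed. -/
theorem List.toChunks_go_eq (k : ℕ) : ∀ (xs : List α) (acc : Array α) (res : Array (List α)),
    acc.size ≤ k → 1 ≤ acc.size →
    List.toChunks.go k xs acc res =
      res.toList ++ ((acc.toList ++ xs).take k :: ((acc.toList ++ xs).drop k).toChunks k)
  | [], acc, res, h, _ => by
    rw [List.toChunks.go]
    have h1 : acc.toList.take k = acc.toList := List.take_of_length_le (by simpa using h)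
    have h2 : acc.toList.drop k = [] := List.drop_of_length_le (by simpa using h)
    cases k <;> simp [h1, h2, List.toChunks]
  | x :: xs, acc, res, h, h1 => by
    rw [List.toChunks.go]
    by_cases hk : acc.size = k
    · have hk' : (acc.size == k) = true := by simpa using hk
      rw [if_pos hk', List.toChunks_go_eq k xs _ _ (by simp; omega) (by simp)]
      have h3 : (acc.toList ++ x :: xs).take k = acc.toList := by
        rw [List.take_left' (by simpa using hk)]
      have h4 : (acc.toList ++ x :: xs).drop k = x :: xs := by
        rw [List.drop_left' (by simpa using hk)]
      rw [h3, h4]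
      obtain ⟨k, rfl⟩ : ∃ k', k = k' + 1 := ⟨k - 1, by omega⟩
      rw [List.toChunks, List.toChunks_go_eq _ xs #[x] #[] (by simp) (by simp)]
      · simp
      · omega
    · have hk' : ¬ (acc.size == k) = true := by simpa using hk
      rw [if_neg hk', List.toChunks_go_eq k xs _ _ (by simp; omega) (by simp)]
      simp

theorem List.toChunks_eq_cons {k : ℕ} (hk : 1 ≤ k) {L : List α} (hL : L ≠ []) :
    L.toChunks k = L.take k :: (L.drop k).toChunks k := by
  cases L with
  | nil => exact absurd rfl hL
  | cons x xs =>
    obtain ⟨k, rfl⟩ : ∃ k', k = k' + 1 := ⟨k - 1, by omega⟩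
    rw [List.toChunks, List.toChunks_go_eq _ xs #[x] #[] (by simp) (by simp)]
    · simp
    · omega

theorem List.mem_toChunks {k : ℕ} (hk : 1 ≤ k) (V : List α) : ∀ (L : List α),
    V ∈ L.toChunks k ↔ ∃ t, t * k < L.length ∧ V = L.block k t := by
  intro L
  induction h : L.length using Nat.strong_induction_on generalizing L with
  | _ m ih =>
    subst h
    by_cases hL : L = []
    · subst hL
      cases k <;> simp [List.toChunks]
    · have hpos : 0 < L.length := List.length_pos_iff.2 hL
      rw [List.toChunks_eq_cons hk hL, List.mem_cons,
        ih (L.drop k).length (by simp; omega) _ rfl]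
      constructor
      · rintro (rfl | ⟨t, ht, rfl⟩)
        · exact ⟨0, by simpa using hpos, by simp [List.block]⟩
        · refine ⟨t + 1, ?_, ?_⟩
          · simp at ht; rw [add_mul]; omega
          · simp [List.block, add_mul, add_comm]
      · rintro ⟨t, ht, rfl⟩
        cases t with
        | zero => left; simp [List.block]
        | succ t =>
          right
          refine ⟨t, ?_, ?_⟩
          · simp; rw [add_mul] at ht; omega
          · simp [List.block, add_mul, add_comm]

/-- The rule for translating indices: in a filtered list, a surviving entry is preceded exactly by
the surviving entries that preceded it before. -/
theorem List.getElem?_filter_countP (l : List α) (p : α → Bool) {i : ℕ} (hi : i < l.length)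
    (h : p l[i] = true) : (l.filter p)[(l.take i).countP p]? = some l[i] := by
  have h1 : l = l.take i ++ (l[i] :: l.drop (i + 1)) := by simp
  conv_lhs => rw [h1]
  rw [List.filter_append, List.filter_cons_of_pos h]
  have h2 : ((l.take i ++ (l[i] :: l.drop (i + 1))).take i) = l.take i := by simp
  rw [h2, List.countP_eq_length_filter]
  simp

/-- In a list on which `p` is downward closed, the entries with `p` form a prefix. -/
theorem List.take_countP_eq_filter {R : α → α → Prop} {p : α → Bool} (l : List α)
    (hl : l.Pairwise R) (hp : ∀ a b, R a b → p b = true → p a = true) :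
    l.take (l.countP p) = l.filter p := by
  induction l with
  | nil => simp
  | cons a l ih =>
    rw [List.pairwise_cons] at hl
    by_cases h : p a = true
    · simp [h, ih hl.2]
    · have h0 : l.filter p = [] := by
        rw [List.filter_eq_nil_iff]
        intro b hb hpb
        exact h (hp a b (hl.1 b hb) hpb)
      have : l.countP p = 0 := by rw [List.countP_eq_length_filter, h0]; rfl
      simp [h, this, h0]

theorem List.mem_block [DecidableEq α] {L : List α} (hL : L.Nodup) {k : ℕ} (hk : 1 ≤ k) {t : ℕ}
    {x : α} : x ∈ L.block k t ↔ x ∈ L ∧ L.idxOf x / k = t := by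
  rw [List.block, List.mem_iff_getElem?]
  constructor
  · rintro ⟨r, hr⟩
    rw [List.getElem?_take] at hr
    split at hr
    · rw [List.getElem?_drop] at hr
      obtain ⟨h1, h2⟩ := List.getElem?_eq_some_iff.1 hr
      refine ⟨h2 ▸ List.getElem_mem _, ?_⟩
      have : L.idxOf x = t * k + r := by rw [← h2, hL.idxOf_getElem]
      rw [this, Nat.mul_comm, Nat.mul_add_div (by omega), Nat.div_eq_of_lt (by assumption)]
      rfl
    · simp at hr
  · rintro ⟨h1, h2⟩
    have h3 := List.idxOf_lt_length_iff.2 h1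
    have h4 := Nat.div_add_mod (L.idxOf x) k
    have h5 := Nat.mod_lt (L.idxOf x) (show 0 < k by omega)
    rw [h2] at h4
    refine ⟨L.idxOf x % k, ?_⟩
    rw [List.getElem?_take, if_pos h5, List.getElem?_drop, mul_comm t, h4]
    exact List.getElem?_idxOf h1

end lists

/-! ### The x-sorted lists of the nodes of a binary range tree -/

section nodeList
variable {n : ℕ} (x : Fin n → Coord) (W : List (Fin n))

/-- The bottom list of the `t`-th node at height `j` of the binary range tree with leaves `W`. -/
noncomputable def nodeList (j t : ℕ) : List (Fin n) := sortByKey x (W.block (2 ^ j) t).toFinset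

variable {W}

theorem mem_nodeList (hW : W.Nodup) {j t : ℕ} {i : Fin n} :
    i ∈ nodeList x W j t ↔ i ∈ W ∧ W.idxOf i / 2 ^ j = t := by
  rw [nodeList, mem_sortByKey, List.mem_toFinset, List.mem_block hW Nat.one_le_two_pow]

/-- Both lists are sorted by the same key, and the leaves of the descendant form a subset cut out by
the leaf position; `filter_sortByKey` does the rest. -/
theorem filter_nodeList (hW : W.Nodup) {j d t t' : ℕ} (ht : t' / 2 ^ d = t) :
    (nodeList x W (j + d) t).filter (fun i => W.idxOf i / 2 ^ j = t') = nodeList x W j t' := by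
  unfold nodeList
  rw [filter_sortByKey]
  congr 1
  ext i
  simp only [Finset.mem_filter, List.mem_toFinset, decide_eq_true_eq,
    List.mem_block hW Nat.one_le_two_pow]
  constructor
  · rintro ⟨⟨h1, -⟩, h2⟩
    exact ⟨h1, h2⟩
  · rintro ⟨h1, h2⟩
    exact ⟨⟨h1, by rw [pow_add, ← Nat.div_div_eq_div_mul, h2, ht]⟩, h2⟩

theorem length_nodeList_le (j t : ℕ) : (nodeList x W j t).length ≤ 2 ^ j := by
  rw [nodeList, length_sortByKey]
  refine (List.toFinset_card_le _).trans ?_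
  simp [List.block]

end nodeList

/-- The planar lists are the lists of the nodes of the range tree. -/
theorem mem_planarLists {n : ℕ} {x y : Fin n → Coord} {S : Finset (Fin n)} {P : List (Fin n)} :
    P ∈ planarLists x y S ↔ ∃ j t, j ≤ Nat.clog 2 S.card ∧ t * 2 ^ j < S.card ∧
      P = nodeList x (sortByKey y S) j t := by
  simp only [planarLists, rangeTreeNodes, List.mem_map, List.mem_flatMap, List.mem_range,
    length_sortByKey, Nat.lt_succ_iff, nodeList]
  constructor
  · rintro ⟨V, ⟨j, hj, hV⟩, rfl⟩
    obtain ⟨t, ht, rfl⟩ := (List.mem_toChunks Nat.one_le_two_pow V _).1 hV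
    exact ⟨j, t, hj, by rwa [length_sortByKey] at ht, rfl⟩
  · rintro ⟨j, t, hj, ht, rfl⟩
    exact ⟨_, ⟨j, hj, (List.mem_toChunks Nat.one_le_two_pow _ _).2
      ⟨t, by rwa [length_sortByKey], rfl⟩⟩, rfl⟩

theorem mem_dominanceLists {n lam : ℕ} (hlam : 1 ≤ lam) {x y z : Fin n → Coord}
    {S : Finset (Fin n)} {P : List (Fin n)} :
    P ∈ dominanceLists lam x y z S ↔ ∃ j t, j ≤ Nat.clog lam S.card ∧ t * lam ^ j < S.card ∧
      P ∈ planarLists x y ((sortByKey z S).block (lam ^ j) t).toFinset := by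
  simp only [dominanceLists, rangeTreeNodes, List.mem_flatMap, List.mem_range,
    length_sortByKey, Nat.lt_succ_iff]
  have h1 : ∀ j, 1 ≤ lam ^ j := fun j => Nat.one_le_pow _ _ hlam
  constructor
  · rintro ⟨V, ⟨j, hj, hV⟩, hP⟩
    obtain ⟨t, ht, rfl⟩ := (List.mem_toChunks (h1 j) V _).1 hV
    exact ⟨j, t, hj, by rwa [length_sortByKey] at ht, hP⟩
  · rintro ⟨j, t, hj, ht, hP⟩
    exact ⟨_, ⟨j, hj, (List.mem_toChunks (h1 j) _ _).2
      ⟨t, by rwa [length_sortByKey], rfl⟩⟩, hP⟩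

theorem mem_bottomLists {n lam : ℕ} {B : Fin n → CanonicalBox} {P : List (Fin n)} :
    P ∈ bottomLists lam B ↔
      ∃ I ∈ (intervalTree (fun i => ((B i).z₁ : Coord)) (fun i => (B i).z₂) Finset.univ).nodeSets,
      ∃ J ∈ (intervalTree (fun i => ((B i).y₁ : Coord)) (fun i => (B i).y₂) I).nodeSets,
      ∃ dz dy : Bool, P ∈ dominanceLists lam (fun i => ((B i).x₁ : Coord))
        (fun i => if dy then ((B i).y₁ : Coord) else (B i).y₂)
        (fun i => if dz then ((B i).z₁ : Coord) else (B i).z₂) J := by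
  simp only [bottomLists, List.mem_flatMap, List.mem_append, Bool.exists_bool]
  refine exists_congr fun I => and_congr_right fun _ => exists_congr fun J =>
    and_congr_right fun _ => ?_
  simp only [Bool.false_eq_true, if_false, if_true]
  tauto

/-! ### Packed arrays -/

/-- The number with the digits `f 0, …, f (e - 1)` in base `G`, the least significant first. -/
def packDigits (G e : ℕ) (f : ℕ → ℕ) : ℕ := ∑ r ∈ Finset.range e, f r * G ^ r

theorem packDigits_lt {G : ℕ} {f : ℕ → ℕ} (hf : ∀ r, f r < G) (e : ℕ) :
    packDigits G e f < G ^ e := by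
  induction e with
  | zero => simp [packDigits]
  | succ e ih =>
    rw [packDigits, Finset.sum_range_succ]
    have h1 : packDigits G e f + f e * G ^ e < G ^ e + f e * G ^ e := by omega
    have h2 : (f e + 1) * G ^ e ≤ G * G ^ e := Nat.mul_le_mul_right _ (hf e)
    rw [pow_succ, mul_comm (G ^ e)]
    unfold packDigits at h1
    linarith

theorem packDigits_split {G : ℕ} {f : ℕ → ℕ} {e r : ℕ} (hr : r ≤ e) :
    packDigits G e f = packDigits G r f + G ^ r * packDigits G (e - r) (fun i => f (r + i)) := by
  obtain ⟨d, rfl⟩ := Nat.exists_eq_add_of_le hr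
  simp only [packDigits, Finset.sum_range_add, Nat.add_sub_cancel_left, Finset.mul_sum]
  congr 1
  refine Finset.sum_congr rfl fun i _ => ?_
  ring

theorem packDigits_mod {G : ℕ} {f : ℕ → ℕ} (hf : ∀ r, f r < G) {e r : ℕ} (hr : r ≤ e) :
    packDigits G e f % G ^ r = packDigits G r f := by
  rw [packDigits_split hr, Nat.add_mul_mod_self_left, Nat.mod_eq_of_lt (packDigits_lt hf r)]

theorem packDigits_digit {G : ℕ} {f : ℕ → ℕ} (hf : ∀ r, f r < G) {e r : ℕ} (hr : r < e) :
    packDigits G e f / G ^ r % G = f r := by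
  have hG : 0 < G ^ r := Nat.pow_pos ((Nat.zero_le _).trans_lt (hf 0))
  rw [packDigits_split hr.le, Nat.add_mul_div_left _ _ hG,
    Nat.div_eq_of_lt (packDigits_lt hf r), zero_add]
  have := packDigits_mod (f := fun i => f (r + i)) (fun i => hf _) (e := e - r) (r := 1) (by omega)
  rw [pow_one] at this
  rw [this]
  simp [packDigits]

/-- The number of ones among the `b` lowest bits. -/
def popcount (b v : ℕ) : ℕ := ∑ r ∈ Finset.range b, v / 2 ^ r % 2

theorem popcount_le (b v : ℕ) : popcount b v ≤ b := by
  refine (Finset.sum_le_card_nsmul _ _ 1 fun r _ => ?_).trans (by simp)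
  omega

/-- Masking a packed block to its lowest `r` bits leaves the packing of `r` digits, so that one
table for `b`-bit arguments answers every rank within a block. -/
theorem popcount_packDigits {f : ℕ → ℕ} (hf : ∀ r, f r < 2) {b r : ℕ} (hr : r ≤ b) :
    popcount b (packDigits 2 r f) = ∑ i ∈ Finset.range r, f i := by
  obtain ⟨d, rfl⟩ := Nat.exists_eq_add_of_le hr
  rw [popcount, Finset.sum_range_add]
  have h2 : ∑ i ∈ Finset.range d, packDigits 2 r f / 2 ^ (r + i) % 2 = 0 := by
    refine Finset.sum_eq_zero fun i _ => ?_
    rw [Nat.div_eq_of_lt ((packDigits_lt hf r).trans_le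
      (Nat.pow_le_pow_right (by norm_num) (by omega))), Nat.zero_mod]
  rw [h2, add_zero]
  exact Finset.sum_congr rfl fun i hi => packDigits_digit hf (Finset.mem_range.1 hi)

theorem List.countP_take_eq_sum {α : Type*} (l : List α) (p : α → Bool) {f : ℕ → ℕ}
    (hf : ∀ i (hi : i < l.length), f i = if p l[i] = true then 1 else 0) {i : ℕ}
    (hi : i ≤ l.length) : (l.take i).countP p = ∑ r ∈ Finset.range i, f r := by
  induction i with
  | zero => simp
  | succ i ih =>
    rw [Finset.sum_range_succ, ← ih (by omega), hf i hi, List.take_succ_eq_append_getElem hi,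
      List.countP_append]
    simp [List.countP_cons]

theorem List.countP_take_add {α : Type*} (l : List α) (p : α → Bool) (i k : ℕ) :
    (l.take (i + k)).countP p = (l.take i).countP p + ((l.drop i).take k).countP p := by
  rw [List.take_add, List.countP_append]

/-! ### Digit sums -/

/-- Lowering the lowest nonzero digit. -/
theorem exists_pow_dvd_digits_sum {B : ℕ} (hB : 2 ≤ B) : ∀ j, 0 < j →
    ∃ e, B ^ e ∣ j ∧ (Nat.digits B (j - B ^ e)).sum + 1 = (Nat.digits B j).sum := by
  have key : ∀ m, (Nat.digits B m).sum = m % B + (Nat.digits B (m / B)).sum := by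
    intro m
    rcases Nat.eq_zero_or_pos m with rfl | hm
    · simp
    · rw [Nat.digits_def' (by omega) hm, List.sum_cons]
  intro j
  induction j using Nat.strong_induction_on with
  | _ j ih =>
    intro hj
    -- A trailing zero digit is stripped and the exponent found for `j / B` is raised by one;
    -- otherwise the last digit itself is lowered, with exponent `0`.
    by_cases hd : B ∣ j
    · obtain ⟨j', rfl⟩ := hd
      have hj' : 0 < j' := Nat.pos_of_mul_pos_left hj
      obtain ⟨e, he, hs⟩ := ih j' (by nlinarith) hj'
      refine ⟨e + 1, by rw [pow_succ, mul_comm B]; exact Nat.mul_dvd_mul_right he B, ?_⟩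
      have : B * j' - B ^ (e + 1) = B * (j' - B ^ e) := by
        rw [Nat.mul_sub, pow_succ, mul_comm B (B ^ e)]
      rw [key, key (B * j'), this]
      simp only [Nat.mul_mod_right, zero_add]
      rw [Nat.mul_div_cancel_left _ (by omega), Nat.mul_div_cancel_left _ (by omega), hs]
    · refine ⟨0, by simp, ?_⟩
      have h1 : 0 < j % B := Nat.pos_of_ne_zero fun h => hd (Nat.dvd_of_mod_eq_zero h)
      have h2 := Nat.div_add_mod j B
      have h3 := Nat.mod_lt j (show 0 < B by omega)
      have h4 : j - 1 = B * (j / B) + (j % B - 1) := by omega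
      rw [pow_zero, key, key j]
      have h5 : (j - 1) % B = j % B - 1 := by
        rw [h4, Nat.mul_add_mod, Nat.mod_eq_of_lt (by omega)]
      have h6 : (j - 1) / B = j / B := by
        rw [h4, Nat.mul_add_div (by omega), Nat.div_eq_of_lt (show j % B - 1 < B by omega), add_zero]
      rw [h5, h6]
      omega

/-- There are at most `K` digits, each below `B`. The digit sum is the number of jumps to the
leaves. -/
theorem digits_sum_le {B K j : ℕ} (hB : 2 ≤ B) (hj : j < B ^ K) :
    (Nat.digits B j).sum ≤ K * B := by
  have h1 : (Nat.digits B j).length ≤ K := (Nat.digits_length_le_iff (by omega) _).2 hj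
  have h2 := List.sum_le_card_nsmul (Nat.digits B j) B
    fun d hd => (Nat.digits_lt_base (by omega) hd).le
  rw [smul_eq_mul] at h2
  exact h2.trans (Nat.mul_le_mul_right _ h1)

/-! ### Jump lengths and their sums -/

open Classical in
/-- How far one jumps down from height `j`: by the value of the lowest nonzero digit's place. -/
noncomputable def jumpLen (B j : ℕ) : ℕ :=
  if h : ∃ e, B ^ e ∣ j ∧ (Nat.digits B (j - B ^ e)).sum + 1 = (Nat.digits B j).sum then
    B ^ h.choose else 1

theorem jumpLen_spec {B j : ℕ} (hB : 2 ≤ B) (hj : 0 < j) : ∃ e, jumpLen B j = B ^ e ∧ B ^ e ∣ j ∧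
    (Nat.digits B (j - jumpLen B j)).sum + 1 = (Nat.digits B j).sum := by
  have h := exists_pow_dvd_digits_sum hB j hj
  rw [jumpLen, dif_pos h]
  exact ⟨_, rfl, h.choose_spec⟩

theorem jumpLen_pos {B j : ℕ} (hB : 2 ≤ B) (hj : 0 < j) : 1 ≤ jumpLen B j := by
  obtain ⟨e, h, -⟩ := jumpLen_spec hB hj
  rw [h]
  exact Nat.one_le_pow _ _ (by omega)

theorem jumpLen_le {B j : ℕ} (hB : 2 ≤ B) (hj : 0 < j) : jumpLen B j ≤ j := by
  obtain ⟨e, h, h', -⟩ := jumpLen_spec hB hj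
  rw [h]
  exact Nat.le_of_dvd hj h'

/-- A jump length is a power of `B`, so a jump over more than one level spans at least `B` levels.
This is what lets a counter up to `b` fit into a number of bits proportional to the jump length. -/
theorem base_le_jumpLen {B j : ℕ} (hB : 2 ≤ B) (hj : 0 < j) (h1 : jumpLen B j ≠ 1) :
    B ≤ jumpLen B j := by
  obtain ⟨e, h, -⟩ := jumpLen_spec hB hj
  rw [h] at h1 ⊢
  exact Nat.le_self_pow (by rintro rfl; simp at h1) _

/-- Sums over the jumps are bounded by sums over the powers of `B`. -/
theorem sum_jumpLen_le {B K H : ℕ} (hB : 2 ≤ B) (hH : H < B ^ K) (f : ℕ → ℕ → ℕ) {c : ℕ}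
    (hf : ∀ D, 1 ≤ D → ∑ j ∈ (Finset.Icc 1 H).filter (D ∣ ·), f D j ≤ c) :
    ∑ j ∈ Finset.Icc 1 H, f (jumpLen B j) j ≤ K * c := by
  -- Which power of `B` serves at `j` is forgotten: the sum over all powers dividing `j` dominates,
  -- and only exponents below `K` occur because a divisor of `j` is at most `H < B ^ K`.
  have h1 : ∀ j ∈ Finset.Icc 1 H, f (jumpLen B j) j ≤
      ∑ e ∈ Finset.range K, if B ^ e ∣ j then f (B ^ e) j else 0 := by
    intro j hj
    rw [Finset.mem_Icc] at hj
    obtain ⟨e, h, h', -⟩ := jumpLen_spec hB (show 0 < j by omega)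
    have he : e ∈ Finset.range K := by
      rw [Finset.mem_range]
      refine (Nat.pow_lt_pow_iff_right (a := B) (by omega)).1 ?_
      exact (Nat.le_of_dvd (by omega) h').trans_lt (by omega)
    refine le_trans (by rw [h, if_pos h']) (Finset.single_le_sum (fun _ _ => Nat.zero_le _) he)
  refine (Finset.sum_le_sum h1).trans ?_
  rw [Finset.sum_comm]
  refine (Finset.sum_le_card_nsmul _ _ c fun e _ => ?_).trans (by simp)
  rw [← Finset.sum_filter]
  exact hf _ (Nat.one_le_pow _ _ (by omega))

theorem sum_filter_dvd_Icc_succ (H D : ℕ) (f : ℕ → ℕ) :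
    ∑ j ∈ (Finset.Icc 1 (H + 1)).filter (D ∣ ·), f j =
      (∑ j ∈ (Finset.Icc 1 H).filter (D ∣ ·), f j) + if D ∣ H + 1 then f (H + 1) else 0 := by
  rw [Finset.sum_filter, Finset.sum_filter, Finset.sum_Icc_succ_top (by omega)]

/-- For a fixed power `D` the multiples of `D` up to `H` contribute `D * (H / D) ≤ H`, and there are
`K` powers. -/
theorem sum_jumpLen {B K H : ℕ} (hB : 2 ≤ B) (hH : H < B ^ K) :
    ∑ j ∈ Finset.Icc 1 H, jumpLen B j ≤ K * H := by
  refine sum_jumpLen_le hB hH (fun D _ => D) fun D hD => ?_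
  have h1 : Finset.Icc 1 H = Finset.Ioc 0 H := by ext; simp [Nat.succ_le_iff]
  rw [Finset.sum_const, smul_eq_mul, h1, Nat.Ioc_filter_dvd_card_eq_div]
  exact Nat.div_mul_le_self H D

/-- For a fixed power `D` the terms at `j = D, 2D, …` are `2 ^ H, 2 ^ (H - D), …`, a geometric
series below `2 ^ (H + 1)`. -/
theorem sum_pow_jumpLen {B K H : ℕ} (hB : 2 ≤ B) (hH : H < B ^ K) :
    ∑ j ∈ Finset.Icc 1 H, 2 ^ (H - j) * 2 ^ jumpLen B j ≤ K * 2 ^ (H + 1) := by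
  refine sum_jumpLen_le hB hH (fun D j => 2 ^ (H - j) * 2 ^ D) fun D hD => ?_
  -- The reserve `2 ^ D` makes the induction work: doubling it pays for the possible new term `2 ^
  -- D` at height `H + 1` and leaves the reserve in place.
  have key : ∀ H, ∑ j ∈ (Finset.Icc 1 H).filter (D ∣ ·), 2 ^ (H - j) * 2 ^ D +
      (if D ≤ H then 2 ^ D else 0) ≤ 2 ^ (H + 1) := by
    intro H
    induction H with
    | zero => simp [show ¬ D ≤ 0 by omega]
    | succ H ih =>
      rw [sum_filter_dvd_Icc_succ]
      have h2 : ∑ j ∈ (Finset.Icc 1 H).filter (D ∣ ·), 2 ^ (H + 1 - j) * 2 ^ D =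
          2 * ∑ j ∈ (Finset.Icc 1 H).filter (D ∣ ·), 2 ^ (H - j) * 2 ^ D := by
        rw [Finset.mul_sum]
        refine Finset.sum_congr rfl fun j hj => ?_
        simp only [Finset.mem_filter, Finset.mem_Icc] at hj
        rw [show H + 1 - j = (H - j) + 1 by omega, pow_succ]
        ring
      rw [h2]
      have h3 : 2 ^ (H + 1 + 1) = 2 * 2 ^ (H + 1) := by ring
      rw [h3]
      simp only [Nat.sub_self, pow_zero, one_mul]
      by_cases h4 : D ≤ H
      · rw [if_pos h4] at ih
        rw [if_pos (show D ≤ H + 1 by omega)]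
        have h5 : 0 < 2 ^ D := by positivity
        split <;> omega
      · rw [if_neg h4] at ih
        have h0 : ∑ j ∈ (Finset.Icc 1 H).filter (D ∣ ·), 2 ^ (H - j) * 2 ^ D = 0 := by
          refine Finset.sum_eq_zero fun j hj => ?_
          simp only [Finset.mem_filter, Finset.mem_Icc] at hj
          exact absurd (Nat.le_of_dvd (by omega) hj.2) (by omega)
        rw [h0]
        have h5 : D ≤ H + 1 → 2 ^ D ≤ 2 ^ (H + 1) := Nat.pow_le_pow_right (by norm_num)
        have h6 : D ∣ H + 1 → D ≤ H + 1 := Nat.le_of_dvd (by omega)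
        split <;> split <;> omega
  exact (Nat.le_add_right _ _).trans (key H)

/-! ### Canonical decompositions -/

/-- A property that is inherited downwards and fails above `H` has a unique last height. Applied to
"the block of `x` lies inside the range", it places each position in exactly one maximal block. -/
theorem exists_le_and_not_succ_iff {P : ℕ → Prop} {H : ℕ} (hP : ∀ j, P (j + 1) → P j)
    (hH : ¬ P (H + 1)) : (P 0 ↔ ∃ j ≤ H, P j ∧ ¬ P (j + 1)) ∧
      ∀ j j', P j ∧ ¬ P (j + 1) → P j' ∧ ¬ P (j' + 1) → j = j' := by
  have mono : ∀ j k, P (j + k) → P j := by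
    intro j k
    induction k with
    | zero => exact id
    | succ k ih => exact fun h => ih (hP _ h)
  refine ⟨⟨fun h0 => ?_, fun ⟨j, _, h, _⟩ => mono 0 j (by simpa using h)⟩, ?_⟩
  · by_contra! hcon
    have : ∀ j ≤ H + 1, P j := by
      intro j
      induction j with
      | zero => exact fun _ => h0
      | succ j ih => exact fun hj => hcon j (by omega) (ih (by omega))
    exact hH (this _ le_rfl)
  · rintro j j' ⟨h1, h2⟩ ⟨h3, h4⟩
    by_contra hne
    rcases Nat.lt_or_gt_of_ne hne with h | h
    · obtain ⟨k, rfl⟩ := Nat.exists_eq_add_of_le (show j + 1 ≤ j' from h)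
      exact h2 (mono _ _ h3)
    · obtain ⟨k, rfl⟩ := Nat.exists_eq_add_of_le (show j' + 1 ≤ j from h)
      exact h4 (mono _ _ h1)

/-- A set of leaf positions is the disjoint union of runs of blocks, at most `d` per height. -/
structure Runs (d m H : ℕ) (S : ℕ → Prop) (lo hi : ℕ → ℕ) : Prop where
  valid : ∀ j ≤ H, ∀ t, t < hi j → t * d ^ j < m
  le : ∀ j, hi j ≤ lo j + d
  cover : ∀ x < m, (S x ↔ ∃ j ≤ H, lo j ≤ x / d ^ j ∧ x / d ^ j < hi j)
  unique : ∀ x < m, ∀ j ≤ H, ∀ j' ≤ H, lo j ≤ x / d ^ j ∧ x / d ^ j < hi j →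
    lo j' ≤ x / d ^ j' ∧ x / d ^ j' < hi j' → j = j'

/-- The block of `x` at height `j` lies before `p` iff `x / d ^ j < p / d ^ j`. The maximal such
blocks at height `j` are those between `d * (p / d ^ (j + 1))` and `p / d ^ j`, and their number is
the `j`-th digit of `p` in base `d`. -/
theorem exists_runs_prefix {d m H p : ℕ} (hd : 2 ≤ d) (hm : m ≤ d ^ H) (hp : p ≤ m) :
    ∃ lo hi, Runs d m H (· < p) lo hi := by
  have hpos : ∀ j, 0 < d ^ j := fun j => Nat.pow_pos (by omega)
  have hdd : ∀ x j, x / d ^ (j + 1) = x / d ^ j / d := fun x j => by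
    rw [pow_succ, Nat.div_div_eq_div_mul]
  have key : ∀ x j, (d * (p / d ^ (j + 1)) ≤ x / d ^ j ∧ x / d ^ j < p / d ^ j) ↔
      (x / d ^ j < p / d ^ j ∧ ¬ x / d ^ (j + 1) < p / d ^ (j + 1)) := by
    intro x j
    rw [hdd x j, not_lt, Nat.le_div_iff_mul_le (show 0 < d by omega), mul_comm d, and_comm]
  have tr : ∀ x, _ := fun x => exists_le_and_not_succ_iff
    (P := fun j => x / d ^ j < p / d ^ j) (H := H)
    (fun j h => by
      by_contra h'
      rw [hdd, hdd] at h
      exact absurd (Nat.div_le_div_right (c := d) (not_lt.1 h')) (not_le.2 h))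
    (by
      have : p / d ^ (H + 1) = 0 := Nat.div_eq_of_lt (by
        rw [pow_succ]; have := hpos H; nlinarith)
      simp [this])
  refine ⟨fun j => d * (p / d ^ (j + 1)), fun j => p / d ^ j, ?_, ?_, ?_, ?_⟩
  · intro j _ t ht
    have h1 := Nat.div_mul_le_self p (d ^ j)
    have h2 : (t + 1) * d ^ j ≤ p / d ^ j * d ^ j := Nat.mul_le_mul_right _ ht
    have := hpos j
    rw [add_mul] at h2
    omega
  · intro j
    simp only [hdd]
    have := Nat.div_add_mod (p / d ^ j) d
    have := Nat.mod_lt (p / d ^ j) (show 0 < d by omega)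
    omega
  · intro x _
    simp only [key]
    simpa using (tr x).1
  · intro x _ j _ j' _ h h'
    exact (tr x).2 j j' ((key x j).1 h) ((key x j').1 h')

/-- With `c j` the quotient `p / d ^ j` rounded up, block `t` at height `j` starts at or after `p`
iff `c j ≤ t`. The maximal ones are those below `d * c (j + 1)`, and rounding up at two consecutive
heights loses at most `d` blocks. -/
theorem exists_runs_suffix {d m H p : ℕ} (hd : 2 ≤ d) (hm : m ≤ d ^ H) :
    ∃ lo hi, Runs d m H (p ≤ ·) lo hi := by
  have hpos : ∀ j, 0 < d ^ j := fun j => Nat.pow_pos (by omega)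
  have hdd : ∀ x j, x / d ^ (j + 1) = x / d ^ j / d := fun x j => by
    rw [pow_succ, Nat.div_div_eq_div_mul]
  set c : ℕ → ℕ := fun j => (p + d ^ j - 1) / d ^ j with hc
  have hcle : ∀ j t, c j ≤ t ↔ p ≤ t * d ^ j := by
    intro j t
    have := hpos j
    rw [hc, ← Nat.lt_succ_iff, Nat.div_lt_iff_lt_mul (hpos j), Nat.succ_mul]
    omega
  have hnb : ∀ j t, t < (m + d ^ j - 1) / d ^ j ↔ t * d ^ j < m := by
    intro j t
    have := hpos j
    rw [← Nat.succ_le_iff, Nat.le_div_iff_mul_le (hpos j), Nat.succ_mul]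
    omega
  have hup : ∀ x j, x / d ^ (j + 1) * d ^ (j + 1) ≤ x / d ^ j * d ^ j := by
    intro x j
    rw [hdd, pow_succ, mul_comm (d ^ j) d, ← mul_assoc]
    exact Nat.mul_le_mul_right _ (Nat.div_mul_le_self _ _)
  -- The second bound keeps only blocks that start before `m`. At the top height there is no parent
  -- that could absorb a block, so only this bound applies.
  set hi : ℕ → ℕ := fun j => if j = H then (m + d ^ j - 1) / d ^ j else
    min (d * c (j + 1)) ((m + d ^ j - 1) / d ^ j) with hhi
  -- The conjunct `j ≤ H` is needed: for `p = 0` the second conjunct holds at every height, and the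
  -- property must fail above `H`.
  set P : ℕ → ℕ → Prop := fun x j => j ≤ H ∧ c j ≤ x / d ^ j with hPdef
  have key : ∀ x < m, ∀ j ≤ H, (c j ≤ x / d ^ j ∧ x / d ^ j < hi j) ↔ (P x j ∧ ¬ P x (j + 1)) := by
    intro x hx j hj
    have hv : x / d ^ j < (m + d ^ j - 1) / d ^ j :=
      (hnb _ _).2 ((Nat.div_mul_le_self _ _).trans_lt hx)
    by_cases hjH : j = H
    · simp only [hPdef, hhi, if_pos hjH]
      have : ¬ j + 1 ≤ H := by omega
      tauto
    · have h1 : x / d ^ j < hi j ↔ ¬ c (j + 1) ≤ x / d ^ (j + 1) := by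
        simp only [hhi, if_neg hjH, lt_min_iff, hv, and_true]
        rw [not_le, hdd, Nat.div_lt_iff_lt_mul (show 0 < d by omega), mul_comm d]
      simp only [hPdef, h1]
      have : j + 1 ≤ H := by omega
      tauto
  have tr : ∀ x, _ := fun x => exists_le_and_not_succ_iff (P := P x) (H := H)
    (fun j h => ⟨by have := h.1; omega, by
      have h1 := (hcle _ _).1 h.2
      exact (hcle _ _).2 (h1.trans (hup x j))⟩)
    (fun h => by have := h.1; omega)
  have h00 : ∀ x, P x 0 ↔ p ≤ x := by
    intro x
    simp only [hPdef, hcle]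
    simp
  refine ⟨c, hi, ?_, ?_, ?_, ?_⟩
  · intro j _ t ht
    refine (hnb _ _).1 (ht.trans_le ?_)
    simp only [hhi]
    split
    · exact le_rfl
    · exact min_le_right _ _
  · intro j
    simp only [hhi]
    split
    next h =>
      subst h
      have h1 : (m + d ^ j - 1) / d ^ j ≤ 1 := by
        rw [← Nat.lt_succ_iff, Nat.div_lt_iff_lt_mul (hpos j)]
        have := hpos j
        omega
      omega
    next h =>
      refine (min_le_left _ _).trans ?_
      have h1 : p ≤ c j * d ^ j := (hcle _ _).1 le_rfl
      have h2 : c (j + 1) ≤ c j / d + 1 := by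
        rw [hcle, pow_succ, mul_comm (d ^ j) d, ← mul_assoc]
        refine h1.trans (Nat.mul_le_mul_right _ ?_)
        have := Nat.div_add_mod (c j) d
        have := Nat.mod_lt (c j) (show 0 < d by omega)
        rw [add_mul, mul_comm _ d]
        omega
      have := Nat.div_add_mod (c j) d
      calc d * c (j + 1) ≤ d * (c j / d + 1) := Nat.mul_le_mul_left _ h2
        _ ≤ c j + d := by rw [mul_add]; omega
  · intro x hx
    rw [← h00 x, (tr x).1]
    exact exists_congr fun j => and_congr_right fun hj => (key x hx j hj).symm
  · intro x hx j hj j' hj' h h'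
    exact (tr x).2 j j' ((key x hx j hj).1 h) ((key x hx j' hj').1 h')

/-! ### Interval trees -/

/-- The tree is an interval tree over the intervals `[lo i, hi i)`, `i ∈ S`. -/
def IsIntervalTree {ι : Type} (lo hi : ι → Coord) : IntervalTree ι → Finset ι → Prop
  | .nil, S => S = ∅
  | .node m I l r, S =>
    (∀ i, i ∈ I ↔ i ∈ S ∧ lo i ≤ m ∧ m < hi i) ∧
    (∃ L : Finset ι, (∀ i, i ∈ L ↔ i ∈ S ∧ hi i ≤ m) ∧ IsIntervalTree lo hi l L) ∧
    (∃ R : Finset ι, (∀ i, i ∈ R ↔ i ∈ S ∧ m < lo i) ∧ IsIntervalTree lo hi r R)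

def IntervalTree.depth {ι : Type} : IntervalTree ι → ℕ
  | .nil => 0
  | .node _ _ l r => max l.depth r.depth + 1

section intervalTree
variable {ι : Type} {lo hi : ι → Coord}

open Classical in
/-- Both the number of left intervals and the number of intervals left of the median again are
controlled by the rank of the median. -/
theorem endpointMedian_card (S : Finset ι) (hS : S.Nonempty) :
    let m := endpointMedian lo hi S
    (S.filter fun i => lo i < m).card + (S.filter fun i => hi i < m).card ≤ S.card - 1 ∧
      (S.filter fun i => m < lo i).card + (S.filter fun i => m < hi i).card ≤ S.card := by
  intro m
  set E : Multiset Coord := S.val.map lo + S.val.map hi with hE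
  set l := E.sort (· ≤ ·) with hl
  have hlen : l.length = 2 * S.card := by
    rw [hl, Multiset.length_sort, hE]
    simp [two_mul]
  have hpos : 0 < S.card := hS.card_pos
  have hm : m = l[S.card - 1]'(by omega) := by
    simp only [m, endpointMedian]
    rw [List.getD_eq_getElem _ _ (by rw [← hE, ← hl]; omega)]
  have hsort : l.Pairwise (· ≤ ·) := Multiset.pairwise_sort _ _
  have hcount : ∀ p : Coord → Prop, (S.filter fun i => p (lo i)).card +
      (S.filter fun i => p (hi i)).card = l.countP (fun c => decide (p c)) := by
    intro p
    have h1 : l.countP (fun c => decide (p c)) = E.countP p := by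
      rw [← Multiset.coe_countP, hl, Multiset.sort_eq]
    rw [h1, hE, Multiset.countP_add, Multiset.countP_map, Multiset.countP_map]
    rfl
  constructor
  · have hc : (S.filter fun i => lo i < m).card + (S.filter fun i => hi i < m).card =
        l.countP (fun c => decide (c < m)) := by convert hcount (fun c => c < m)
    rw [hc]
    conv_lhs => rw [← List.take_append_drop (S.card - 1) l, List.countP_append]
    have h2 : (l.drop (S.card - 1)).countP (fun c => decide (c < m)) = 0 := by
      rw [List.countP_eq_zero]
      intro c hc
      rw [List.mem_iff_getElem] at hc
      obtain ⟨i, hi', rfl⟩ := hc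
      rw [List.getElem_drop]
      rw [List.length_drop] at hi'
      simp only [decide_eq_true_eq, not_lt]
      rw [hm]
      rcases Nat.eq_zero_or_pos i with rfl | h
      · simp
      · exact List.pairwise_iff_getElem.1 hsort _ _ _ _ (by omega)
    rw [h2, add_zero]
    refine (List.countP_le_length).trans ?_
    rw [List.length_take]
    exact min_le_left _ _
  · have hc : (S.filter fun i => m < lo i).card + (S.filter fun i => m < hi i).card =
        l.countP (fun c => decide (m < c)) := by convert hcount (fun c => m < c)
    rw [hc]
    conv_lhs => rw [← List.take_append_drop S.card l, List.countP_append]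
    have h2 : (l.take S.card).countP (fun c => decide (m < c)) = 0 := by
      rw [List.countP_eq_zero]
      intro c hc
      rw [List.mem_iff_getElem] at hc
      obtain ⟨i, hi', rfl⟩ := hc
      rw [List.getElem_take]
      rw [List.length_take] at hi'
      simp only [decide_eq_true_eq, not_lt]
      rw [hm]
      rcases Nat.lt_or_ge i (S.card - 1) with h | h
      · exact List.pairwise_iff_getElem.1 hsort _ _ _ _ h
      · have : i = S.card - 1 := by omega
        subst this
        exact le_rfl
    rw [h2, zero_add]
    refine (List.countP_le_length).trans ?_
    rw [List.length_drop]
    omega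

-- A left interval has its lower endpoint strictly below the median, and at most `|S| - 1` endpoints
-- lie there.
open Classical in
theorem card_left_lt {S : Finset ι} (hlt : ∀ i, lo i < hi i) (hS : S.Nonempty) :
    (S.filter fun i => hi i ≤ endpointMedian lo hi S).card < S.card := by
  have h := (endpointMedian_card (lo := lo) (hi := hi) S hS).1
  have h1 : (S.filter fun i => hi i ≤ endpointMedian lo hi S).card ≤
      (S.filter fun i => lo i < endpointMedian lo hi S).card := by
    refine Finset.card_le_card fun i hi' => ?_
    rw [Finset.mem_filter] at hi' ⊢
    exact ⟨hi'.1, (hlt i).trans_le hi'.2⟩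
  have := hS.card_pos
  omega

-- A right interval has both endpoints above the median, and at most `|S|` of the endpoints lie
-- there.
open Classical in
theorem two_mul_card_right_le {S : Finset ι} (hlt : ∀ i, lo i < hi i) (hS : S.Nonempty) :
    2 * (S.filter fun i => endpointMedian lo hi S < lo i).card ≤ S.card := by
  have h := (endpointMedian_card (lo := lo) (hi := hi) S hS).2
  have h1 : (S.filter fun i => endpointMedian lo hi S < lo i).card ≤
      (S.filter fun i => endpointMedian lo hi S < hi i).card := by
    refine Finset.card_le_card fun i hi' => ?_
    rw [Finset.mem_filter] at hi' ⊢
    exact ⟨hi'.1, hi'.2.trans (hlt i)⟩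
  omega

open Classical in
/-- If the left part of `S` is large, then most of its intervals end at the median, so that the left
part of the left part is small. -/
theorem two_mul_card_left_left_le {S L : Finset ι} (hlt : ∀ i, lo i < hi i)
    (hL : L = S.filter fun i => hi i ≤ endpointMedian lo hi S) (hLne : L.Nonempty) :
    2 * (L.filter fun i => hi i ≤ endpointMedian lo hi L).card ≤ S.card := by
  have hSL : L ⊆ S := hL ▸ Finset.filter_subset _ _
  have hS : S.Nonempty := hLne.mono hSL
  set m := endpointMedian lo hi S with hm
  set m' := endpointMedian lo hi L with hm'
  have h := (endpointMedian_card (lo := lo) (hi := hi) S hS).1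
  have h' := (endpointMedian_card (lo := lo) (hi := hi) L hLne)
  simp only [← hm, ← hm'] at h h'
  have hLm : ∀ i ∈ L, hi i ≤ m := fun i hi' => by
    rw [hL, Finset.mem_filter] at hi'
    exact hi'.2
  -- all left endpoints of `L` are less than `m`, so the median of `L` is
  have hmm : m' < m := by
    by_contra hcon
    have h1 : (L.filter fun i => lo i < m') = L := by
      refine Finset.filter_true_of_mem fun i hi' => ?_
      exact ((hlt i).trans_le (hLm i hi')).trans_le (not_lt.1 hcon)
    have h2 := h'.1
    rw [h1] at h2
    have := hLne.card_pos
    omega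
  have h3 : (L.filter fun i => hi i ≤ m').card ≤ (S.filter fun i => hi i < m).card := by
    refine Finset.card_le_card fun i hi' => ?_
    rw [Finset.mem_filter] at hi' ⊢
    exact ⟨hSL hi'.1, hi'.2.trans_lt hmm⟩
  have h4 : (L.filter fun i => hi i ≤ m').card ≤ L.card := Finset.card_filter_le _ _
  have h5 : L.card ≤ (S.filter fun i => lo i < m).card := by
    refine Finset.card_le_card fun i hi' => ?_
    rw [Finset.mem_filter]
    exact ⟨hSL hi', (hlt i).trans_le (hLm i hi')⟩
  -- The left part of the left part injects both into the intervals starting below `m` and into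
  -- those ending below `m`; together these two counts are at most `|S| - 1`.
  omega

theorem isIntervalTree_aux (hlt : ∀ i, lo i < hi i) :
    ∀ (k : ℕ) (S : Finset ι), S.card ≤ k → IsIntervalTree lo hi (intervalTreeAux lo hi k S) S := by
  classical
  intro k
  induction k with
  | zero =>
    intro S hS
    simpa [intervalTreeAux, IsIntervalTree] using hS
  | succ k ih =>
    intro S hS
    rw [intervalTreeAux]
    split
    next h => exact h
    next h =>
      have hne := Finset.nonempty_iff_ne_empty.2 h
      have h1 := card_left_lt (lo := lo) (hi := hi) hlt hne
      have h2 := two_mul_card_right_le (lo := lo) (hi := hi) hlt hne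
      have := hne.card_pos
      refine ⟨fun i => by simp, ⟨_, fun i => by simp, ih _ ?_⟩, ⟨_, fun i => by simp, ih _ ?_⟩⟩
      · exact Nat.lt_succ_iff.1 (lt_of_lt_of_le (by convert h1) hS)
      · have h3 : (S.filter fun i => endpointMedian lo hi S < lo i).card < S.card := by omega
        exact Nat.lt_succ_iff.1 (lt_of_lt_of_le (by convert h3) hS)

theorem isIntervalTree_intervalTree (hlt : ∀ i, lo i < hi i) (S : Finset ι) :
    IsIntervalTree lo hi (intervalTree lo hi S) S := isIntervalTree_aux hlt _ _ le_rfl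

/-- With the lower median a left subtree can keep all intervals but one, so sizes need not halve at
every level. They do halve after two levels, which gives the factor `2` in front of the bit length.
-/
theorem depth_intervalTreeAux_le (hlt : ∀ i, lo i < hi i) :
    ∀ (N k : ℕ) (S : Finset ι), S.card ≤ N →
      (intervalTreeAux lo hi k S).depth ≤ 2 * Nat.size S.card := by
  classical
  intro N
  induction N with
  | zero =>
    intro k S hS
    have : S = ∅ := by simpa using hS
    cases k <;> simp [intervalTreeAux, this, IntervalTree.depth]
  | succ N ih =>
    intro k S hS
    -- the subtree over at most half of the intervals
    have half : ∀ (k : ℕ) (T : Finset ι), 0 < S.card → 2 * T.card ≤ S.card →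
        (intervalTreeAux lo hi k T).depth + 2 ≤ 2 * Nat.size S.card := by
      intro k T hpos hT
      have h1 := ih k T (by omega)
      have h2 : Nat.size T.card + 1 ≤ Nat.size S.card := by
        rw [Nat.add_one_le_iff, Nat.lt_size]
        rcases Nat.eq_zero_or_pos T.card with h | h
        · rw [h]; simpa using hpos
        · have h3 : 2 ^ (Nat.size T.card - 1) ≤ T.card :=
            Nat.lt_size.1 (Nat.sub_lt (Nat.size_pos.2 h) one_pos)
          obtain ⟨z, hz⟩ : ∃ z, Nat.size T.card = z + 1 :=
            ⟨Nat.size T.card - 1, by have := Nat.size_pos.2 h; omega⟩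
          rw [hz] at h3 ⊢
          rw [pow_succ]
          simp at h3
          omega
      omega
    cases k with
    | zero => simp [intervalTreeAux, IntervalTree.depth]
    | succ k =>
      rw [intervalTreeAux]
      split
      next h => simp [IntervalTree.depth]
      next h =>
        have hne := Finset.nonempty_iff_ne_empty.2 h
        have hpos := hne.card_pos
        have hR := two_mul_card_right_le (lo := lo) (hi := hi) hlt hne
        have e1 := half k _ hpos hR
        -- The left child itself may be large, but both of its children hold at most half of `S`.
        have hL : (intervalTreeAux lo hi k
            (S.filter fun i => hi i ≤ endpointMedian lo hi S)).depth + 1 ≤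
            2 * Nat.size S.card := by
          generalize hLdef : (S.filter fun i => hi i ≤ endpointMedian lo hi S) = L
          have hs := Nat.size_pos.2 hpos
          cases k with
          | zero => simp [intervalTreeAux, IntervalTree.depth]; omega
          | succ k =>
            rw [intervalTreeAux]
            split
            next h => simp [IntervalTree.depth]; omega
            next h =>
              have hneL := Finset.nonempty_iff_ne_empty.2 h
              have hLS : L.card ≤ S.card := hLdef ▸ Finset.card_filter_le _ _
              have f1 := half k _ hpos (two_mul_card_left_left_le hlt hLdef.symm hneL)
              have f2 := half k _ hpos
                ((two_mul_card_right_le (lo := lo) (hi := hi) hlt hneL).trans hLS)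
              simp only [IntervalTree.depth]
              omega
        simp only [IntervalTree.depth]
        have e2 := le_trans (Nat.le_refl _) e1
        omega

theorem depth_intervalTree_le (hlt : ∀ i, lo i < hi i) (S : Finset ι) :
    (intervalTree lo hi S).depth ≤ 2 * Nat.size S.card :=
  depth_intervalTreeAux_le hlt _ _ _ le_rfl

/-- The sum of a cost over the nodes of a tree. -/
def IntervalTree.cost (f : Finset ι → ℕ) : IntervalTree ι → ℕ
  | .nil => 0
  | .node _ I l r => f I + l.cost f + r.cost f

-- A node with no assigned interval must still pay `c`. In that case both subtrees are nonempty,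
-- because neither side alone can hold all of `S`. The reserve `c` of each nonempty tree then
-- settles the account: two reserves come in, one pays for the node and one is passed on. A node
-- with assigned intervals pays from the additional `2 * c` per interval.
open Classical in
theorem cost_intervalTreeAux_le (hlt : ∀ i, lo i < hi i) {f : Finset ι → ℕ} {a c : ℕ}
    (hf : ∀ I, f I ≤ a * I.card + c) : ∀ (k : ℕ) (S : Finset ι),
      (intervalTreeAux lo hi k S).cost f + (if S = ∅ then 0 else c) ≤ (a + 2 * c) * S.card := by
  intro k
  induction k with
  | zero =>
    intro S
    rw [intervalTreeAux]
    split
    next h => simp [IntervalTree.cost]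
    next h =>
      have := (Finset.nonempty_iff_ne_empty.2 h).card_pos
      simp only [IntervalTree.cost]
      nlinarith
  | succ k ih =>
    intro S
    rw [intervalTreeAux]
    by_cases h : S = ∅
    · simp [h, IntervalTree.cost]
    · rw [if_neg h, if_neg h]
      have hne := Finset.nonempty_iff_ne_empty.2 h
      have h1 := card_left_lt (lo := lo) (hi := hi) hlt hne
      have h2 := two_mul_card_right_le (lo := lo) (hi := hi) hlt hne
      set m := endpointMedian lo hi S
      set L := S.filter fun i => hi i ≤ m with hL
      set R := S.filter fun i => m < lo i with hR
      set I := S.filter fun i => lo i ≤ m ∧ m < hi i with hI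
      have iL := ih L
      have iR := ih R
      have hsum : I.card + L.card + R.card ≤ S.card := by
        rw [← Finset.card_union_of_disjoint, ← Finset.card_union_of_disjoint]
        · refine Finset.card_le_card fun i hi' => ?_
          simp only [hI, hL, hR, Finset.mem_union, Finset.mem_filter] at hi'
          tauto
        · rw [Finset.disjoint_left]
          intro i hi' hi''
          simp only [hI, hL, hR, Finset.mem_union, Finset.mem_filter] at hi' hi''
          rcases hi' with hi' | hi'
          · exact absurd hi'.2.1 (not_le.2 hi''.2)
          · exact absurd ((hlt i).trans_le hi'.2) (not_lt.2 hi''.2.le)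
        · rw [Finset.disjoint_left]
          intro i hi' hi''
          simp only [hI, hL, Finset.mem_filter] at hi' hi''
          exact absurd hi'.2.2 (not_lt.2 hi''.2)
      have hfI := hf I
      simp only [IntervalTree.cost]
      have hpos := hne.card_pos
      have e1 : (a + 2 * c) * (I.card + L.card + R.card) ≤ (a + 2 * c) * S.card :=
        Nat.mul_le_mul_left _ hsum
      by_cases hI0 : I.card = 0
      · have hcov : S.card ≤ L.card + R.card := by
          rw [← Finset.card_union_of_disjoint]
          · refine Finset.card_le_card fun i hi' => ?_
            have hi0 : i ∉ I := by rw [Finset.card_eq_zero.1 hI0]; simp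
            simp only [hI, hL, hR, Finset.mem_union, Finset.mem_filter, hi', true_and] at hi0 ⊢
            rw [not_and_or, not_le, not_lt] at hi0
            tauto
          · rw [Finset.disjoint_left]
            intro i hi' hi''
            simp only [hL, hR, Finset.mem_filter] at hi' hi''
            exact absurd ((hlt i).trans_le hi'.2) (not_lt.2 hi''.2.le)
        have hLne : L ≠ ∅ := by
          intro h0
          rw [h0] at hcov
          simp at hcov
          omega
        have hRne : R ≠ ∅ := by
          intro h0
          rw [h0] at hcov
          simp at hcov
          omega
        rw [if_neg hLne] at iL
        rw [if_neg hRne] at iR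
        rw [hI0] at e1 hfI
        nlinarith
      · have : 0 < I.card := Nat.pos_of_ne_zero hI0
        nlinarith [Nat.zero_le (if L = ∅ then 0 else c), Nat.zero_le (if R = ∅ then 0 else c)]

theorem cost_intervalTree_le (hlt : ∀ i, lo i < hi i) {f : Finset ι → ℕ} {a c : ℕ}
    (hf : ∀ I, f I ≤ a * I.card + c) (S : Finset ι) :
    (intervalTree lo hi S).cost f ≤ (a + 2 * c) * S.card :=
  (Nat.le_add_right _ _).trans (cost_intervalTreeAux_le hlt hf _ S)

end intervalTree

/-! ### Arrays in memory -/

def WordArray {w : ℕ} (M : List (Cell w)) (A len : ℕ) (f : ℕ → ℕ) : Prop :=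
  ∀ k < len, wordAt M (A + k) = some (f k)

def CoordArray {w : ℕ} (M : List (Cell w)) (A len : ℕ) (f : ℕ → Coord) : Prop :=
  ∀ k < len, coordAt M (A + k) = some (f k)

/-- Cell `0` holds the block length, and a popcount table starts at cell `2`. -/
structure HasTable {w : ℕ} (M : List (Cell w)) (b : ℕ) : Prop where
  pos : 1 ≤ b
  lt : b < w
  block : wordAt M 0 = some b
  table : WordArray M 2 (2 ^ b) (popcount b)

/-! ### Binary range trees in memory -/

section tree
variable {w n : ℕ} (M : List (Cell w)) (b : ℕ) (x y : Fin n → Coord) (W : List (Fin n))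

/-- Among the descendants `d` levels below, at height `j`, the one that contains the leaf `i`. -/
def leafDigit (j d : ℕ) (i : Fin n) : ℕ := W.idxOf i / 2 ^ j % 2 ^ d

/-- The digit of the `i`-th entry of a bottom list. -/
noncomputable def symAt (j d t i : ℕ) : ℕ :=
  ((nodeList x W (j + d) t)[i]?).elim 0 (leafDigit W j d)

/-- The number of entries with digit `c` among the first `i` ones of a bottom list. -/
noncomputable def cntSym (j d t c i : ℕ) : ℕ :=
  ((nodeList x W (j + d) t).take i).countP fun p => leafDigit W j d p = c

/-- The key has the same offset as in the record of an inner node, so a descent can compare before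
it knows which kind of node it has reached. -/
structure LeafAt (t a : ℕ) : Prop where
  flag : wordAt M (a + 0) = some 0
  id : ∀ i, W[t]? = some i → wordAt M (a + 1) = some (i : ℕ)
  key : ∀ i, W[t]? = some i → coordAt M (a + 6) = some (y i)

/-- The record of a node at height `j + 1`. -/
structure InnerAt (addr : ℕ → ℕ → ℕ) (j t a jp bits ones : ℕ) : Prop where
  flag : wordAt M (a + 0) = some 1
  jump : wordAt M (a + 1) = some jp
  left : wordAt M (a + 2) = some (addr j (2 * t))
  right : wordAt M (a + 3) = some (addr j (2 * t + 1))
  bitsPtr : wordAt M (a + 4) = some bits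
  onesPtr : wordAt M (a + 5) = some ones
  key : coordAt M (a + 6) = some ((W[(2 * t + 1) * 2 ^ j]?).elim ⊤ y)
  bitsArr : WordArray M bits ((nodeList x W (j + 1) t).length / b + 1)
    fun k => packDigits 2 b fun r => symAt x W j 1 t (k * b + r)
  onesArr : WordArray M ones ((nodeList x W (j + 1) t).length / b + 1)
    fun k => cntSym x W j 1 t 1 (k * b)

/-- What is stored about the `i`-th entry: its digit, and the number of entries with the same digit
before it in its superblock of length `L`. -/
noncomputable def jumpField (j d t L i : ℕ) : ℕ :=
  symAt x W j d t i + 2 ^ d * (cntSym x W j d t (symAt x W j d t i) i -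
    cntSym x W j d t (symAt x W j d t i) (i / L * L))

/-- The record for jumps from a node at height `j + d` to height `j`. -/
structure JumpAt (addr : ℕ → ℕ → ℕ) (j d t jp e g fields child cnt : ℕ) : Prop where
  epos : 1 ≤ e
  egw : e * g < w
  bg : 2 ^ (2 * d) * b ≤ 2 ^ g
  len : wordAt M (jp + 0) = some (2 ^ d * b)
  per : wordAt M (jp + 1) = some e
  width : wordAt M (jp + 2) = some g
  deg : wordAt M (jp + 3) = some (2 ^ d)
  fieldsPtr : wordAt M (jp + 4) = some fields
  childPtr : wordAt M (jp + 5) = some child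
  cntPtr : wordAt M (jp + 6) = some cnt
  fieldsArr : WordArray M fields ((nodeList x W (j + d) t).length / e + 1)
    fun k => packDigits (2 ^ g) e fun r => jumpField x W j d t (2 ^ d * b) (k * e + r)
  childArr : WordArray M child (2 ^ d) fun c => addr j (t * 2 ^ d + c)
  cntArr : WordArray M cnt (((nodeList x W (j + d) t).length / (2 ^ d * b) + 1) * 2 ^ d)
    fun k => cntSym x W j d t (k % 2 ^ d) (k / 2 ^ d * (2 ^ d * b))

/-- A null jump pointer means that the jump has length one; then the bit sequence already leads to
the child and no jump record is stored. -/
structure TreeAt (B H : ℕ) (addr : ℕ → ℕ → ℕ) : Prop where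
  leaf : ∀ t < W.length, LeafAt M y W t (addr 0 t)
  inner : ∀ j, j + 1 ≤ H → ∀ t, t * 2 ^ (j + 1) < W.length → ∃ jp bits ones,
    InnerAt M b x y W addr j t (addr (j + 1) t) jp bits ones ∧
    ((jumpLen B (j + 1) = 1 ∧ jp = 0) ∨ (jp ≠ 0 ∧ ∃ j' e g fields child cnt,
      j' + jumpLen B (j + 1) = j + 1 ∧
      JumpAt M b x W addr j' (jumpLen B (j + 1)) t jp e g fields child cnt))

end tree

/-! ### Digits, ranks and jump fields of list entries -/

section facts
variable {w n : ℕ} {M : List (Cell w)} {b : ℕ} {x y : Fin n → Coord} {W : List (Fin n)}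

theorem leafDigit_lt (j d : ℕ) (i : Fin n) : leafDigit W j d i < 2 ^ d :=
  Nat.mod_lt _ (by positivity)

theorem symAt_lt (j d t i : ℕ) : symAt x W j d t i < 2 ^ d := by
  unfold symAt
  cases (nodeList x W (j + d) t)[i]? with
  | none => simp
  | some p => exact leafDigit_lt j d p

theorem idxOf_div_eq (hW : W.Nodup) {j d t : ℕ} {p : Fin n} (hp : p ∈ nodeList x W (j + d) t) :
    W.idxOf p / 2 ^ j = t * 2 ^ d + leafDigit W j d p := by
  have h := ((mem_nodeList x hW).1 hp).2
  rw [pow_add, ← Nat.div_div_eq_div_mul] at h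
  rw [leafDigit, ← h, mul_comm]
  exact (Nat.div_add_mod _ _).symm

theorem filter_leafDigit (hW : W.Nodup) {j d t c : ℕ} (hc : c < 2 ^ d) :
    (nodeList x W (j + d) t).filter (fun p => leafDigit W j d p = c) =
      nodeList x W j (t * 2 ^ d + c) := by
  have h1 : (t * 2 ^ d + c) / 2 ^ d = t := by
    rw [mul_comm, Nat.mul_add_div (by positivity), Nat.div_eq_of_lt hc, add_zero]
  rw [← filter_nodeList x hW h1]
  refine List.filter_congr fun p hp => ?_
  rw [idxOf_div_eq hW hp]
  simp

/-- The descendant that holds the entry is named by its digit, and its list is the filtered list of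
the ancestor, so the new index is the rank among equal digits. The second part records that this
descendant exists, which is what makes its record available. -/
theorem nodeList_step (hW : W.Nodup) {j d t i : ℕ} {p : Fin n}
    (hp : (nodeList x W (j + d) t)[i]? = some p) :
    (nodeList x W j (t * 2 ^ d + symAt x W j d t i))[cntSym x W j d t (symAt x W j d t i) i]? =
      some p ∧ (t * 2 ^ d + symAt x W j d t i) * 2 ^ j < W.length := by
  obtain ⟨hi, hpi⟩ := List.getElem?_eq_some_iff.1 hp
  have hs : symAt x W j d t i = leafDigit W j d p := by simp [symAt, hp]
  have hmem : p ∈ nodeList x W (j + d) t := hpi ▸ List.getElem_mem _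
  rw [hs]
  constructor
  · rw [← filter_leafDigit hW (leafDigit_lt j d p)]
    have := List.getElem?_filter_countP (nodeList x W (j + d) t)
      (fun p' => decide (leafDigit W j d p' = leafDigit W j d p)) hi (by simp [hpi])
    rw [hpi] at this
    exact this
  · rw [← idxOf_div_eq hW hmem]
    refine (Nat.div_mul_le_self _ _).trans_lt ?_
    exact List.idxOf_lt_length_iff.2 ((mem_nodeList x hW).1 hmem).1

theorem nodeList_zero (hW : W.Nodup) {t i : ℕ} {p : Fin n}
    (hp : (nodeList x W 0 t)[i]? = some p) : W[t]? = some p := by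
  obtain ⟨hi, hpi⟩ := List.getElem?_eq_some_iff.1 hp
  obtain ⟨h1, h2⟩ := (mem_nodeList x hW).1 (hpi ▸ List.getElem_mem hi : p ∈ _)
  rw [pow_zero, Nat.div_one] at h2
  rw [← h2]
  exact List.getElem?_idxOf h1

theorem cntSym_le_self (j d t c i : ℕ) : cntSym x W j d t c i ≤ i := by
  refine List.countP_le_length.trans ?_
  rw [List.length_take]
  exact min_le_left _ _

theorem cntSym_add_le (j d t c i k : ℕ) :
    cntSym x W j d t c (i + k) ≤ cntSym x W j d t c i + k := by
  unfold cntSym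
  rw [List.countP_take_add]
  refine Nat.add_le_add_left (List.countP_le_length.trans ?_) _
  rw [List.length_take]
  exact min_le_left _ _

theorem cntSym_mono {j d t c i k : ℕ} (h : i ≤ k) :
    cntSym x W j d t c i ≤ cntSym x W j d t c k := by
  obtain ⟨k, rfl⟩ := Nat.exists_eq_add_of_le h
  unfold cntSym
  rw [List.countP_take_add]
  exact Nat.le_add_right _ _

theorem cntSym_one_eq_sum {j t i : ℕ} (hi : i ≤ (nodeList x W (j + 1) t).length) :
    cntSym x W j 1 t 1 i = ∑ r ∈ Finset.range i, symAt x W j 1 t r := by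
  refine List.countP_take_eq_sum _ _ (fun k hk => ?_) hi
  have h := leafDigit_lt (W := W) j 1 (nodeList x W (j + 1) t)[k]
  simp only [symAt, List.getElem?_eq_getElem hk, Option.elim, decide_eq_true_eq]
  split <;> omega

theorem cntSym_zero_add_one {j t i : ℕ} (hi : i ≤ (nodeList x W (j + 1) t).length) :
    cntSym x W j 1 t 0 i + cntSym x W j 1 t 1 i = i := by
  unfold cntSym
  have h := List.length_eq_countP_add_countP
    (fun p => decide (leafDigit W j 1 p = 0)) (l := (nodeList x W (j + 1) t).take i)
  rw [List.length_take, min_eq_left hi] at h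
  conv_rhs => rw [h]
  congr 1
  refine List.countP_congr fun p _ => ?_
  have := leafDigit_lt (W := W) j 1 p
  simp
  omega

/-- The stored rank starts at the superblock boundary, so it is smaller than the superblock length
`2 ^ d * b`; the digit takes `d` further bits. -/
theorem jumpField_lt (j d t i : ℕ) (hb : 1 ≤ b) :
    jumpField x W j d t (2 ^ d * b) i < 2 ^ (2 * d) * b := by
  unfold jumpField
  set s := symAt x W j d t i
  have h1 : s < 2 ^ d := symAt_lt j d t i
  set L := 2 ^ d * b with hL
  have hL0 : 0 < L := by positivity
  have h2 := cntSym_add_le (x := x) (W := W) j d t s (i / L * L) (i % L)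
  rw [mul_comm, Nat.div_add_mod, mul_comm] at h2
  have h3 := Nat.mod_lt i hL0
  have h4 : 2 ^ d * (cntSym x W j d t s i - cntSym x W j d t s (i / L * L) + 1) ≤ 2 ^ d * L :=
    Nat.mul_le_mul_left _ (by omega)
  have h5 : 2 ^ (2 * d) * b = 2 ^ d * L := by rw [hL, two_mul, pow_add, mul_assoc]
  rw [h5]
  rw [mul_add] at h4
  omega

end facts

/-! ### Programs that work at a node -/

def blockLenExpr : RExpr := .ld (.lit 0) (.lit 0)

/-- The packed bits of the block that contains index `r i` of the node at `r a`. -/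
def bitsExpr (a i : ℕ) : RExpr :=
  .ld (.ld (.reg a) (.lit 4)) (.op .div (.reg i) blockLenExpr)

/-- The number of ones before index `r i`. -/
def rankExpr (a i : ℕ) : RExpr :=
  .op .add (.ld (.ld (.reg a) (.lit 5)) (.op .div (.reg i) blockLenExpr))
    (.ld (.lit 2) (.op .mod (bitsExpr a i) (.op .shl (.lit 1) (.op .mod (.reg i) blockLenExpr))))

def bitExpr (a i : ℕ) : RExpr :=
  .op .mod (.op .shr (bitsExpr a i) (.op .mod (.reg i) blockLenExpr)) (.lit 2)

/-- The field of index `r i` in the jump record at `r p`. -/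
def fieldExpr (p i : ℕ) : RExpr :=
  .op .mod (.op .shr (.ld (.ld (.reg p) (.lit 4)) (.op .div (.reg i) (.ld (.reg p) (.lit 1))))
    (.op .mul (.ld (.reg p) (.lit 2)) (.op .mod (.reg i) (.ld (.reg p) (.lit 1)))))
    (.op .shl (.lit 1) (.ld (.reg p) (.lit 2)))

/-- One step down in the decoding of an entry: register `0` holds the node, `1` the index. -/
def stepDown : Prog :=
  asg 3 (.ld (.reg 0) (.lit 1)) ;;
  .ite 3
    (asg 4 (fieldExpr 3 1) ;;
      asg 5 (.op .mod (.reg 4) (.ld (.reg 3) (.lit 3))) ;;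
      asg 0 (.ld (.ld (.reg 3) (.lit 5)) (.reg 5)) ;;
      asg 1 (.op .add (.op .div (.reg 4) (.ld (.reg 3) (.lit 3)))
        (.ld (.ld (.reg 3) (.lit 6)) (.op .add (.op .mul (.op .div (.reg 1)
          (.ld (.reg 3) (.lit 0))) (.ld (.reg 3) (.lit 3))) (.reg 5)))))
    (asg 5 (rankExpr 0 1) ;;
      asg 6 (bitExpr 0 1) ;;
      .ite 6 (asg 1 (.reg 5) ;; asg 0 (.ld (.reg 0) (.lit 3)))
        (asg 1 (.op .sub (.reg 1) (.reg 5)) ;; asg 0 (.ld (.reg 0) (.lit 2)))) ;;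
  asg 2 (.ld (.reg 0) (.lit 0))

/-- Decode the entry with index in register `1` of the node in register `0`, into register `2`. -/
def decode : Prog :=
  asg 2 (.ld (.reg 0) (.lit 0)) ;; .loop 2 stepDown ;; asg 2 (.ld (.reg 0) (.lit 1))

section wp
variable {w n : ℕ} {M : List (Cell w)} {q : Fin 3 → ℝ} {b B H : ℕ} {x y : Fin n → Coord}
  {W : List (Fin n)} {addr : ℕ → ℕ → ℕ}

theorem lit_lt_two_pow (hw : 8 ≤ w) {k : ℕ} (hk : k < 100) : k < 2 ^ w :=
  hk.trans_le ((by norm_num : 100 ≤ 2 ^ 8).trans (Nat.pow_le_pow_right (by norm_num) hw))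

theorem val_ld_reg_lit (hw : 8 ≤ w) {env : ℕ → ℕ} {r k a v : ℕ} (hr : r < 100) (hk : k < 100)
    (ha : env r = a) (h : wordAt M (a + k) = some v) :
    (RExpr.ld (.reg r) (.lit k)).Val M q env v :=
  ⟨a, ⟨hr, ha.symm⟩, k, ⟨rfl, lit_lt_two_pow hw hk⟩, h⟩

theorem val_blockLen (hT : HasTable M b) {env : ℕ → ℕ} :
    blockLenExpr.Val M q env b :=
  ⟨0, ⟨rfl, by positivity⟩, 0, ⟨rfl, by positivity⟩, hT.block⟩

theorem val_bitsExpr (hw : 8 ≤ w) (hT : HasTable M b) {env : ℕ → ℕ} {ra ri j t a i jp bits ones : ℕ}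
    (hN : InnerAt M b x y W addr j t a jp bits ones) (hra : ra < 100) (hri : ri < 100)
    (ha : env ra = a) (hi : env ri = i) (hle : i ≤ (nodeList x W (j + 1) t).length) :
    (bitsExpr ra ri).Val M q env (packDigits 2 b fun r => symAt x W j 1 t (i / b * b + r)) :=
  ⟨bits, val_ld_reg_lit hw hra (by norm_num) ha hN.bitsPtr, i / b,
    ⟨i, ⟨hri, hi.symm⟩, b, val_blockLen hT, rfl⟩,
    hN.bitsArr _ (Nat.lt_succ_of_le (Nat.div_le_div_right hle))⟩

theorem val_modExpr (hT : HasTable M b) {env : ℕ → ℕ} {ri i : ℕ} (hri : ri < 100)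
    (hi : env ri = i) : (RExpr.op .mod (.reg ri) blockLenExpr).Val M q env (i % b) :=
  ⟨i, ⟨hri, hi.symm⟩, b, val_blockLen hT, rfl⟩

/-- The number of ones is the sample at the start of the block plus the popcount of the bits before
`i` in the block, isolated by a remainder modulo a power of two. The index may equal the length of
the list, since both arrays have one cell more than there are full blocks. -/
theorem val_rankExpr (hw : 8 ≤ w) (hT : HasTable M b) {env : ℕ → ℕ}
    {ra ri j t a i jp bits ones : ℕ}
    (hN : InnerAt M b x y W addr j t a jp bits ones) (hra : ra < 100) (hri : ri < 100)
    (ha : env ra = a) (hi : env ri = i) (hle : i ≤ (nodeList x W (j + 1) t).length)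
    (hiw : i < 2 ^ w) :
    (rankExpr ra ri).Val M q env (cntSym x W j 1 t 1 i) := by
  have hb := hT.pos
  have hmod : i % b < b := Nat.mod_lt _ hb
  have hsym : ∀ k r, symAt x W j 1 t (k + r) < 2 := fun k r => by
    simpa using symAt_lt (x := x) (W := W) j 1 t (k + r)
  have hdm : i / b * b + i % b = i := by rw [mul_comm]; exact Nat.div_add_mod i b
  have hsum : cntSym x W j 1 t 1 i = cntSym x W j 1 t 1 (i / b * b) +
      popcount b (packDigits 2 (i % b) fun r => symAt x W j 1 t (i / b * b + r)) := by
    rw [popcount_packDigits (hsym _) hmod.le, cntSym_one_eq_sum hle,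
      cntSym_one_eq_sum (by omega)]
    conv_lhs => rw [← hdm]
    rw [Finset.sum_range_add]
  refine ⟨_, ⟨ones, val_ld_reg_lit hw hra (by norm_num) ha hN.onesPtr, i / b,
    ⟨i, ⟨hri, hi.symm⟩, b, val_blockLen hT, rfl⟩,
    hN.onesArr _ (Nat.lt_succ_of_le (Nat.div_le_div_right hle))⟩,
    popcount b (packDigits 2 (i % b) fun r => symAt x W j 1 t (i / b * b + r)),
    ⟨2, ⟨rfl, lit_lt_two_pow hw (by norm_num)⟩, _, ⟨_, val_bitsExpr hw hT hN hra hri ha hi hle, _,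
      ⟨1, ⟨rfl, lit_lt_two_pow hw (by norm_num)⟩, _, val_modExpr hT hri hi,
        (one_mul _).symm, ?_⟩, rfl⟩, ?_⟩, ?_⟩
  · rw [one_mul]
    exact Nat.pow_lt_pow_right (by norm_num) (hmod.trans hT.lt)
  · rw [packDigits_mod (hsym _) hmod.le]
    refine hT.table _ ((packDigits_lt (hsym _) _).trans_le ?_)
    exact Nat.pow_le_pow_right (by norm_num) hmod.le
  · change _ = _ % _
    rw [← hsum, Nat.mod_eq_of_lt ((cntSym_le_self _ _ _ _ _).trans_lt hiw)]

theorem val_bitExpr (hw : 8 ≤ w) (hT : HasTable M b) {env : ℕ → ℕ}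
    {ra ri j t a i jp bits ones : ℕ}
    (hN : InnerAt M b x y W addr j t a jp bits ones) (hra : ra < 100) (hri : ri < 100)
    (ha : env ra = a) (hi : env ri = i) (hle : i ≤ (nodeList x W (j + 1) t).length) :
    (bitExpr ra ri).Val M q env (symAt x W j 1 t i) := by
  have hb := hT.pos
  have hmod : i % b < b := Nat.mod_lt _ hb
  have hsym : ∀ k r, symAt x W j 1 t (k + r) < 2 := fun k r => by
    simpa using symAt_lt (x := x) (W := W) j 1 t (k + r)
  have hdm : i / b * b + i % b = i := by rw [mul_comm]; exact Nat.div_add_mod i b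
  refine ⟨_, ⟨_, val_bitsExpr hw hT hN hra hri ha hi hle, _, val_modExpr hT hri hi, rfl⟩, 2,
    ⟨rfl, lit_lt_two_pow hw (by norm_num)⟩, ?_⟩
  change _ = _ % 2
  rw [packDigits_digit (hsym _) hmod, hdm]

/-- A field is digit number `i % e` in base `2 ^ g` of word number `i / e`; `e * g < w` guarantees
that neither the word nor the shift amount overflows. -/
theorem val_fieldExpr (hw : 8 ≤ w) (hT : HasTable M b) {env : ℕ → ℕ}
    {rp ri j d t jp e g i fields child cnt : ℕ}
    (hJ : JumpAt M b x W addr j d t jp e g fields child cnt) (hrp : rp < 100) (hri : ri < 100)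
    (hp : env rp = jp) (hi : env ri = i) (hle : i ≤ (nodeList x W (j + d) t).length) :
    (fieldExpr rp ri).Val M q env (jumpField x W j d t (2 ^ d * b) i) := by
  have hmod : i % e < e := Nat.mod_lt _ hJ.epos
  have hdm : i / e * e + i % e = i := by rw [mul_comm]; exact Nat.div_add_mod i e
  have hf : ∀ k r, jumpField x W j d t (2 ^ d * b) (k + r) < 2 ^ g := fun k r =>
    (jumpField_lt _ _ _ _ hT.pos).trans_le hJ.bg
  have he : (RExpr.ld (.reg rp) (.lit 1)).Val M q env e :=
    val_ld_reg_lit hw hrp (by norm_num) hp hJ.per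
  have hg : (RExpr.ld (.reg rp) (.lit 2)).Val M q env g :=
    val_ld_reg_lit hw hrp (by norm_num) hp hJ.width
  have hgw : g < w := (Nat.le_mul_of_pos_left g hJ.epos).trans_lt hJ.egw
  refine ⟨_, ⟨_, ⟨fields, val_ld_reg_lit hw hrp (by norm_num) hp hJ.fieldsPtr, i / e,
    ⟨i, ⟨hri, hi.symm⟩, e, he, rfl⟩,
    hJ.fieldsArr _ (Nat.lt_succ_of_le (Nat.div_le_div_right hle))⟩, _,
    ⟨g, hg, i % e, ⟨i, ⟨hri, hi.symm⟩, e, he, rfl⟩, rfl, ?_⟩, rfl⟩, _,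
    ⟨1, ⟨rfl, lit_lt_two_pow hw (by norm_num)⟩, g, hg, rfl, ?_⟩, ?_⟩
  · refine lt_of_le_of_lt (Nat.mul_le_mul_left g hmod.le) ?_
    rw [mul_comm]
    exact hJ.egw.trans Nat.lt_two_pow_self
  · rw [one_mul]
    exact Nat.pow_lt_pow_right (by norm_num) hgw
  · change _ = _ / _ % _
    rw [one_mul, pow_mul, packDigits_digit (hf _) hmod, hdm]

/-- One step: from height `h > 0` to a smaller height, on the way to the leaf of an entry. -/
theorem wp_stepDown (hw : 8 ≤ w) (hM : M.length ≤ 2 ^ w) (hT : HasTable M b) (hB : 2 ≤ B)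
    (hW : W.Nodup) (hA : TreeAt M b x y W B H addr) {j t i : ℕ} {p : Fin n} {σ : AState}
    (hj : j + 1 ≤ H) (ht : t * 2 ^ (j + 1) < W.length)
    (hp : (nodeList x W (j + 1) t)[i]? = some p) (h0 : σ.env 0 = addr (j + 1) t)
    (h1 : σ.env 1 = i) (hiw : i < 2 ^ w) :
    WP M q stepDown σ fun σ' => ∃ h t' i', h ≤ j ∧
      (Nat.digits B h).sum + 1 = (Nat.digits B (j + 1)).sum ∧ t' * 2 ^ h < W.length ∧
      (nodeList x W h t')[i']? = some p ∧ σ'.env 0 = addr h t' ∧ σ'.env 1 = i' ∧ i' < 2 ^ w ∧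
      σ'.env 2 = (if h = 0 then 0 else 1) ∧ (∀ r, 8 ≤ r → σ'.env r = σ.env r) ∧
      σ'.out = σ.out ∧ σ'.time ≤ σ.time + 100 := by
  have hw2 : 2 ≤ w := by omega
  obtain ⟨jp, bits, ones, hN, hjump⟩ := hA.inner j hj t ht
  have hlt : i < (nodeList x W (j + 1) t).length := (List.getElem?_eq_some_iff.1 hp).1
  have hflag : ∀ h t', h ≤ H → t' * 2 ^ h < W.length →
      wordAt M (addr h t' + 0) = some (if h = 0 then 0 else 1) := by
    intro h t' hh ht'
    cases h with
    | zero => simpa using (hA.leaf t' (by simpa using ht')).flag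
    | succ h =>
      obtain ⟨_, _, _, hN', -⟩ := hA.inner h hh t' ht'
      simpa using hN'.flag
  refine WP.seq (WP.asg hw2 hM (by norm_num)
    (val_ld_reg_lit hw (by norm_num) (by norm_num) h0 hN.jump) ?_)
  refine WP.seq (WP.ite (by norm_num) (fun hne => ?_) (fun hz => ?_))
  · simp only [AState.upd_env, if_true] at hne
    rcases hjump with ⟨-, h⟩ | ⟨-, j', e, g, fields, child, cnt, hj', hJ⟩
    · exact absurd h hne
    obtain ⟨_, -, -, hds⟩ := jumpLen_spec hB (Nat.succ_pos j)
    have hd1 := jumpLen_pos hB (Nat.succ_pos j)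
    set d := jumpLen B (j + 1) with hd
    rw [show j.succ - d = j' by omega] at hds
    rw [← hj'] at hp hlt ht
    obtain ⟨hs1, hs2⟩ := nodeList_step hW hp
    have hsl := symAt_lt (x := x) (W := W) j' d t i
    set s := symAt x W j' d t i with hs
    set L := 2 ^ d * b with hL
    have hb := hT.pos
    have hL0 : 0 < L := by positivity
    have hmono : cntSym x W j' d t s (i / L * L) ≤ cntSym x W j' d t s i :=
      cntSym_mono (Nat.div_mul_le_self _ _)
    have hcle := cntSym_le_self (x := x) (W := W) j' d t s i
    have hfield : jumpField x W j' d t L i = s + 2 ^ d * (cntSym x W j' d t s i -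
        cntSym x W j' d t s (i / L * L)) := rfl
    -- The superblock counters form a matrix stored by rows: one row per superblock, one column per
    -- digit.
    have hidx : (i / L * 2 ^ d + s) < ((nodeList x W (j' + d) t).length / L + 1) * 2 ^ d := by
      have := Nat.mul_le_mul_right (2 ^ d) (Nat.div_le_div_right (c := L) hlt.le)
      rw [add_mul]
      omega
    -- Since `L` is a multiple of `2 ^ d`, the row offset computed by the program is at most `i`, so
    -- the multiplication does not overflow.
    have hil : i / L * 2 ^ d ≤ i := by
      refine le_trans (Nat.mul_le_mul_left _ ?_) (Nat.div_mul_le_self i L)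
      rw [hL]
      exact Nat.le_mul_of_pos_right _ hb
    have hdg : 2 ^ d ≤ 2 ^ w := (wordAt_lt hJ.deg).le
    refine WP.seq (WP.asg hw2 hM (by norm_num) (val_fieldExpr hw hT hJ (by norm_num) (by norm_num)
      (by simp) (i := i) (by simp [h1]) hlt.le) ?_)
    refine WP.seq (WP.asg hw2 hM (by norm_num) (v := s) ⟨_, ⟨by norm_num, rfl⟩, 2 ^ d,
      val_ld_reg_lit hw (by norm_num) (by norm_num) (a := jp) (by simp) hJ.deg, ?_⟩ ?_)
    · change _ = _ % _
      simp only [AState.upd_env, if_true]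
      rw [← hL, hfield, Nat.add_mul_mod_self_left, Nat.mod_eq_of_lt hsl]
    refine WP.seq (WP.asg hw2 hM (by norm_num) (v := addr j' (t * 2 ^ d + s)) ⟨child,
      val_ld_reg_lit hw (by norm_num) (by norm_num) (a := jp) (by simp) hJ.childPtr, s,
      ⟨by norm_num, by simp⟩, hJ.childArr _ hsl⟩ ?_)
    have hcv := hJ.cntArr _ hidx
    have e1 : (i / L * 2 ^ d + s) % 2 ^ d = s := by
      rw [mul_comm, Nat.mul_add_mod, Nat.mod_eq_of_lt hsl]
    have e2 : (i / L * 2 ^ d + s) / 2 ^ d = i / L := by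
      rw [mul_comm, Nat.mul_add_div (by positivity), Nat.div_eq_of_lt hsl, add_zero]
    beta_reduce at hcv
    rw [e1, e2, ← hL] at hcv
    -- Dividing by `2 ^ d` strips the digit and leaves the rank within the superblock; adding the
    -- counter at the superblock's start restores the full rank.
    have e3 : jumpField x W j' d t L i / 2 ^ d =
        cntSym x W j' d t s i - cntSym x W j' d t s (i / L * L) := by
      rw [hfield, Nat.add_mul_div_left _ _ (by positivity), Nat.div_eq_of_lt hsl, zero_add]
    refine WP.asg hw2 hM (by norm_num) (v := cntSym x W j' d t s i) ⟨_,
      ⟨_, ⟨by norm_num, rfl⟩, 2 ^ d,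
        val_ld_reg_lit hw (by norm_num) (by norm_num) (a := jp) (by simp) hJ.deg, rfl⟩, _,
      ⟨cnt, val_ld_reg_lit hw (by norm_num) (by norm_num) (a := jp) (by simp) hJ.cntPtr,
        i / L * 2 ^ d + s,
        ⟨i / L * 2 ^ d, ⟨i / L, ⟨i, ⟨by norm_num, by simp [h1]⟩, L,
          val_ld_reg_lit hw (by norm_num) (by norm_num) (a := jp) (by simp) hJ.len, rfl⟩, 2 ^ d,
          val_ld_reg_lit hw (by norm_num) (by norm_num) (a := jp) (by simp) hJ.deg, rfl,
          hil.trans_lt hiw⟩, s, ⟨by norm_num, by simp⟩, ?_⟩, hcv⟩, ?_⟩ ?_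
    · have := wordAt_addr_lt hcv
      exact (Nat.mod_eq_of_lt (by omega)).symm
    · simp only [AState.upd_env, WordOp.spec]
      simp only [Nat.reduceEqDiff, if_false, if_true, ← hL, e3]
      rw [Nat.mod_eq_of_lt] <;> omega
    · refine WP.asg hw2 hM (by norm_num) (val_ld_reg_lit hw (by norm_num) (by norm_num)
        (a := addr j' (t * 2 ^ d + s)) (by simp) (hflag _ _ (by omega) hs2)) ?_
      refine ⟨j', t * 2 ^ d + s, cntSym x W j' d t s i, by omega, hds, hs2, hs1, by simp, by simp,
        hcle.trans_lt hiw, by simp, fun r hr => ?_, by simp, ?_⟩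
      · simp (disch := omega) [AState.upd_env, if_neg]
      · simp [RExpr.cost, fieldExpr]
  · simp only [AState.upd_env, if_true] at hz
    subst hz
    rcases hjump with ⟨hd, -⟩ | ⟨h, -⟩
    swap
    · exact absurd rfl h
    obtain ⟨_, -, -, hds⟩ := jumpLen_spec hB (Nat.succ_pos j)
    rw [hd] at hds
    obtain ⟨hs1, hs2⟩ := nodeList_step hW hp
    have hsl := symAt_lt (x := x) (W := W) j 1 t i
    set s := symAt x W j 1 t i with hs
    have hcle := cntSym_le_self (x := x) (W := W) j 1 t s i
    have hsum := cntSym_zero_add_one (x := x) (W := W) hlt.le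
    refine WP.seq (WP.asg hw2 hM (by norm_num) (val_rankExpr hw hT hN (by norm_num)
      (by norm_num) (by simp [h0]) (i := i) (by simp [h1]) hlt.le hiw) ?_)
    refine WP.seq (WP.asg hw2 hM (by norm_num) (val_bitExpr hw hT hN (by norm_num)
      (by norm_num) (by simp [h0]) (i := i) (by simp [h1]) hlt.le) ?_)
    refine WP.ite (by norm_num) (fun hne => ?_) (fun hz => ?_)
    · simp only [AState.upd_env, if_true, ← hs] at hne
      have hs1' : s = 1 := by omega
      rw [hs1', mul_comm t, pow_one] at hs1 hs2
      refine WP.seq (WP.asg hw2 hM (by norm_num) (v := cntSym x W j 1 t 1 i)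
        ⟨by norm_num, by simp⟩ ?_)
      refine WP.asg hw2 hM (by norm_num) (val_ld_reg_lit hw (by norm_num) (by norm_num)
        (a := addr (j + 1) t) (by simp [h0]) hN.right) ?_
      refine WP.asg hw2 hM (by norm_num) (val_ld_reg_lit hw (by norm_num) (by norm_num)
        (a := addr j (2 * t + 1)) (by simp) (hflag _ _ (by omega) hs2)) ?_
      refine ⟨j, 2 * t + 1, cntSym x W j 1 t 1 i, le_rfl, hds, hs2, hs1, by simp, by simp,
        (by rw [hs1'] at hcle; omega), by simp, fun r hr => ?_, by simp, ?_⟩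
      · simp (disch := omega) [AState.upd_env, if_neg]
      · simp [RExpr.cost, rankExpr, bitExpr, bitsExpr, blockLenExpr]
    · simp only [AState.upd_env, if_true, ← hs] at hz
      rw [hz, mul_comm t, pow_one, add_zero] at hs1 hs2
      refine WP.seq (WP.asg hw2 hM (by norm_num) (v := cntSym x W j 1 t 0 i)
        ⟨i, ⟨by norm_num, by simp [h1]⟩, cntSym x W j 1 t 1 i, ⟨by norm_num, by simp⟩, ?_⟩ ?_)
      · change _ = _ - _ ∧ _ ≤ _
        omega
      refine WP.asg hw2 hM (by norm_num) (val_ld_reg_lit hw (by norm_num) (by norm_num)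
        (a := addr (j + 1) t) (by simp [h0]) hN.left) ?_
      refine WP.asg hw2 hM (by norm_num) (val_ld_reg_lit hw (by norm_num) (by norm_num)
        (a := addr j (2 * t)) (by simp) (hflag _ _ (by omega) hs2)) ?_
      refine ⟨j, 2 * t, cntSym x W j 1 t 0 i, le_rfl, hds, hs2, hs1, by simp, by simp,
        (by rw [hz] at hcle; omega), by simp, fun r hr => ?_, by simp, ?_⟩
      · simp (disch := omega) [AState.upd_env, if_neg]
      · simp [RExpr.cost, rankExpr, bitExpr, bitsExpr, blockLenExpr]

end wp

/-! ### Decoding an entry of a bottom list -/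

/-- From the address `a`, the entries of the list `P` can be decoded within time `T`. -/
def Handle {w n : ℕ} (M : List (Cell w)) (T a : ℕ) (P : List (Fin n)) : Prop :=
  ∀ (q : Fin 3 → ℝ) (i : ℕ) (p : Fin n) (σ : AState), P[i]? = some p → σ.env 0 = a →
    σ.env 1 = i → WP M q decode σ fun σ' => (∀ r, 8 ≤ r → σ'.env r = σ.env r) ∧
      σ'.out = σ.out ∧ σ'.env 2 = p ∧ σ'.time ≤ σ.time + T

section decode
variable {w n : ℕ} {M : List (Cell w)} {q : Fin 3 → ℝ} {b B H : ℕ} {x y : Fin n → Coord}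
  {W : List (Fin n)} {addr : ℕ → ℕ → ℕ}

/-- Each round lowers the digit sum of the height by one, whatever the jump length, so the digit sum
bounds the number of rounds; termination itself follows from the falling height. -/
theorem wp_loop_stepDown (hw : 8 ≤ w) (hM : M.length ≤ 2 ^ w) (hT : HasTable M b) (hB : 2 ≤ B)
    (hW : W.Nodup) (hA : TreeAt M b x y W B H addr) {p : Fin n} :
    ∀ (h t i : ℕ) (σ : AState), h ≤ H → t * 2 ^ h < W.length →
    (nodeList x W h t)[i]? = some p → σ.env 0 = addr h t → σ.env 1 = i → i < 2 ^ w →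
    σ.env 2 = (if h = 0 then 0 else 1) →
    WP M q (.loop 2 stepDown) σ fun σ' => ∃ t', W[t']? = some p ∧ σ'.env 0 = addr 0 t' ∧
      (∀ r, 8 ≤ r → σ'.env r = σ.env r) ∧ σ'.out = σ.out ∧
      σ'.time ≤ σ.time + 101 * (Nat.digits B h).sum + 1 := by
  intro h
  induction h using Nat.strong_induction_on with
  | _ h ih =>
    intro t i σ hh ht hp h0 h1 hi h2
    cases h with
    | zero =>
      exact WP.loop_done (by norm_num) (by simpa using h2)
        ⟨t, nodeList_zero hW hp, h0, fun _ _ => rfl, rfl, by simp⟩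
    | succ j =>
      refine WP.loop_step (by norm_num) (by simp [h2]) ?_
      refine (wp_stepDown hw hM hT hB hW hA hh ht hp (by simpa using h0) (by simpa using h1) hi).mono
        ?_
      rintro σ₁ ⟨h', t', i', hj, hds, ht', hp', h0', h1', hi', h2', hf, ho, htime⟩
      refine (ih h' (by omega) t' i' σ₁ (by omega) ht' hp' h0' h1' hi' h2').mono ?_
      rintro σ₂ ⟨t'', hp'', h0'', hf'', ho'', htime''⟩
      refine ⟨t'', hp'', h0'', fun r hr => by rw [hf'' r hr, hf r hr]; simp, by rw [ho'', ho]; rfl,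
        ?_⟩
      simp only [AState.tick_time] at htime
      omega

/-- A round costs at most `100` steps and one test, and there are at most `K * B` rounds; this is
where the bound `lg^ε n` for decoding comes from. -/
theorem TreeAt.handle (hw : 8 ≤ w) (hM : M.length ≤ 2 ^ w) (hT : HasTable M b) (hB : 2 ≤ B)
    (hn : n < 2 ^ w) (hW : W.Nodup) (hA : TreeAt M b x y W B H addr) {K h t : ℕ} (hK : H < B ^ K)
    (hh : h ≤ H) (ht : t * 2 ^ h < W.length) :
    Handle M (101 * (K * B) + 20) (addr h t) (nodeList x W h t) := by
  intro q i p σ hp h0 h1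
  have hw2 : 2 ≤ w := by omega
  have hi : i < 2 ^ w := by
    have h3 := (List.getElem?_eq_some_iff.1 hp).1
    have h4 := (nodup_sortByKey x (W.block (2 ^ h) t).toFinset).length_le_card
    rw [Fintype.card_fin] at h4
    unfold nodeList at h3
    omega
  have hflag : wordAt M (addr h t + 0) = some (if h = 0 then 0 else 1) := by
    cases h with
    | zero => simpa using (hA.leaf t (by simpa using ht)).flag
    | succ h =>
      obtain ⟨_, _, _, hN', -⟩ := hA.inner h hh t ht
      simpa using hN'.flag
  refine WP.seq (WP.asg hw2 hM (by norm_num)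
    (val_ld_reg_lit hw (by norm_num) (by norm_num) h0 hflag) ?_)
  refine WP.seq ((wp_loop_stepDown hw hM hT hB hW hA h t i _ hh ht hp (by simpa using h0)
    (by simpa using h1) hi (by simp)).mono ?_)
  rintro σ₁ ⟨t', hp', h0', hf, ho, htime⟩
  refine WP.asg hw2 hM (by norm_num) (val_ld_reg_lit hw (by norm_num) (by norm_num) h0'
    ((hA.leaf t' (List.getElem?_eq_some_iff.1 hp').1).id p hp')) ?_
  have hds := digits_sum_le hB (lt_of_le_of_lt hh hK)
  refine ⟨fun r hr => ?_, by simp [ho], by simp, ?_⟩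
  · simp (disch := omega) [AState.upd_env, if_neg, hf r hr]
  · simp only [AState.upd_time, RExpr.cost] at htime ⊢
    omega

end decode

/-! ### Traversals that collect prefixes of bottom lists -/

/-- The prefixes in `L` are disjoint, they make up the set `S`, and there are at most `N`. -/
structure Collects {n : ℕ} (Ls : List (List (Fin n))) (S : Fin n → Prop) (N : ℕ)
    (L : List (List (Fin n))) : Prop where
  nodup : L.flatten.Nodup
  mem : ∀ i, i ∈ L.flatten ↔ S i
  pref : ∀ P ∈ L, P ≠ [] ∧ ∃ Q ∈ Ls, P <+: Q
  len : L.length ≤ N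

theorem Collects.nil {n : ℕ} {Ls : List (List (Fin n))} {S : Fin n → Prop} {N : ℕ}
    (h : ∀ i, ¬ S i) : Collects Ls S N [] :=
  ⟨by simp, fun i => by simpa using h i, by simp, by simp⟩

theorem Collects.append {n : ℕ} {Ls L₁ L₂ : List (List (Fin n))} {S S₁ S₂ : Fin n → Prop}
    {N N₁ N₂ : ℕ} (h₁ : Collects Ls S₁ N₁ L₁) (h₂ : Collects Ls S₂ N₂ L₂)
    (hd : ∀ i, S₁ i → ¬ S₂ i) (hS : ∀ i, S i ↔ S₁ i ∨ S₂ i) (hN : N₁ + N₂ ≤ N) :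
    Collects Ls S N (L₁ ++ L₂) := by
  refine ⟨?_, fun i => ?_, fun P hP => ?_, ?_⟩
  · rw [List.flatten_append, List.nodup_append']
    refine ⟨h₁.nodup, h₂.nodup, fun i hi hi' => ?_⟩
    exact hd i ((h₁.mem i).1 hi) ((h₂.mem i).1 hi')
  · rw [List.flatten_append, List.mem_append, h₁.mem, h₂.mem, hS]
  · rcases List.mem_append.1 hP with h | h
    · exact h₁.pref P h
    · exact h₂.pref P h
  · have := h₁.len
    have := h₂.len
    rw [List.length_append]
    omega

/-- The action `act` on a prefix of length `r 9` of the list of the node `r 8`: it extends the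
record `Acc`, which depends on register `99` and on the output. -/
def IsAction {w n : ℕ} (M : List (Cell w)) (q : Fin 3 → ℝ) (T a c : ℕ) (act : Prog)
    (Acc : ℕ → List ℕ → List (List (Fin n)) → Prop) : Prop :=
  ∀ (σ : AState) (L : List (List (Fin n))) (h : ℕ) (P : List (Fin n)) (i : ℕ),
    Handle M T h P → 0 < i → i ≤ P.length → σ.env 8 = h → σ.env 9 = i →
    Acc (σ.env 99) σ.out L → WP M q act σ fun σ' =>
      (∀ r, 12 ≤ r → r ≠ 99 → σ'.env r = σ.env r) ∧
      Acc (σ'.env 99) σ'.out (L ++ [P.take i]) ∧ σ'.time ≤ σ.time + a + c * i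

/-- The effect of a traversal that collects the set `S` without changing a register from `K` on. -/
def Traversed {n : ℕ} (Ls : List (List (Fin n))) (a c : ℕ)
    (Acc : ℕ → List ℕ → List (List (Fin n)) → Prop) (K : ℕ) (σ : AState)
    (L₀ : List (List (Fin n))) (S : Fin n → Prop) (N T : ℕ) (σ' : AState) : Prop :=
  (∀ r, K ≤ r → r ≠ 99 → σ'.env r = σ.env r) ∧ ∃ L, Collects Ls S N L ∧
    Acc (σ'.env 99) σ'.out (L₀ ++ L) ∧
    σ'.time ≤ σ.time + T + a * L.length + c * L.flatten.length

section trav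
variable {w n : ℕ} {M : List (Cell w)} {q : Fin 3 → ℝ} {Ls : List (List (Fin n))} {a c : ℕ}
  {Acc : ℕ → List ℕ → List (List (Fin n)) → Prop}

theorem Traversed.nil {K N T : ℕ} {σ σ' : AState} {L₀ : List (List (Fin n))} {S : Fin n → Prop}
    (hS : ∀ i, ¬ S i) (hf : ∀ r, K ≤ r → r ≠ 99 → σ'.env r = σ.env r)
    (hacc : Acc (σ'.env 99) σ'.out L₀) (ht : σ'.time ≤ σ.time + T) :
    Traversed Ls a c Acc K σ L₀ S N T σ' :=
  ⟨hf, [], Collects.nil hS, by simpa using hacc, by simp; omega⟩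

/-- A traversal whose result is relative to an earlier state. -/
theorem Traversed.weaken {K K' N N' T T' : ℕ} {σ σ₁ σ' : AState} {L₀ : List (List (Fin n))}
    {S S' : Fin n → Prop} (h : Traversed Ls a c Acc K σ₁ L₀ S N T σ') (hK : K ≤ K')
    (hf : ∀ r, K' ≤ r → r ≠ 99 → σ₁.env r = σ.env r) (hS : ∀ i, S i ↔ S' i) (hN : N ≤ N')
    (ht : σ₁.time + T ≤ σ.time + T') : Traversed Ls a c Acc K' σ L₀ S' N' T' σ' := by
  obtain ⟨h1, L, h2, h3, h4⟩ := h
  refine ⟨fun r hr hr' => (h1 r (hK.trans hr) hr').trans (hf r hr hr'), L,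
    ⟨h2.nodup, fun i => (h2.mem i).trans (hS i), h2.pref, h2.len.trans hN⟩, h3, by omega⟩

/-- The extra assertion `R` hands a loop invariant to the second program, which the description of a
traversal does not retain. -/
theorem WP.trav_comp {p p' : Prog} {K N N₁ N₂ T T₁ T₂ : ℕ} {σ : AState}
    {L₀ : List (List (Fin n))} {S S₁ S₂ : Fin n → Prop} {R : AState → Prop}
    (h₁ : WP M q p σ fun σ₁ => Traversed Ls a c Acc K σ L₀ S₁ N₁ T₁ σ₁ ∧ R σ₁)
    (h₂ : ∀ σ₁ L, R σ₁ → Acc (σ₁.env 99) σ₁.out L →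
      (∀ r, K ≤ r → r ≠ 99 → σ₁.env r = σ.env r) →
      WP M q p' σ₁ (Traversed Ls a c Acc K σ₁ L S₂ N₂ T₂))
    (hd : ∀ i, S₁ i → ¬ S₂ i) (hS : ∀ i, S i ↔ S₁ i ∨ S₂ i) (hN : N₁ + N₂ ≤ N)
    (ht : T₁ + T₂ ≤ T) :
    WP M q p σ fun σ₁ => WP M q p' σ₁ (Traversed Ls a c Acc K σ L₀ S N T) := by
  refine h₁.mono ?_
  rintro σ₁ ⟨⟨f1, L₁, c1, a1, t1⟩, hR⟩
  refine (h₂ σ₁ (L₀ ++ L₁) hR a1 f1).mono ?_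
  rintro σ₂ ⟨f2, L₂, c2, a2, t2⟩
  refine ⟨fun r hr hr' => (f2 r hr hr').trans (f1 r hr hr'), L₁ ++ L₂, c1.append c2 hd hS hN,
    by rwa [← List.append_assoc], ?_⟩
  simp only [List.length_append, List.flatten_append, mul_add]
  omega

/-- A loop that counts register `rc` down from `m`. -/
theorem wp_countdown {rc K N T : ℕ} (hrc : rc < 99) {body : Prog} {I : ℕ → AState → Prop}
    {S : ℕ → Fin n → Prop} (hI : ∀ k σ, I k σ → I k (σ.tick 1)) :
    ∀ (m k₀ : ℕ), (∀ k < m, ∀ k' < m, ∀ i, S (k₀ + k) i → S (k₀ + k') i → k = k') →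
    (∀ k < m, ∀ σ L, I (k₀ + k) σ → σ.env rc = m - k → Acc (σ.env 99) σ.out L →
      WP M q body σ fun σ' => Traversed Ls a c Acc K σ L (S (k₀ + k)) N T σ' ∧
        I (k₀ + k + 1) σ' ∧ σ'.env rc = m - (k + 1)) →
    ∀ σ L, I k₀ σ → σ.env rc = m → Acc (σ.env 99) σ.out L →
      WP M q (.loop rc body) σ (Traversed Ls a c Acc K σ L (fun i => ∃ k < m, S (k₀ + k) i)
        (m * N) (m * (T + 1) + 1)) := by
  intro m
  induction m with
  | zero =>
    intro k₀ _ _ σ L _ h0 hacc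
    exact WP.loop_done (by omega) h0
      (Traversed.nil (by simp) (fun _ _ _ => rfl) hacc (by simp))
  | succ m ih =>
    intro k₀ hd hbody σ L hI0 h0 hacc
    refine WP.loop_step (by omega) (by omega) ?_
    have hb := hbody 0 (by omega) (σ.tick 1) L (hI _ _ hI0) (by simpa using h0) hacc
    -- One unit is subtracted from the time because the loop test has already been charged to the
    -- starting state.
    refine WP.trav_comp (K := K) (N := (m + 1) * N) (T := (m + 1) * (T + 1) + 1 - 1)
      (S := fun i => ∃ k < m + 1, S (k₀ + k) i) hb (p' := .loop rc body)
      (S₂ := fun i => ∃ k < m, S (k₀ + 1 + k) i) (N₂ := m * N) (T₂ := m * (T + 1) + 1)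
      ?_ ?_ ?_ ?_ ?_ |>.mono ?_
    · rintro σ₁ L₁ ⟨hI1, hrc1⟩ hacc1 -
      refine ih (k₀ + 1) ?_ ?_ σ₁ L₁ hI1 (by omega) hacc1
      · intro k hk k' hk' i h h'
        have := hd (k + 1) (by omega) (k' + 1) (by omega) i
          (by rwa [show k₀ + (k + 1) = k₀ + 1 + k by ring])
          (by rwa [show k₀ + (k' + 1) = k₀ + 1 + k' by ring])
        omega
      · intro k hk σ L h1 h2 h3
        have := hbody (k + 1) (by omega) σ L (by rwa [show k₀ + (k + 1) = k₀ + 1 + k by ring])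
          (by omega) h3
        rw [show k₀ + (k + 1) = k₀ + 1 + k by ring] at this
        refine this.mono fun σ' h' => ⟨h'.1, h'.2.1, by have := h'.2.2; omega⟩
    · rintro i h1 ⟨k, hk, h2⟩
      have := hd 0 (by omega) (k + 1) (by omega) i h1
        (by rwa [show k₀ + (k + 1) = k₀ + 1 + k by ring])
      omega
    · intro i
      constructor
      · rintro ⟨k, hk, h⟩
        cases k with
        | zero => exact Or.inl h
        | succ k => exact Or.inr ⟨k, by omega, by rwa [show k₀ + 1 + k = k₀ + (k + 1) by ring]⟩
      · rintro (h | ⟨k, hk, h⟩)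
        · exact ⟨0, by omega, h⟩
        · exact ⟨k + 1, by omega, by rwa [show k₀ + (k + 1) = k₀ + 1 + k by ring]⟩
    · rw [add_mul]; omega
    · rw [add_mul]; omega
    · intro σ' h'
      refine h'.mono fun σ'' h'' => h''.weaken le_rfl (fun _ _ _ => rfl) (fun _ => Iff.rfl) le_rfl ?_
      simp
      omega

end trav

/-! ### Binary search -/

/-- The number of keys up to the query coordinate, in a padded array of `2 ^ m - 1` cells. Register
`22` holds the address before the array, `23` half of `2 ^ m`, and `24` receives the result. -/
def search (ax : Fin 3) : Prog :=
  asg 24 (.lit 0) ;;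
  .loop 23 (
    asg 25 (.op .lt (.cmp (.reg 22) (.op .add (.reg 24) (.reg 23)) ax) (.lit 2)) ;;
    asg 24 (.op .add (.reg 24) (.op .mul (.reg 25) (.reg 23))) ;;
    asg 23 (.op .div (.reg 23) (.lit 2)))

theorem cmpNat_lt_two (c c' : Coord) : (if cmpNat c c' < 2 then 1 else 0) =
    (open Classical in if c ≤ c' then 1 else 0) := by
  unfold cmpNat
  rcases lt_trichotomy c c' with h | h | h
  · simp [h, h.le]
  · simp [h]
  · simp [h.not_gt, h.ne', h.not_ge]

open Classical in
/-- The key is at most the query coordinate. -/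
noncomputable def leQuery {n : ℕ} (key : Fin n → Coord) (c : ℝ) (i : Fin n) : Bool :=
  decide (key i ≤ (c : Coord))

@[simp] theorem leQuery_iff {n : ℕ} {key : Fin n → Coord} {c : ℝ} {i : Fin n} :
    leQuery key c i = true ↔ key i ≤ (c : Coord) := by simp [leQuery]

/-- The keys of `Z` in cells `A + 1, …`, padded with `⊤` up to cell `A + 2 ^ m - 1`. -/
structure SortedKeys {w n : ℕ} (M : List (Cell w)) (A m : ℕ) (key : Fin n → Coord)
    (Z : List (Fin n)) : Prop where
  len : Z.length < 2 ^ m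
  cells : ∀ k, k + 1 < 2 ^ m → coordAt M (A + (k + 1)) = some ((Z[k]?).elim ⊤ key)

section search
variable {w n : ℕ} {M : List (Cell w)} {q : Fin 3 → ℝ}

/-- The position grows by powers of two: with step `2 ^ j / 2` the count lies in a window of length
`2 ^ j`. The step becomes `0` exactly when the window is a single position, so the same register
ends the loop. -/
theorem wp_search (hw : 8 ≤ w) (hM : M.length ≤ 2 ^ w) {A m : ℕ} {key : Fin n → Coord}
    {Z : List (Fin n)} (hZ : SortedKeys M A m key Z) (hs : Z.Pairwise fun i j => key i ≤ key j)
    (ax : Fin 3) {σ : AState} (h22 : σ.env 22 = A) (h23 : σ.env 23 = 2 ^ m / 2) :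
    WP M q (search ax) σ fun σ' => (∀ r, 26 ≤ r → σ'.env r = σ.env r) ∧
      (∀ r, r < 22 → σ'.env r = σ.env r) ∧ σ'.out = σ.out ∧
      σ'.env 24 = Z.countP (leQuery key (q ax)) ∧
      σ'.time ≤ σ.time + 30 * m + 10 := by
  classical
  have hw2 : 2 ≤ w := by omega
  set P : Fin n → Bool := leQuery key (q ax) with hP
  have hle : Z.countP P ≤ Z.length := List.countP_le_length
  have htake := List.take_countP_eq_filter (p := P) Z hs (fun i j h h' => by
    simp only [hP, leQuery_iff] at h' ⊢; exact h.trans h')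
  -- The keys up to a real query form a prefix of the sorted list, and the padding `⊤` exceeds every
  -- real, so probes beyond the end of the list answer correctly.
  have hiff : ∀ k, ((Z[k]?).elim ⊤ key ≤ (q ax : Coord)) ↔ k < Z.countP P := by
    intro k
    constructor
    · intro h
      by_contra hk
      cases hk' : Z[k]? with
      | none => rw [hk'] at h; simp at h
      | some i =>
        rw [hk'] at h
        have h1 : Z.countP P = (Z.take (Z.countP P)).countP P + (Z.drop (Z.countP P)).countP P := by
          rw [← List.countP_append, List.take_append_drop]
        have h2 : (Z.take (Z.countP P)).countP P = Z.countP P := by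
          rw [htake, List.countP_filter]
          simp
        have h3 : i ∈ Z.drop (Z.countP P) := by
          rw [List.mem_iff_getElem?]
          exact ⟨k - Z.countP P, by rw [List.getElem?_drop, ← hk']; congr 1; omega⟩
        have h4 : 0 < (Z.drop (Z.countP P)).countP P :=
          List.countP_pos_iff.2 ⟨i, h3, by simpa [hP] using h⟩
        omega
    · intro hk
      have hk1 : k < Z.length := by omega
      have h1 : Z[k] ∈ Z.take (Z.countP P) := by
        rw [List.mem_iff_getElem]
        exact ⟨k, by simp; omega, by simp⟩
      rw [htake, List.mem_filter] at h1
      simpa [hP, List.getElem?_eq_getElem hk1] using h1.2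
  -- The last cell of the padded array exists and its address is below the memory size, so `2 ^ m`
  -- itself is bounded by `2 ^ w`.
  have hwm : ∀ k, k < 2 ^ m → k < 2 ^ w := by
    intro k hk
    have : 2 ^ m ≤ 2 ^ w := by
      rcases Nat.eq_zero_or_pos (2 ^ m - 1) with h | h
      · have := Nat.one_le_two_pow (n := w); omega
      · have h2 := hZ.cells (2 ^ m - 2) (by omega)
        have := coordAt_addr_lt h2
        omega
    omega
  refine WP.seq (WP.asg hw2 hM (by norm_num) (v := 0) ⟨rfl, by positivity⟩ ?_)
  -- Invariant: the sought count lies in `[pos, pos + 2 ^ j)`, a window that stays inside the padded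
  -- array.
  have key : ∀ (j pos : ℕ) (τ : AState), j ≤ m → τ.env 22 = A → τ.env 23 = 2 ^ j / 2 →
      τ.env 24 = pos → pos + 2 ^ j ≤ 2 ^ m → pos ≤ Z.countP P → Z.countP P < pos + 2 ^ j →
      WP M q (.loop 23 (
        asg 25 (.op .lt (.cmp (.reg 22) (.op .add (.reg 24) (.reg 23)) ax) (.lit 2)) ;;
        asg 24 (.op .add (.reg 24) (.op .mul (.reg 25) (.reg 23))) ;;
        asg 23 (.op .div (.reg 23) (.lit 2)))) τ fun σ' =>
        (∀ r, 26 ≤ r → σ'.env r = τ.env r) ∧ (∀ r, r < 22 → σ'.env r = τ.env r) ∧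
        σ'.out = τ.out ∧ σ'.env 24 = Z.countP P ∧ σ'.time ≤ τ.time + 30 * j + 1 := by
    intro j
    induction j with
    | zero =>
      intro pos τ _ h22 h23 h24 h1 h2 h3
      refine WP.loop_done (by norm_num) (by simpa using h23) ?_
      exact ⟨fun _ _ => rfl, fun _ _ => rfl, rfl, by rw [AState.tick_env, h24]; omega, by simp⟩
    | succ j ih =>
      intro pos τ hj h22 h23 h24 h1 h2 h3
      rw [pow_succ] at h1 h3
      have h23' : τ.env 23 = 2 ^ j := by rw [h23, pow_succ]; simp
      have hjp := Nat.one_le_two_pow (n := j)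
      refine WP.loop_step (by norm_num) (by omega) ?_
      have hc := hZ.cells (pos + 2 ^ j - 1) (by omega)
      rw [show pos + 2 ^ j - 1 + 1 = pos + 2 ^ j by omega] at hc
      refine WP.seq (WP.asg hw2 hM (by norm_num)
        (v := if (Z[pos + 2 ^ j - 1]?).elim ⊤ key ≤ (q ax : Coord) then 1 else 0)
        ⟨_, ⟨A, ⟨by norm_num, by simp [h22]⟩, pos + 2 ^ j, ⟨pos, ⟨by norm_num, by simp [h24]⟩,
          2 ^ j, ⟨by norm_num, by simp [h23']⟩, ?_⟩, _, hc, rfl⟩, 2,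
          ⟨rfl, lit_lt_two_pow hw (by norm_num)⟩, ?_⟩ ?_)
      · exact (Nat.mod_eq_of_lt (hwm _ (by omega))).symm
      · exact (cmpNat_lt_two _ _).symm
      rw [if_congr (hiff _) rfl rfl]
      have fin : ∀ pos', pos' = pos + (if pos + 2 ^ j - 1 < Z.countP P then 1 else 0) * 2 ^ j →
          pos' + 2 ^ j ≤ 2 ^ m ∧ pos' ≤ Z.countP P ∧ Z.countP P < pos' + 2 ^ j := by
        rintro pos' rfl
        split <;> omega
      obtain ⟨f1, f2, f3⟩ := fin _ rfl
      set d := if pos + 2 ^ j - 1 < Z.countP P then 1 else 0 with hd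
      refine WP.seq (WP.asg hw2 hM (by norm_num) (v := pos + d * 2 ^ j)
        ⟨pos, ⟨by norm_num, by simp [h24]⟩, d * 2 ^ j, ⟨d, ⟨by norm_num, by simp⟩, 2 ^ j,
          ⟨by norm_num, by simp [h23']⟩, rfl, hwm _ (by omega)⟩, ?_⟩ ?_)
      · exact (Nat.mod_eq_of_lt (hwm _ (by omega))).symm
      refine WP.asg hw2 hM (by norm_num) (v := 2 ^ j / 2)
        ⟨2 ^ j, ⟨by norm_num, by simp [h23']⟩, 2, ⟨rfl, lit_lt_two_pow hw (by norm_num)⟩, rfl⟩ ?_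
      refine (ih (pos + d * 2 ^ j) _ (by omega) (by simp [h22]) (by simp) (by simp) f1 f2 f3).mono ?_
      rintro σ' ⟨g1, g2, g3, g4, g5⟩
      refine ⟨fun r hr => ?_, fun r hr => ?_, by rw [g3]; rfl, g4, ?_⟩
      · rw [g1 r hr]
        simp (disch := omega) [AState.upd_env, if_neg]
      · rw [g2 r hr]
        simp (disch := omega) [AState.upd_env, if_neg]
      · simp [RExpr.cost] at g5
        omega
  refine (key m 0 _ le_rfl (by simp [h22]) (by simp [h23]) (by simp) (by simp) (by simp)
    (by simp; have := hZ.len; omega)).mono ?_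
  rintro σ' ⟨g1, g2, g3, g4, g5⟩
  refine ⟨fun r hr => ?_, fun r hr => ?_, by rw [g3]; rfl, g4, ?_⟩
  · rw [g1 r hr]
    simp (disch := omega) [AState.upd_env, if_neg]
  · rw [g2 r hr]
    simp (disch := omega) [AState.upd_env, if_neg]
  · simp [RExpr.cost] at g5
    omega

end search

/-! ### Chaining traversals -/

section trav
variable {w n : ℕ} {M : List (Cell w)} {q : Fin 3 → ℝ} {Ls : List (List (Fin n))} {a c : ℕ}
  {Acc : ℕ → List ℕ → List (List (Fin n)) → Prop}

/-- The result is measured from an earlier state `σ₀`, so that assignments made before the first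
traversal are charged to the composite. -/
theorem WP.trav_seq {p p' : Prog} {K K₁ N N₁ N₂ T T₁ T₂ : ℕ} {σ₀ σ : AState}
    {L₀ : List (List (Fin n))} {S S₁ S₂ : Fin n → Prop}
    (h₁ : WP M q p σ (Traversed Ls a c Acc K₁ σ L₀ S₁ N₁ T₁))
    (h₂ : ∀ σ₁ L, Acc (σ₁.env 99) σ₁.out L → (∀ r, K₁ ≤ r → r ≠ 99 → σ₁.env r = σ.env r) →
      WP M q p' σ₁ (Traversed Ls a c Acc K σ₁ L S₂ N₂ T₂))
    (hK : K₁ ≤ K) (hf : ∀ r, K ≤ r → r ≠ 99 → σ.env r = σ₀.env r)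
    (hd : ∀ i, S₁ i → ¬ S₂ i) (hS : ∀ i, S i ↔ S₁ i ∨ S₂ i) (hN : N₁ + N₂ ≤ N)
    (ht : σ.time + T₁ + T₂ ≤ σ₀.time + T) :
    WP M q p σ fun σ₁ => WP M q p' σ₁ (Traversed Ls a c Acc K σ₀ L₀ S N T) := by
  refine h₁.mono ?_
  rintro σ₁ ⟨f1, L₁, c1, a1, t1⟩
  refine (h₂ σ₁ (L₀ ++ L₁) a1 f1).mono ?_
  rintro σ₂ ⟨f2, L₂, c2, a2, t2⟩
  refine ⟨fun r hr hr' => ((f2 r hr hr').trans (f1 r (hK.trans hr) hr')).trans (hf r hr hr'),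
    L₁ ++ L₂, c1.append c2 hd hS hN, by rwa [← List.append_assoc], ?_⟩
  simp only [List.length_append, List.flatten_append, mul_add]
  omega

end trav

/-! ### Planar queries -/

/-- The condition that a corner imposes: it is at most, or greater than, the query coordinate. -/
def cornerCond {n : ℕ} (pre : Bool) (key : Fin n → Coord) (c : ℝ) (i : Fin n) : Prop :=
  if pre then key i ≤ (c : Coord) else (c : Coord) < key i

/-- Act on a prefix if register `21` is set and the prefix is not empty. -/
def takePrefix (act : Prog) : Prog := .ite 21 (.ite 9 act .skip) .skip

/-- Descend in a binary range tree from the node in register `12`, whose list has a prefix of length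
`r 13` with small `x`-keys. Register `43` is `1` for corners at most the query coordinate, and `0`
for corners greater than it. -/
def descend (act : Prog) : Prog :=
  asg 15 (.lit 1) ;;
  .loop 15 (
    asg 16 (.ld (.reg 12) (.lit 0)) ;;
    asg 17 (.op .lt (.cmp (.reg 12) (.lit 6) 1) (.lit 2)) ;;
    asg 21 (.op .eq (.reg 17) (.reg 43)) ;;
    .ite 16
      (asg 19 (rankExpr 12 13) ;;
        .ite 17
          (asg 8 (.ld (.reg 12) (.lit 2)) ;; asg 9 (.op .sub (.reg 13) (.reg 19)) ;;
            asg 13 (.reg 19) ;; asg 12 (.ld (.reg 12) (.lit 3)))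
          (asg 8 (.ld (.reg 12) (.lit 3)) ;; asg 9 (.reg 19) ;;
            asg 13 (.op .sub (.reg 13) (.reg 19)) ;; asg 12 (.ld (.reg 12) (.lit 2))))
      (asg 8 (.reg 12) ;; asg 9 (.reg 13) ;; asg 15 (.lit 0)) ;;
    takePrefix act)

/-- Query the planar structure whose record is at `r 26`. -/
def planarQuery (act : Prog) : Prog :=
  asg 22 (.ld (.reg 26) (.lit 1)) ;;
  asg 23 (.ld (.reg 26) (.lit 2)) ;;
  search 0 ;;
  asg 12 (.ld (.reg 26) (.lit 0)) ;;
  asg 13 (.reg 24) ;;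
  descend act

section descend
variable {w n : ℕ} {M : List (Cell w)} {q : Fin 3 → ℝ} {b B H : ℕ} {x y : Fin n → Coord}
  {W : List (Fin n)} {addr : ℕ → ℕ → ℕ} {Ls : List (List (Fin n))} {a c T : ℕ}
  {Acc : ℕ → List ℕ → List (List (Fin n)) → Prop} {act : Prog}

theorem pairwise_nodeList (j t : ℕ) : (nodeList x W j t).Pairwise fun i k => x i ≤ x k :=
  (pairwise_sortByKey x _).imp fun h => h.key_le

theorem take_countP_nodeList (j t : ℕ) (r : ℝ) :
    (nodeList x W j t).take ((nodeList x W j t).countP (leQuery x r)) =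
      (nodeList x W j t).filter (leQuery x r) :=
  List.take_countP_eq_filter _ (pairwise_nodeList j t) fun i k h h' => by
    rw [leQuery_iff] at h' ⊢
    exact h.trans h'

/-- The entries with small x-keys form a prefix at every node. Hence a rank query at the end of the
parent's prefix yields the length of the descendant's prefix, and no binary search is needed below
the root. -/
theorem cntSym_countP (hW : W.Nodup) {j d t s : ℕ} (hs : s < 2 ^ d) (r : ℝ) :
    cntSym x W j d t s ((nodeList x W (j + d) t).countP (leQuery x r)) =
      (nodeList x W j (t * 2 ^ d + s)).countP (leQuery x r) := by
  rw [cntSym, take_countP_nodeList, ← filter_leafDigit hW hs, List.countP_filter,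
    List.countP_filter]
  refine List.countP_congr fun p _ => ?_
  rw [Bool.and_comm]

/-- The handle is required only for a nonempty prefix, because the sibling of a node on the path may
not exist. The test for emptiness also ensures that every collected prefix is nonempty. -/
theorem wp_takePrefix (hact : IsAction M q T a c act Acc) {σ : AState} {L₀ : List (List (Fin n))}
    {h t : ℕ} (hd : (nodeList x W h t).countP (leQuery x (q 0)) ≠ 0 →
      Handle M T (σ.env 8) (nodeList x W h t) ∧ nodeList x W h t ∈ Ls)
    (h9 : σ.env 9 = (nodeList x W h t).countP (leQuery x (q 0)))
    (hacc : Acc (σ.env 99) σ.out L₀) :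
    WP M q (takePrefix act) σ (Traversed Ls a c Acc 12 σ L₀
      (fun i => σ.env 21 ≠ 0 ∧ i ∈ nodeList x W h t ∧ x i ≤ (q 0 : Coord)) 1 3) := by
  refine WP.ite (by norm_num) (fun h21 => ?_) (fun h21 => ?_)
  · refine WP.ite (by norm_num) (fun h0 => ?_) (fun h0 => ?_)
    · simp only [AState.tick_env] at h0
      rw [h9] at h0
      obtain ⟨hH, hL⟩ := hd h0
      refine (hact ((σ.tick 1).tick 1) L₀ _ _ _ hH (Nat.pos_of_ne_zero h0) List.countP_le_length
        rfl (by simpa using h9) hacc).mono ?_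
      rintro σ' ⟨f1, a1, t1⟩
      refine ⟨fun r hr hr' => f1 r hr hr', _, ⟨?_, fun i => ?_, ?_, le_rfl⟩, a1, ?_⟩
      · simpa using ((nodup_sortByKey x _).sublist (List.take_sublist _ _) :
          ((nodeList x W h t).take _).Nodup)
      · rw [List.flatten_singleton, take_countP_nodeList, List.mem_filter, leQuery_iff]
        exact ⟨fun h => ⟨h21, h⟩, fun h => h.2⟩
      · intro P hP
        rw [List.mem_singleton] at hP
        subst hP
        refine ⟨?_, _, hL, List.take_prefix _ _⟩
        intro hnil
        have := congrArg List.length hnil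
        rw [List.length_take, min_eq_left List.countP_le_length] at this
        exact h0 (by simpa using this)
      · rw [List.flatten_singleton, List.length_take, min_eq_left List.countP_le_length]
        simp only [AState.tick_time, List.length_singleton] at t1 ⊢
        omega
    · refine WP.skip (Traversed.nil ?_ (fun _ _ _ => rfl) hacc (by simp))
      rintro i ⟨-, h1, h2⟩
      simp only [AState.tick_env] at h0
      rw [h9, List.countP_eq_zero] at h0
      exact h0 i h1 (leQuery_iff.2 h2)
  · refine WP.skip (Traversed.nil ?_ (fun _ _ _ => rfl) hacc (by simp))
    rintro i ⟨h1, -⟩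
    exact h1 h21

theorem idxOf_key_le (hy : W.Pairwise fun i k => y i ≤ y k) {i : Fin n} {k : ℕ}
    (hi : i ∈ W) : (W.idxOf i ≤ k → y i ≤ (W[k]?).elim ⊤ y) ∧
      (k ≤ W.idxOf i → (W[k]?).elim ⊤ y ≤ y i) := by
  have h1 := List.idxOf_lt_length_iff.2 hi
  have h2 : W[W.idxOf i] = i := List.getElem_idxOf h1
  constructor
  · intro h
    cases hk : W[k]? with
    | none => exact le_top
    | some j =>
      obtain ⟨h3, rfl⟩ := List.getElem?_eq_some_iff.1 hk
      rcases h.lt_or_eq with h | h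
      · have := List.pairwise_iff_getElem.1 hy _ _ h1 h3 h
        rwa [h2] at this
      · subst h
        rw [h2]
        exact le_rfl
  · intro h
    rw [List.getElem?_eq_getElem (h.trans_lt h1)]
    rcases h.lt_or_eq with h | h
    · have := List.pairwise_iff_getElem.1 hy _ _ (h.trans h1) h1 h
      rwa [h2] at this
    · subst h
      simp [h2]

/-- The pivot is the y-key of the first leaf of the right child. If it is at most the query
coordinate, the whole left child is at most the query coordinate and the search goes right;
otherwise the whole right child is greater and the search goes left. The settled child is taken
entirely or not at all, depending on whether the comparison agrees with the side that is asked for.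
A leaf settles itself by the same test. -/
theorem wp_descend (hw : 8 ≤ w) (hM : M.length ≤ 2 ^ w) (hT : HasTable M b) (hn : n < 2 ^ w)
    (hW : W.Nodup) (hy : W.Pairwise fun i k => y i ≤ y k) (hA : TreeAt M b x y W B H addr)
    (hact : IsAction M q T a c act Acc) {pre : Bool}
    (hd : ∀ h t, h ≤ H → t * 2 ^ h < W.length →
      Handle M T (addr h t) (nodeList x W h t) ∧ nodeList x W h t ∈ Ls) :
    ∀ (h t : ℕ) (σ₀ : AState) (L₀ : List (List (Fin n))), h ≤ H → t * 2 ^ h < W.length →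
      σ₀.env 12 = addr h t → σ₀.env 13 = (nodeList x W h t).countP (leQuery x (q 0)) →
      σ₀.env 15 = 1 → σ₀.env 43 = (if pre then 1 else 0) → Acc (σ₀.env 99) σ₀.out L₀ →
      WP M q (.loop 15 (
        asg 16 (.ld (.reg 12) (.lit 0)) ;;
        asg 17 (.op .lt (.cmp (.reg 12) (.lit 6) 1) (.lit 2)) ;;
        asg 21 (.op .eq (.reg 17) (.reg 43)) ;;
        .ite 16
          (asg 19 (rankExpr 12 13) ;;
            .ite 17
              (asg 8 (.ld (.reg 12) (.lit 2)) ;; asg 9 (.op .sub (.reg 13) (.reg 19)) ;;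
                asg 13 (.reg 19) ;; asg 12 (.ld (.reg 12) (.lit 3)))
              (asg 8 (.ld (.reg 12) (.lit 3)) ;; asg 9 (.reg 19) ;;
                asg 13 (.op .sub (.reg 13) (.reg 19)) ;; asg 12 (.ld (.reg 12) (.lit 2))))
          (asg 8 (.reg 12) ;; asg 9 (.reg 13) ;; asg 15 (.lit 0)) ;;
        takePrefix act)) σ₀ (Traversed Ls a c Acc 22 σ₀ L₀
          (fun i => i ∈ nodeList x W h t ∧ x i ≤ (q 0 : Coord) ∧ cornerCond pre y (q 1) i)
          (h + 1) (100 * (h + 1))) := by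
  classical
  have hw2 : 2 ≤ w := by omega
  intro h
  induction h with
  | zero =>
    intro t σ₀ L₀ hh ht h12 h13 h15 h43 hacc
    have ht' : t < W.length := by simpa using ht
    have hlf := hA.leaf t ht'
    have hkey := hlf.key W[t] (List.getElem?_eq_getElem ht')
    refine WP.loop_step (by norm_num) (by omega) ?_
    refine WP.seq (WP.asg hw2 hM (by norm_num) (val_ld_reg_lit hw (by norm_num) (by norm_num)
      (by simpa using h12) hlf.flag) ?_)
    refine WP.seq (WP.asg hw2 hM (by norm_num)
      (v := if y W[t] ≤ (q 1 : Coord) then 1 else 0)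
      ⟨_, ⟨addr 0 t, ⟨by norm_num, by simp [h12]⟩, 6, ⟨rfl, lit_lt_two_pow hw (by norm_num)⟩,
        _, hkey, rfl⟩, 2, ⟨rfl, lit_lt_two_pow hw (by norm_num)⟩, (cmpNat_lt_two _ _).symm⟩ ?_)
    refine WP.seq (WP.asg hw2 hM (by norm_num)
      (v := if (if y W[t] ≤ (q 1 : Coord) then 1 else 0) = (if pre then 1 else 0) then 1 else 0)
      ⟨_, ⟨by norm_num, rfl⟩, _, ⟨by norm_num, rfl⟩, by
        simp only [AState.upd_env, AState.tick_env, h43]; rfl⟩ ?_)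
    refine WP.seq (WP.ite (by norm_num) (fun hne => absurd ?_ hne) (fun _ => ?_))
    · simp
    refine WP.seq (WP.asg hw2 hM (by norm_num) (v := addr 0 t) ⟨by norm_num, by simp [h12]⟩ ?_)
    refine WP.seq (WP.asg hw2 hM (by norm_num)
      (v := (nodeList x W 0 t).countP (leQuery x (q 0))) ⟨by norm_num, by simp [h13]⟩ ?_)
    refine WP.asg hw2 hM (by norm_num) (v := 0) ⟨rfl, by positivity⟩ ?_
    refine WP.trav_seq (S₂ := fun _ => False) (N₂ := 0) (T₂ := 1)
      (wp_takePrefix (x := x) (W := W) (h := 0) (t := t) (Ls := Ls) hact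
        (fun _ => by simpa using hd 0 t (by omega) ht) (by simp) (by simpa using hacc))
      ?_ (by norm_num) ?_ ?_ ?_ (by norm_num) ?_
    · intro σ₁ L₁ hacc₁ hf
      refine WP.loop_done (by norm_num) ?_ (Traversed.nil (by simp) (fun _ _ _ => rfl) hacc₁ le_rfl)
      rw [hf 15 (by norm_num) (by norm_num)]
      simp
    · intro r hr hr'
      simp (disch := omega) [AState.upd_env, if_neg]
    · simp
    · intro i
      simp only [or_false, AState.upd_env]
      have hcc : i ∈ nodeList x W 0 t → (cornerCond pre y (q 1) i ↔
          ((if y W[t] ≤ (q 1 : Coord) then 1 else 0) = (if pre then 1 else 0))) := by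
        intro hi
        have h1 := (mem_nodeList x hW).1 hi
        have h2 : W[t] = i := by
          have h3 := h1.2
          rw [pow_zero, Nat.div_one] at h3
          subst h3
          exact List.getElem_idxOf _
        rw [h2]
        cases pre <;> by_cases hle : y i ≤ (q 1 : Coord) <;> simp [cornerCond, hle]
        exact not_le.1 hle
      simp
      tauto
    · simp [RExpr.cost]
  | succ j ih =>
    intro t σ₀ L₀ hh ht h12 h13 h15 h43 hacc
    obtain ⟨jp, bits, ones, hN, -⟩ := hA.inner j hh t ht
    set m := (W[(2 * t + 1) * 2 ^ j]?).elim ⊤ y with hm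
    set i₀ := (nodeList x W (j + 1) t).countP (leQuery x (q 0)) with hi₀
    have hi₀le : i₀ ≤ (nodeList x W (j + 1) t).length := List.countP_le_length
    have hi₀w : i₀ < 2 ^ w := by
      have h4 := (nodup_sortByKey x (W.block (2 ^ (j + 1)) t).toFinset).length_le_card
      rw [Fintype.card_fin] at h4
      unfold nodeList at hi₀le
      omega
    have e0 : cntSym x W j 1 t 0 i₀ = (nodeList x W j (2 * t)).countP (leQuery x (q 0)) := by
      rw [hi₀, cntSym_countP hW (by norm_num), pow_one, mul_comm, add_zero]
    have e1 : cntSym x W j 1 t 1 i₀ = (nodeList x W j (2 * t + 1)).countP (leQuery x (q 0)) := by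
      rw [hi₀, cntSym_countP hW (by norm_num), pow_one, mul_comm]
    have hsum := cntSym_zero_add_one (x := x) (W := W) hi₀le
    -- A node with a nonempty list contains a leaf, hence exists in the tree.
    have hvalid : ∀ t', (nodeList x W j t').countP (leQuery x (q 0)) ≠ 0 → t' * 2 ^ j < W.length := by
      intro t' hne
      obtain ⟨i, hi, -⟩ := List.countP_pos_iff.1 (Nat.pos_of_ne_zero hne)
      obtain ⟨hi1, hi2⟩ := (mem_nodeList x hW).1 hi
      rw [← hi2]
      exact (Nat.div_mul_le_self _ _).trans_lt (List.idxOf_lt_length_iff.2 hi1)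
    have hdd : ∀ k, k / 2 ^ (j + 1) = k / 2 ^ j / 2 := fun k => by
      rw [pow_succ, Nat.div_div_eq_div_mul]
    -- the two children
    have hsplit : ∀ i, i ∈ nodeList x W (j + 1) t ↔
        i ∈ nodeList x W j (2 * t) ∨ i ∈ nodeList x W j (2 * t + 1) := by
      intro i
      simp only [mem_nodeList x hW, hdd]
      constructor
      · rintro ⟨h1, h2⟩
        have : W.idxOf i / 2 ^ j = 2 * t ∨ W.idxOf i / 2 ^ j = 2 * t + 1 := by omega
        tauto
      · rintro (⟨h1, h2⟩ | ⟨h1, h2⟩) <;> exact ⟨h1, by omega⟩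
    have hdisj : ∀ i, i ∈ nodeList x W j (2 * t) → ¬ i ∈ nodeList x W j (2 * t + 1) := by
      intro i h1 h2
      have h3 := ((mem_nodeList x hW).1 h1).2
      have h4 := ((mem_nodeList x hW).1 h2).2
      omega
    have hleft : ∀ i, i ∈ nodeList x W j (2 * t) → y i ≤ m := by
      intro i hi
      obtain ⟨h1, h2⟩ := (mem_nodeList x hW).1 hi
      refine (idxOf_key_le hy h1).1 ?_
      have h3 : W.idxOf i / 2 ^ j < 2 * t + 1 := by omega
      exact ((Nat.div_lt_iff_lt_mul (by positivity)).1 h3).le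
    have hright : ∀ i, i ∈ nodeList x W j (2 * t + 1) → m ≤ y i := by
      intro i hi
      obtain ⟨h1, h2⟩ := (mem_nodeList x hW).1 hi
      refine (idxOf_key_le hy h1).2 ?_
      exact (Nat.le_div_iff_mul_le (by positivity)).1 h2.ge
    have ht0 : 2 * t * 2 ^ j < W.length := by
      rw [pow_succ] at ht
      calc 2 * t * 2 ^ j = t * (2 ^ j * 2) := by ring
        _ < _ := ht
    refine WP.loop_step (by norm_num) (by omega) ?_
    refine WP.seq (WP.asg hw2 hM (by norm_num) (val_ld_reg_lit hw (by norm_num) (by norm_num)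
      (by simpa using h12) hN.flag) ?_)
    refine WP.seq (WP.asg hw2 hM (by norm_num)
      (v := if m ≤ (q 1 : Coord) then 1 else 0)
      ⟨_, ⟨addr (j + 1) t, ⟨by norm_num, by simp [h12]⟩, 6, ⟨rfl, lit_lt_two_pow hw (by norm_num)⟩,
        _, hN.key, rfl⟩, 2, ⟨rfl, lit_lt_two_pow hw (by norm_num)⟩, (cmpNat_lt_two _ _).symm⟩ ?_)
    refine WP.seq (WP.asg hw2 hM (by norm_num)
      (v := if (if m ≤ (q 1 : Coord) then 1 else 0) = (if pre then 1 else 0) then 1 else 0)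
      ⟨_, ⟨by norm_num, rfl⟩, _, ⟨by norm_num, rfl⟩, by
        simp only [AState.upd_env, AState.tick_env, h43]; rfl⟩ ?_)
    refine WP.seq (WP.ite (by norm_num) (fun _ => ?_) (fun h0 => absurd h0 ?_))
    swap
    · simp
    refine WP.seq (WP.asg hw2 hM (by norm_num) (val_rankExpr hw hT hN (by norm_num) (by norm_num)
      (by simp [h12]) (i := i₀) (by simp [h13]) hi₀le hi₀w) ?_)
    refine WP.ite (by norm_num) (fun hle => ?_) (fun hle => ?_)
    · have hle' : m ≤ (q 1 : Coord) := by
        by_contra hcon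
        simp [hcon] at hle
      -- A missing right child has pivot `⊤`, which is not at most a real number, so the descent
      -- never moves to it.
      have ht1 : (2 * t + 1) * 2 ^ j < W.length := by
        by_contra hcon
        rw [hm, List.getElem?_eq_none (not_lt.1 hcon)] at hle'
        simp at hle'
      refine WP.seq (WP.asg hw2 hM (by norm_num) (val_ld_reg_lit hw (by norm_num) (by norm_num)
        (by simpa using h12) hN.left) ?_)
      refine WP.seq (WP.asg hw2 hM (by norm_num) (v := cntSym x W j 1 t 0 i₀)
        ⟨i₀, ⟨by norm_num, by simp [h13]⟩, cntSym x W j 1 t 1 i₀, ⟨by norm_num, by simp⟩, ?_⟩ ?_)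
      · change _ = _ - _ ∧ _ ≤ _
        omega
      refine WP.seq (WP.asg hw2 hM (by norm_num) (v := cntSym x W j 1 t 1 i₀)
        ⟨by norm_num, by simp⟩ ?_)
      refine WP.asg hw2 hM (by norm_num) (val_ld_reg_lit hw (by norm_num) (by norm_num)
        (a := addr (j + 1) t) (by simp [h12]) hN.right) ?_
      refine WP.trav_seq (T₂ := 100 * (j + 1))
        (wp_takePrefix (x := x) (W := W) (h := j) (t := 2 * t) (Ls := Ls) hact
        (fun _ => by simpa using hd j (2 * t) (by omega) ht0) (by simp [e0]) (by simpa using hacc))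
        (fun σ₁ L₁ hacc₁ hf => ih (2 * t + 1) σ₁ L₁ (by omega) ht1 ?_ ?_ ?_ ?_ hacc₁)
        (by norm_num) ?_ ?_ ?_ (by omega) ?_
      · rw [hf 12 (by norm_num) (by norm_num)]; simp
      · rw [hf 13 (by norm_num) (by norm_num)]; simp [e1]
      · rw [hf 15 (by norm_num) (by norm_num)]; simp [h15]
      · rw [hf 43 (by norm_num) (by norm_num)]; simp [h43]
      · intro r hr hr'
        simp (disch := omega) [AState.upd_env, if_neg]
      · rintro i ⟨-, h1, -⟩ ⟨h2, -⟩
        exact hdisj i h1 h2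
      · intro i
        have hl : i ∈ nodeList x W j (2 * t) → (cornerCond pre y (q 1) i ↔ pre = true) := by
          intro hi
          have h1 := (hleft i hi).trans hle'
          cases pre <;> simp [cornerCond, h1]
        rw [hsplit]
        cases pre <;> simp [hle'] <;> simp at hl <;> tauto
      · simp [RExpr.cost, rankExpr, bitsExpr, blockLenExpr]
        omega
    · have hle' : (q 1 : Coord) < m := by
        by_contra hcon
        simp [not_lt.1 hcon] at hle
      refine WP.seq (WP.asg hw2 hM (by norm_num) (val_ld_reg_lit hw (by norm_num) (by norm_num)
        (by simpa using h12) hN.right) ?_)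
      refine WP.seq (WP.asg hw2 hM (by norm_num) (v := cntSym x W j 1 t 1 i₀)
        ⟨by norm_num, by simp⟩ ?_)
      refine WP.seq (WP.asg hw2 hM (by norm_num) (v := cntSym x W j 1 t 0 i₀)
        ⟨i₀, ⟨by norm_num, by simp [h13]⟩, cntSym x W j 1 t 1 i₀, ⟨by norm_num, by simp⟩, ?_⟩ ?_)
      · change _ = _ - _ ∧ _ ≤ _
        omega
      refine WP.asg hw2 hM (by norm_num) (val_ld_reg_lit hw (by norm_num) (by norm_num)
        (a := addr (j + 1) t) (by simp [h12]) hN.left) ?_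
      refine WP.trav_seq (T₂ := 100 * (j + 1))
        (wp_takePrefix (x := x) (W := W) (h := j) (t := 2 * t + 1) (Ls := Ls) hact
        (fun hne => by simpa using hd j (2 * t + 1) (by omega) (hvalid _ hne)) (by simp [e1])
          (by simpa using hacc))
        (fun σ₁ L₁ hacc₁ hf => ih (2 * t) σ₁ L₁ (by omega) ht0 ?_ ?_ ?_ ?_ hacc₁)
        (by norm_num) ?_ ?_ ?_ (by omega) ?_
      · rw [hf 12 (by norm_num) (by norm_num)]; simp
      · rw [hf 13 (by norm_num) (by norm_num)]; simp [e0]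
      · rw [hf 15 (by norm_num) (by norm_num)]; simp [h15]
      · rw [hf 43 (by norm_num) (by norm_num)]; simp [h43]
      · intro r hr hr'
        simp (disch := omega) [AState.upd_env, if_neg]
      · rintro i ⟨-, h1, -⟩ ⟨h2, -⟩
        exact hdisj i h2 h1
      · intro i
        have hr : i ∈ nodeList x W j (2 * t + 1) → (cornerCond pre y (q 1) i ↔ pre = false) := by
          intro hi
          have h1 := hle'.trans_le (hright i hi)
          cases pre <;> simp [cornerCond, h1]
        rw [hsplit]
        cases pre <;> simp [not_le.2 hle'] <;> simp at hr <;> tauto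
      · simp [RExpr.cost, rankExpr, bitsExpr, blockLenExpr]
        omega

/-- The record at `r` of the planar structure for the points `V`. -/
structure PlanarAt (M : List (Cell w)) (b B : ℕ) (x y : Fin n → Coord) (V : Finset (Fin n)) (ℓ r : ℕ)
    (A m : ℕ) (addr : ℕ → ℕ → ℕ) : Prop where
  root : wordAt M (r + 0) = some (addr (Nat.clog 2 V.card) 0)
  arr : wordAt M (r + 1) = some A
  step : wordAt M (r + 2) = some (2 ^ m / 2)
  keys : SortedKeys M A m x (nodeList x (sortByKey y V) (Nat.clog 2 V.card) 0)
  tree : TreeAt M b x y (sortByKey y V) B (Nat.clog 2 V.card) addr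
  height : Nat.clog 2 V.card ≤ ℓ
  size : m ≤ ℓ

theorem mem_nodeList_root {V : Finset (Fin n)} {i : Fin n} :
    i ∈ nodeList x (sortByKey y V) (Nat.clog 2 V.card) 0 ↔ i ∈ V := by
  rw [mem_nodeList x (nodup_sortByKey y V), mem_sortByKey]
  refine and_iff_left_of_imp fun hi => Nat.div_eq_of_lt ?_
  have h1 := List.idxOf_lt_length_iff.2 ((mem_sortByKey y V).2 hi)
  rw [length_sortByKey] at h1
  exact h1.trans_le (Nat.le_pow_clog (by norm_num) _)

/-- One binary search gives the prefix length at the root; the descent then derives all other prefix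
lengths from ranks. -/
theorem wp_planarQuery (hw : 8 ≤ w) (hM : M.length ≤ 2 ^ w) (hT : HasTable M b) (hB : 2 ≤ B)
    (hn : n < 2 ^ w) {K ℓ : ℕ} (hK : ℓ < B ^ K) {act : Prog}
    (hact : IsAction M q (101 * (K * B) + 20) a c act Acc) {pre : Bool} {V : Finset (Fin n)}
    (hV : V.Nonempty) {r A m : ℕ} (hP : PlanarAt M b B x y V ℓ r A m addr)
    (hLs : ∀ P ∈ planarLists x y V, P ∈ Ls) {σ₀ : AState} {L₀ : List (List (Fin n))}
    (h26 : σ₀.env 26 = r) (h43 : σ₀.env 43 = if pre then 1 else 0)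
    (hacc : Acc (σ₀.env 99) σ₀.out L₀) :
    WP M q (planarQuery act) σ₀ (Traversed Ls a c Acc 26 σ₀ L₀
      (fun i => i ∈ V ∧ x i ≤ (q 0 : Coord) ∧ cornerCond pre y (q 1) i)
      (ℓ + 1) (130 * (ℓ + 1))) := by
  have hw2 : 2 ≤ w := by omega
  have hW := nodup_sortByKey y V
  have hlen : (sortByKey y V).length = V.card := length_sortByKey y V
  have hd : ∀ h t, h ≤ Nat.clog 2 V.card → t * 2 ^ h < (sortByKey y V).length →
      Handle M (101 * (K * B) + 20) (addr h t) (nodeList x (sortByKey y V) h t) ∧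
        nodeList x (sortByKey y V) h t ∈ Ls := by
    intro h t hh ht
    refine ⟨hP.tree.handle hw hM hT hB hn hW (hP.height.trans_lt hK) hh ht, hLs _ ?_⟩
    exact mem_planarLists.2 ⟨h, t, hh, by rwa [hlen] at ht, rfl⟩
  refine WP.seq (WP.asg hw2 hM (by norm_num) (val_ld_reg_lit hw (by norm_num) (by norm_num)
    h26 hP.arr) ?_)
  refine WP.seq (WP.asg hw2 hM (by norm_num) (val_ld_reg_lit hw (by norm_num) (by norm_num)
    (by simpa using h26) hP.step) ?_)
  refine WP.seq ((wp_search hw hM hP.keys (pairwise_nodeList _ _) 0 (by simp) (by simp)).mono ?_)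
  rintro σ₁ ⟨f1, f2, ho, h24, ht⟩
  have g26 : σ₁.env 26 = r := by rw [f1 26 le_rfl]; simpa using h26
  refine WP.seq (WP.asg hw2 hM (by norm_num) (val_ld_reg_lit hw (by norm_num) (by norm_num)
    g26 hP.root) ?_)
  refine WP.seq (WP.asg hw2 hM (by norm_num) ⟨by norm_num, rfl⟩ ?_)
  refine WP.seq (WP.asg hw2 hM (by norm_num) (v := 1)
    ⟨rfl, lit_lt_two_pow hw (by norm_num)⟩ ?_)
  refine (wp_descend hw hM hT hn hW ((pairwise_sortByKey y V).imp fun h => h.key_le) hP.tree hact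
    (pre := pre) hd (Nat.clog 2 V.card) 0 _ L₀ le_rfl (by rw [hlen, zero_mul]; exact hV.card_pos)
    (by simp) (by simp [h24]) (by simp) ?_ ?_).mono ?_
  · simp [f1 43, h43]
  · simp [f1 99, ho, hacc]
  · intro σ' h'
    refine h'.weaken (by norm_num) ?_ ?_ (Nat.succ_le_succ hP.height) ?_
    · intro k hk hk'
      simp (disch := omega) [AState.upd_env, if_neg, f1 k hk]
    · intro i
      rw [mem_nodeList_root]
    · have h1 := hP.height
      have h2 := hP.size
      simp [RExpr.cost] at ht ⊢
      omega

end descend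

/-! ### Spatial queries -/

/-- Query the dominance structure whose record is at `r 30`. -/
def spatialQuery (act : Prog) : Prog :=
  asg 22 (.ld (.reg 30) (.lit 0)) ;;
  asg 23 (.ld (.reg 30) (.lit 1)) ;;
  search 2 ;;
  asg 32 (.ld (.reg 30) (.lit 4)) ;;
  asg 31 (.op .mul (.reg 24) (.reg 32)) ;;
  .loop 32 (
    asg 27 (.ld (.ld (.reg 30) (.lit 2)) (.reg 31)) ;;
    asg 28 (.ld (.ld (.reg 30) (.lit 3)) (.reg 31)) ;;
    .loop 28 (
      asg 26 (.ld (.reg 27) (.lit 0)) ;;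
      planarQuery act ;;
      asg 27 (.op .add (.reg 27) (.lit 1)) ;;
      asg 28 (.op .sub (.reg 28) (.lit 1))) ;;
    asg 31 (.op .add (.reg 31) (.lit 1)) ;;
    asg 32 (.op .sub (.reg 32) (.lit 1)))

/-- The record at `r` of the dominance structure for the points `J`: an array of sorted `z`-keys,
the planar structures of all nodes of the range tree, and for every rank the canonical
decomposition of the leaves before it, or of those from it on. -/
structure SpatialAt {w n : ℕ} (M : List (Cell w)) (b B lam : ℕ) (x y z : Fin n → Coord) (pre : Bool)
    (J : Finset (Fin n)) (ℓ r A m starts counts : ℕ) (ptr : ℕ → ℕ) (rec : ℕ → ℕ → ℕ) : Prop where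
  arr : wordAt M (r + 0) = some A
  step : wordAt M (r + 1) = some (2 ^ m / 2)
  startsPtr : wordAt M (r + 2) = some starts
  countsPtr : wordAt M (r + 3) = some counts
  levels : wordAt M (r + 4) = some (Nat.clog lam J.card + 1)
  keys : SortedKeys M A m z (sortByKey z J)
  size : m ≤ ℓ
  runs : ∀ p ≤ J.card, ∃ lo hi, Runs lam J.card (Nat.clog lam J.card)
      (if pre then (· < p) else (p ≤ ·)) lo hi ∧ ∀ j ≤ Nat.clog lam J.card,
    wordAt M (starts + (p * (Nat.clog lam J.card + 1) + j)) = some (ptr j + lo j) ∧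
    wordAt M (counts + (p * (Nat.clog lam J.card + 1) + j)) = some (hi j - lo j)
  recs : ∀ j ≤ Nat.clog lam J.card, ∀ t, t * lam ^ j < J.card →
    wordAt M (ptr j + t) = some (rec j t) ∧ ∃ A m addr,
      PlanarAt M b B x y ((sortByKey z J).block (lam ^ j) t).toFinset ℓ (rec j t) A m addr

section spatial
variable {w n : ℕ} {M : List (Cell w)} {q : Fin 3 → ℝ} {b B lam K ℓ : ℕ} {x y z : Fin n → Coord}
  {Ls : List (List (Fin n))} {a c : ℕ}
  {Acc : ℕ → List ℕ → List (List (Fin n)) → Prop} {act : Prog}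

theorem Traversed.upd {K N T T' : ℕ} {σ σ' : AState} {L₀ : List (List (Fin n))} {S : Fin n → Prop}
    (h : Traversed Ls a c Acc K σ L₀ S N T σ') {r v k : ℕ} (hr : r < K) (hr' : r ≠ 99)
    (hT : T + k ≤ T') : Traversed Ls a c Acc K σ L₀ S N T' (σ'.upd r v k) := by
  obtain ⟨f, L, h1, h2, h3⟩ := h
  refine ⟨fun r' h h' => ?_, L, h1, ?_, ?_⟩
  · rw [AState.upd_env, if_neg (by omega), f r' h h']
  · rwa [AState.upd_env, if_neg (by omega)]
  · simp only [AState.upd_time]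
    omega

theorem exists_lt_sub_iff {lo hi t : ℕ} {P : ℕ → Prop} (h : ∀ s, P s ↔ t = s) :
    (∃ k < hi - lo, P (lo + k)) ↔ lo ≤ t ∧ t < hi := by
  constructor
  · rintro ⟨k, hk, hP⟩
    have := (h _).1 hP
    omega
  · rintro ⟨h1, h2⟩
    exact ⟨t - lo, by omega, (h _).2 (by omega)⟩

/-- Passage to rank space: a condition on the z-key becomes a comparison of the position in the
sorted list with one rank, for which a canonical decomposition is stored. -/
theorem countP_leQuery_iff {key : Fin n → Coord} {S : Finset (Fin n)} {r : ℝ} {i : Fin n}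
    (hi : i ∈ S) : (sortByKey key S).idxOf i < (sortByKey key S).countP (leQuery key r) ↔
      key i ≤ (r : Coord) := by
  set Z := sortByKey key S
  have hZ : Z.Nodup := nodup_sortByKey key S
  have hiZ : i ∈ Z := (mem_sortByKey key S).2 hi
  have h1 := List.take_countP_eq_filter (p := leQuery key r) Z (pairwise_sortByKey key S)
    (fun j k h h' => by rw [leQuery_iff] at h' ⊢; exact h.key_le.trans h')
  have h2 : i ∈ Z.take (Z.countP (leQuery key r)) ↔
      Z.idxOf i < Z.countP (leQuery key r) := by
    rw [List.mem_iff_getElem?]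
    constructor
    · rintro ⟨k, hk⟩
      rw [List.getElem?_take] at hk
      split at hk
      next h =>
        obtain ⟨h3, rfl⟩ := List.getElem?_eq_some_iff.1 hk
        rwa [hZ.idxOf_getElem]
      next => simp at hk
    · intro h
      exact ⟨Z.idxOf i, by rw [List.getElem?_take, if_pos h, List.getElem?_idxOf hiZ]⟩
  rw [← h2, h1, List.mem_filter, leQuery_iff]
  exact and_iff_right hiZ

/-- The rank of the query coordinate among the z-keys selects a row of the tables of runs. The outer
loop goes through the heights, the inner one through at most `lam` consecutive blocks; the points of
these blocks are pairwise disjoint, and together they are exactly those with the required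
z-condition. -/
theorem wp_spatialQuery (hw : 8 ≤ w) (hM : M.length ≤ 2 ^ w) (hT : HasTable M b) (hB : 2 ≤ B)
    (hn : n < 2 ^ w) (hK : ℓ < B ^ K) (hlam : 2 ≤ lam)
    (hact : IsAction M q (101 * (K * B) + 20) a c act Acc) {pre prez : Bool} {J : Finset (Fin n)}
    {Λ : ℕ} (hΛ : Nat.clog lam J.card ≤ Λ)
    {r A m starts counts : ℕ} {ptr : ℕ → ℕ} {rec : ℕ → ℕ → ℕ}
    (hP : SpatialAt M b B lam x y z prez J ℓ r A m starts counts ptr rec)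
    (hLs : ∀ P ∈ dominanceLists lam x y z J, P ∈ Ls) {σ₀ : AState} {L₀ : List (List (Fin n))}
    (h30 : σ₀.env 30 = r) (h43 : σ₀.env 43 = if pre then 1 else 0)
    (hacc : Acc (σ₀.env 99) σ₀.out L₀) :
    WP M q (spatialQuery act) σ₀ (Traversed Ls a c Acc 35 σ₀ L₀
      (fun i => i ∈ J ∧ x i ≤ (q 0 : Coord) ∧ cornerCond pre y (q 1) i ∧ cornerCond prez z (q 2) i)
      ((Λ + 1) * (lam * (ℓ + 1))) (400 * ((Λ + 1) * (lam * (ℓ + 1))))) := by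
  have hw2 : 2 ≤ w := by omega
  set H := Nat.clog lam J.card with hH
  set Z := sortByKey z J with hZ
  have hZn : Z.Nodup := nodup_sortByKey z J
  have hZlen : Z.length = J.card := length_sortByKey z J
  have hlamj : ∀ j, 1 ≤ lam ^ j := fun j => Nat.one_le_pow _ _ (by omega)
  refine WP.seq (WP.asg hw2 hM (by norm_num) (val_ld_reg_lit hw (by norm_num) (by norm_num)
    h30 hP.arr) ?_)
  refine WP.seq (WP.asg hw2 hM (by norm_num) (val_ld_reg_lit hw (by norm_num) (by norm_num)
    (by simpa using h30) hP.step) ?_)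
  refine WP.seq ((wp_search hw hM hP.keys ((pairwise_sortByKey z J).imp fun h => h.key_le) 2
    (by simp) (by simp)).mono ?_)
  rintro σ₁ ⟨f1, f2, ho, h24, ht⟩
  set p := Z.countP (leQuery z (q 2)) with hp
  have hpJ : p ≤ J.card := hZlen ▸ List.countP_le_length
  obtain ⟨lo, hi, hruns, hcells⟩ := hP.runs p hpJ
  rw [← hH] at hruns hcells
  have g30 : σ₁.env 30 = r := by rw [f1 30 (by norm_num)]; simpa using h30
  have g43 : σ₁.env 43 = if pre then 1 else 0 := by rw [f1 43 (by norm_num)]; simpa using h43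
  have hidx : ∀ j ≤ H, p * (H + 1) + j < 2 ^ w := fun j hj => by
    have := wordAt_addr_lt (hcells j hj).1
    omega
  refine WP.seq (WP.asg hw2 hM (by norm_num) (val_ld_reg_lit hw (by norm_num) (by norm_num)
    g30 hP.levels) ?_)
  refine WP.seq (WP.asg hw2 hM (by norm_num) (v := p * (H + 1)) ⟨p, ⟨by norm_num, by simp [h24]⟩,
    H + 1, ⟨by norm_num, by simp [hH]⟩, rfl, by simpa using hidx 0 (Nat.zero_le _)⟩ ?_)
  set cond : Fin n → Prop := fun i => x i ≤ (q 0 : Coord) ∧ cornerCond pre y (q 1) i with hcond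
  set S : ℕ → Fin n → Prop := fun j i => ∃ k < hi j - lo j,
    (i ∈ (Z.block (lam ^ j) (lo j + k)).toFinset ∧ cond i) with hS
  have hblock : ∀ j t i, i ∈ (Z.block (lam ^ j) t).toFinset ↔ i ∈ Z ∧ Z.idxOf i / lam ^ j = t :=
    fun j t i => by rw [List.mem_toFinset, List.mem_block hZn (hlamj j)]
  have hSiff : ∀ j i, S j i ↔ (i ∈ Z ∧ cond i) ∧
      (lo j ≤ Z.idxOf i / lam ^ j ∧ Z.idxOf i / lam ^ j < hi j) := by
    intro j i
    simp only [hS, hblock]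
    rw [← exists_lt_sub_iff (P := fun s => Z.idxOf i / lam ^ j = s) (fun s => Iff.rfl)]
    constructor
    · rintro ⟨k, hk, ⟨h1, h2⟩, h3⟩
      exact ⟨⟨h1, h3⟩, k, hk, h2⟩
    · rintro ⟨⟨h1, h3⟩, k, hk, h2⟩
      exact ⟨k, hk, ⟨h1, h2⟩, h3⟩
  have hidxlt : ∀ i, i ∈ Z → Z.idxOf i < J.card := fun i hi' => by
    rw [← hZlen]; exact List.idxOf_lt_length_iff.2 hi'
  have inner : ∀ j ≤ H, ∀ σ L, σ.env 27 = (ptr j + lo j) % 2 ^ w →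
      σ.env 43 = (if pre then 1 else 0) → σ.env 28 = hi j - lo j → Acc (σ.env 99) σ.out L →
      WP M q (.loop 28 (
        asg 26 (.ld (.reg 27) (.lit 0)) ;;
        planarQuery act ;;
        asg 27 (.op .add (.reg 27) (.lit 1)) ;;
        asg 28 (.op .sub (.reg 28) (.lit 1)))) σ (Traversed Ls a c Acc 30 σ L (S j)
          (lam * (ℓ + 1)) (lam * (150 * (ℓ + 1)) + 1)) := by
    intro j hj σ L h33 h43 h34 hacc
    have hm : hi j - lo j ≤ lam := by have := hruns.le j; omega
    -- The cursor is only tracked modulo `2 ^ w`: after the last block of a run, or for an empty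
    -- run, it need not be the address of a cell. Within a run it is one, and there the remainder
    -- disappears.
    refine (wp_countdown (Ls := Ls) (a := a) (c := c) (Acc := Acc) (rc := 28) (K := 30) (N := ℓ + 1) (T := 130 * (ℓ + 1) + 15) (by norm_num)
      (I := fun k σ => σ.env 27 = (ptr j + lo j + k) % 2 ^ w ∧
        σ.env 43 = (if pre then 1 else 0))
      (S := fun k i => i ∈ (Z.block (lam ^ j) (lo j + k)).toFinset ∧ cond i)
      (fun k σ h => h) (hi j - lo j) 0 ?_ ?_ σ L ⟨h33, h43⟩ h34 hacc).mono ?_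
    · rintro k hk k' hk' i ⟨h, -⟩ ⟨h', -⟩
      simp only [hblock] at h h'
      omega
    · rintro k hk σ L ⟨h33, h43⟩ h34 hacc
      rw [zero_add] at h33 ⊢
      have hv : (lo j + k) * lam ^ j < J.card := hruns.valid j hj _ (by omega)
      obtain ⟨hr1, A', m', addr', hPl⟩ := hP.recs j hj (lo j + k) hv
      have hlt := wordAt_addr_lt hr1
      rw [← add_assoc] at hr1 hlt
      have h33' : σ.env 27 = ptr j + lo j + k := by
        rw [h33, Nat.mod_eq_of_lt (by omega)]
      refine WP.seq (WP.asg hw2 hM (by norm_num) (val_ld_reg_lit hw (by norm_num) (by norm_num)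
        h33' hr1) ?_)
      have hne : ((Z.block (lam ^ j) (lo j + k)).toFinset).Nonempty := by
        rw [← hZlen] at hv
        refine ⟨Z[(lo j + k) * lam ^ j], ?_⟩
        rw [hblock]
        refine ⟨List.getElem_mem _, ?_⟩
        rw [hZn.idxOf_getElem, Nat.mul_div_cancel _ (hlamj j)]
      refine WP.seq ((wp_planarQuery (pre := pre) (Ls := Ls) hw hM hT hB hn hK hact hne hPl ?_
        (by simp) (by simpa using h43) (by simpa using hacc)).mono ?_)
      · intro P hP'
        exact hLs P ((mem_dominanceLists (by omega)).2 ⟨j, lo j + k, hj, hv, hP'⟩)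
      intro σ₂ hσ₂
      have k33 : σ₂.env 27 = ptr j + lo j + k := by
        rw [hσ₂.1 27 (by norm_num) (by norm_num)]; simpa using h33'
      have k34 : σ₂.env 28 = hi j - lo j - k := by
        rw [hσ₂.1 28 (by norm_num) (by norm_num)]; simpa using h34
      have k43 : σ₂.env 43 = if pre then 1 else 0 := by
        rw [hσ₂.1 43 (by norm_num) (by norm_num)]; simpa using h43
      refine WP.seq (WP.asg hw2 hM (by norm_num) (v := (ptr j + lo j + k + 1) % 2 ^ w)
        ⟨_, ⟨by norm_num, rfl⟩, 1, ⟨rfl, lit_lt_two_pow hw (by norm_num)⟩, by rw [k33]; rfl⟩ ?_)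
      refine WP.asg hw2 hM (by norm_num) (v := hi j - lo j - (k + 1))
        ⟨hi j - lo j - k, ⟨by norm_num, by simp [k34]⟩, 1,
          ⟨rfl, lit_lt_two_pow hw (by norm_num)⟩, ?_⟩ ?_
      · change _ = _ - _ ∧ _ ≤ _
        omega
      refine ⟨?_, ⟨by simp [add_assoc], by simp [k43]⟩, by simp⟩
      refine ((hσ₂.weaken (T' := 130 * (ℓ + 1) + 5) (K' := 30) (σ := σ) (by norm_num) ?_
        (fun _ => Iff.rfl) le_rfl ?_).upd (T' := 130 * (ℓ + 1) + 10) (by norm_num) (by norm_num)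
          ?_).upd (by norm_num) (by norm_num) ?_
      · intro k hk hk'
        simp (disch := omega) [AState.upd_env, if_neg]
      · simp [RExpr.cost]; omega
      · simp [RExpr.cost]
      · simp [RExpr.cost]
    · intro σ' h'
      refine h'.weaken le_rfl (fun _ _ _ => rfl) (fun i => ?_) (Nat.mul_le_mul_right _ hm) ?_
      · simp only [hS, zero_add]
      · have := Nat.mul_le_mul_right (130 * (ℓ + 1) + 15 + 1) hm
        have : lam * (130 * (ℓ + 1) + 15 + 1) ≤ lam * (150 * (ℓ + 1)) :=
          Nat.mul_le_mul_left _ (by omega)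
        omega
  refine (wp_countdown (Ls := Ls) (a := a) (c := c) (Acc := Acc) (rc := 32) (K := 35) (N := lam * (ℓ + 1))
    (T := lam * (150 * (ℓ + 1)) + 40) (by norm_num)
    (I := fun j σ => σ.env 31 = (p * (H + 1) + j) % 2 ^ w ∧ σ.env 30 = r ∧
      σ.env 43 = (if pre then 1 else 0)) (S := S)
    (fun k σ h => h) (H + 1) 0 ?_ ?_ _ L₀ ⟨?_, ?_, ?_⟩ ?_ ?_).mono ?_
  · intro j hj j' hj' i h h'
    rw [zero_add, hSiff] at h h'
    exact hruns.unique _ (hidxlt i h.1.1) j (by omega) j' (by omega) h.2 h'.2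
  · rintro j hj σ L ⟨h31, h30, h43⟩ h32 hacc
    rw [zero_add] at h31 ⊢
    rw [Nat.mod_eq_of_lt (hidx j (by omega))] at h31
    obtain ⟨hc1, hc2⟩ := hcells j (by omega)
    refine WP.seq (WP.asg hw2 hM (by norm_num) (v := ptr j + lo j) ⟨starts,
      val_ld_reg_lit hw (by norm_num) (by norm_num) h30 hP.startsPtr, _,
      ⟨by norm_num, h31.symm⟩, hc1⟩ ?_)
    refine WP.seq (WP.asg hw2 hM (by norm_num) (v := hi j - lo j) ⟨counts,
      val_ld_reg_lit hw (by norm_num) (by norm_num) (by simpa using h30) hP.countsPtr, _,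
      ⟨by norm_num, by simp [h31]⟩, hc2⟩ ?_)
    refine WP.seq ((inner j (by omega) _ L ?_ (by simpa using h43) (by simp)
      (by simpa using hacc)).mono ?_)
    · simp only [AState.upd_env, if_true]
      rw [Nat.mod_eq_of_lt (wordAt_lt hc1)]
      simp
    intro σ₂ hσ₂
    have hf : ∀ k, 30 ≤ k → k ≠ 99 → σ₂.env k = σ.env k := by
      intro k hk hk'
      rw [hσ₂.1 k hk hk']
      simp (disch := omega) [AState.upd_env, if_neg]
    have k31 : σ₂.env 31 = p * (H + 1) + j := (hf 31 (by norm_num) (by norm_num)).trans h31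
    have k32 : σ₂.env 32 = H + 1 - j := (hf 32 (by norm_num) (by norm_num)).trans h32
    refine WP.seq (WP.asg hw2 hM (by norm_num) (v := (p * (H + 1) + j + 1) % 2 ^ w)
      ⟨_, ⟨by norm_num, rfl⟩, 1, ⟨rfl, lit_lt_two_pow hw (by norm_num)⟩, by rw [k31]; rfl⟩ ?_)
    refine WP.asg hw2 hM (by norm_num) (v := H + 1 - (j + 1))
      ⟨H + 1 - j, ⟨by norm_num, by simp [k32]⟩, 1,
        ⟨rfl, lit_lt_two_pow hw (by norm_num)⟩, ?_⟩ ?_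
    · change _ = _ - _ ∧ _ ≤ _
      omega
    refine ⟨?_, ⟨by simp [add_assoc], by simp [hf, h30], by simp [hf, h43]⟩, by simp⟩
    refine ((hσ₂.weaken (T' := lam * (150 * (ℓ + 1)) + 30) (K' := 35) (σ := σ) (by norm_num) ?_
      (fun _ => Iff.rfl) le_rfl ?_).upd (T' := lam * (150 * (ℓ + 1)) + 35) (by norm_num)
        (by norm_num) ?_).upd (by norm_num) (by norm_num) ?_
    · intro k hk hk'
      simp (disch := omega) [AState.upd_env, if_neg]
    · simp [RExpr.cost]; omega
    · simp [RExpr.cost]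
    · simp [RExpr.cost]
  · simp [Nat.mod_eq_of_lt (by simpa using hidx 0 (Nat.zero_le _) : p * (H + 1) < 2 ^ w)]
  · simpa using g30
  · simpa using g43
  · simp only [AState.upd_env, if_true]
    simp [hH]
  · simpa [ho, f1 99 (by norm_num)] using hacc
  · intro σ' h'
    have hX : 2 * (ℓ + 1) ≤ lam * (ℓ + 1) := Nat.mul_le_mul_right _ hlam
    refine h'.weaken le_rfl ?_ ?_ (Nat.mul_le_mul_right _ (by omega)) ?_
    · intro k hk hk'
      simp (disch := omega) [AState.upd_env, if_neg, f1 k (by omega)]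
    · intro i
      simp only [zero_add, hSiff]
      have hcov : i ∈ Z → ((∃ k < H + 1, lo k ≤ Z.idxOf i / lam ^ k ∧ Z.idxOf i / lam ^ k < hi k) ↔
          cornerCond prez z (q 2) i) := by
        intro hiZ
        have h1 := hruns.cover _ (hidxlt i hiZ)
        have h2 := countP_leQuery_iff (key := z) (r := q 2) ((mem_sortByKey z J).1 hiZ)
        rw [← hZ, ← hp] at h2
        simp only [Nat.lt_succ_iff]
        rw [← h1, cornerCond]
        cases prez
        · simp only [Bool.false_eq_true, if_false]
          rw [← not_le, ← h2, not_lt]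
        · simpa using h2
      constructor
      · rintro ⟨k, hk, ⟨h1, h2⟩, h3⟩
        exact ⟨(mem_sortByKey z J).1 h1, h2.1, h2.2, (hcov h1).1 ⟨k, hk, h3⟩⟩
      · rintro ⟨h1, h2, h3, h4⟩
        have h1 := (mem_sortByKey z J).2 h1
        obtain ⟨k, hk, h5⟩ := (hcov h1).2 h4
        exact ⟨k, hk, ⟨h1, h2, h3⟩, h5⟩
    · have hm := hP.size
      -- The overhead `41` per height is absorbed by `21 * (lam * (ℓ + 1))`, since `lam * (ℓ + 1) ≥
      -- 2`.
      have e1 : (H + 1) * (lam * (150 * (ℓ + 1)) + 40 + 1) ≤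
          (Λ + 1) * (171 * (lam * (ℓ + 1))) := by
        refine Nat.mul_le_mul (by omega) ?_
        rw [Nat.mul_left_comm]
        omega
      have e2 : lam * (ℓ + 1) ≤ (Λ + 1) * (lam * (ℓ + 1)) := Nat.le_mul_of_pos_left _ (by omega)
      rw [Nat.mul_left_comm (Λ + 1)] at e1
      generalize (H + 1) * (lam * (150 * (ℓ + 1)) + 40 + 1) = U at *
      generalize (Λ + 1) * (lam * (ℓ + 1)) = Y at *
      generalize lam * (ℓ + 1) = X at *
      simp [RExpr.cost] at ht ⊢
      omega

end spatial

/-! ### Queries on the interval trees -/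

/-- Query the middle-layer tree whose root is in register `40`; register `41` is `1` for the lower
and `0` for the upper `z`-corners. -/
def midQuery (act : Prog) : Prog :=
  .loop 40 (
    asg 42 (.op .lt (.cmp (.reg 40) (.lit 0) 1) (.lit 2)) ;;
    asg 43 (.op .eq (.reg 42) (.lit 0)) ;;
    asg 30 (.ld (.reg 40) (.op .add (.lit 3) (.op .add (.reg 41) (.op .add (.reg 41) (.reg 43))))) ;;
    asg 40 (.ld (.reg 40) (.op .add (.lit 1) (.reg 42))) ;;
    spatialQuery act)

/-- Query the top-layer tree whose root is in register `50`. -/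
def topQuery (act : Prog) : Prog :=
  .loop 50 (
    asg 51 (.op .lt (.cmp (.reg 50) (.lit 0) 2) (.lit 2)) ;;
    asg 41 (.op .eq (.reg 51) (.lit 0)) ;;
    asg 40 (.ld (.reg 50) (.lit 3)) ;;
    asg 50 (.ld (.reg 50) (.op .add (.lit 1) (.reg 51))) ;;
    midQuery act)

/-- The record at `r` describes a dominance structure for the points `J`. -/
def HoldsSpatial {w n : ℕ} (M : List (Cell w)) (b B lam : ℕ) (x y z : Fin n → Coord) (pre : Bool)
    (J : Finset (Fin n)) (ℓ r : ℕ) : Prop :=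
  ∃ A m starts counts ptr rec, SpatialAt M b B lam x y z pre J ℓ r A m starts counts ptr rec

/-- A middle-layer tree with root at `r`. -/
def MidAt {w n : ℕ} (M : List (Cell w)) (b B lam ℓ : ℕ) (x ylo yhi zlo zhi : Fin n → Coord) :
    IntervalTree (Fin n) → ℕ → Prop
  | .nil, r => r = 0
  | .node med J t₁ t₂, r => r ≠ 0 ∧ coordAt M (r + 0) = some med ∧
      (∃ r₁, wordAt M (r + 1) = some r₁ ∧ MidAt M b B lam ℓ x ylo yhi zlo zhi t₁ r₁) ∧
      (∃ r₂, wordAt M (r + 2) = some r₂ ∧ MidAt M b B lam ℓ x ylo yhi zlo zhi t₂ r₂) ∧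
      ∀ dz dy : Bool, ∃ s, wordAt M (r + (3 + (2 * dz.toNat + dy.toNat))) = some s ∧
        HoldsSpatial M b B lam x (if dy then ylo else yhi) (if dz then zlo else zhi) dz J ℓ s

/-- A top-layer tree with root at `r`. -/
def TopAt {w n : ℕ} (M : List (Cell w)) (b B lam ℓ : ℕ) (x ylo yhi zlo zhi : Fin n → Coord) :
    IntervalTree (Fin n) → ℕ → Prop
  | .nil, r => r = 0
  | .node med I t₁ t₂, r => r ≠ 0 ∧ coordAt M (r + 0) = some med ∧
      (∃ r₁, wordAt M (r + 1) = some r₁ ∧ TopAt M b B lam ℓ x ylo yhi zlo zhi t₁ r₁) ∧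
      (∃ r₂, wordAt M (r + 2) = some r₂ ∧ TopAt M b B lam ℓ x ylo yhi zlo zhi t₂ r₂) ∧
      ∃ s, wordAt M (r + 3) = some s ∧
        MidAt M b B lam ℓ x ylo yhi zlo zhi (intervalTree ylo yhi I) s

/-- One comparison decides about the intervals that contain the median. -/
theorem interval_mem_iff {lo hi : Fin n → Coord} {m : Coord} {r : ℝ} {i : Fin n}
    (hi' : lo i ≤ m ∧ m < hi i) :
    (lo i ≤ (r : Coord) ∧ (r : Coord) < hi i) ↔
      cornerCond (decide (¬ m ≤ (r : Coord))) (if decide (¬ m ≤ (r : Coord)) then lo else hi) r i := by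
  by_cases h : m ≤ (r : Coord)
  · simpa [cornerCond, h] using fun _ => hi'.1.trans h
  · simpa [cornerCond, h] using fun _ => (not_le.1 h).trans hi'.2

section layers
variable {w n : ℕ} {M : List (Cell w)} {q : Fin 3 → ℝ} {b B lam K ℓ : ℕ}
  {x ylo yhi zlo zhi : Fin n → Coord} {Ls : List (List (Fin n))} {a c : ℕ}
  {Acc : ℕ → List ℕ → List (List (Fin n)) → Prop} {act : Prog}

/-- Intervals in the subtree away from the query coordinate cannot contain it, so one dominance
query per level of a single path suffices. The comparison with the median also selects which
y-corner still has to be tested. -/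
theorem wp_midQuery (hw : 8 ≤ w) (hM : M.length ≤ 2 ^ w) (hT : HasTable M b) (hB : 2 ≤ B)
    (hn : n < 2 ^ w) (hK : ℓ < B ^ K) (hlam : 2 ≤ lam)
    (hact : IsAction M q (101 * (K * B) + 20) a c act Acc) {dz : Bool} {Λ : ℕ}
    (hΛ : Nat.clog lam n ≤ Λ) (tree : IntervalTree (Fin n)) :
    ∀ (S : Finset (Fin n)) (r : ℕ) (σ₀ : AState) (L₀ : List (List (Fin n))),
      IsIntervalTree ylo yhi tree S → MidAt M b B lam ℓ x ylo yhi zlo zhi tree r →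
      (∀ J ∈ tree.nodeSets, ∀ dy : Bool, ∀ P ∈ dominanceLists lam x (if dy then ylo else yhi)
        (if dz then zlo else zhi) J, P ∈ Ls) →
      σ₀.env 40 = r → σ₀.env 41 = dz.toNat → Acc (σ₀.env 99) σ₀.out L₀ →
      WP M q (midQuery act) σ₀ (Traversed Ls a c Acc 44 σ₀ L₀
        (fun i => i ∈ S ∧ x i ≤ (q 0 : Coord) ∧ (ylo i ≤ (q 1 : Coord) ∧ (q 1 : Coord) < yhi i) ∧
          cornerCond dz (if dz then zlo else zhi) (q 2) i)
        (tree.depth * ((Λ + 1) * (lam * (ℓ + 1))))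
        (tree.depth * (440 * ((Λ + 1) * (lam * (ℓ + 1)))) + 1)) := by
  classical
  have hw2 : 2 ≤ w := by omega
  have hY : 1 ≤ (Λ + 1) * (lam * (ℓ + 1)) := Nat.one_le_iff_ne_zero.2 (by positivity)
  induction tree with
  | nil =>
    rintro S r σ₀ L₀ hS hr - h40 - hacc
    have hS : S = ∅ := hS
    have hr : r = 0 := hr
    refine WP.loop_done (by norm_num) (by omega) (Traversed.nil ?_ (fun _ _ _ => rfl) hacc ?_)
    · simp [hS]
    · simp
  | node m J t₁ t₂ ih₁ ih₂ =>
    rintro S r σ₀ L₀ hS hr hLs h40 h41 hacc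
    obtain ⟨hJ, ⟨S₁, hS₁, hS₁'⟩, S₂, hS₂, hS₂'⟩ := hS
    obtain ⟨hr0, hmed, ⟨r₁, hr₁, hr₁'⟩, ⟨r₂, hr₂, hr₂'⟩, hdom⟩ := hr
    have hlen : J.card ≤ n := by simpa using J.card_le_univ
    set dy : Bool := decide (¬ m ≤ (q 1 : Coord)) with hdy
    obtain ⟨s, hs, A, m', starts, counts, ptr, rec, hsp⟩ := hdom dz dy
    -- the subtree on the path
    obtain ⟨r', t', S', hr', ht', hS'⟩ : ∃ r' t' S', wordAt M (r + (1 +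
        (if m ≤ (q 1 : Coord) then 1 else 0))) = some r' ∧
        (t' = if m ≤ (q 1 : Coord) then t₂ else t₁) ∧
        S' = if m ≤ (q 1 : Coord) then S₂ else S₁ := by
      by_cases h : m ≤ (q 1 : Coord)
      · simp only [h, if_true]
        exact ⟨_, _, _, hr₂, rfl, rfl⟩
      · simp only [h, if_false]
        exact ⟨_, _, _, hr₁, rfl, rfl⟩
    have sub : ∀ σ L, σ.env 40 = r' → σ.env 41 = dz.toNat → Acc (σ.env 99) σ.out L →
        WP M q (midQuery act) σ (Traversed Ls a c Acc 44 σ L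
          (fun i => i ∈ S' ∧ x i ≤ (q 0 : Coord) ∧ (ylo i ≤ (q 1 : Coord) ∧ (q 1 : Coord) < yhi i) ∧
            cornerCond dz (if dz then zlo else zhi) (q 2) i)
          (max t₁.depth t₂.depth * ((Λ + 1) * (lam * (ℓ + 1))))
          (max t₁.depth t₂.depth * (440 * ((Λ + 1) * (lam * (ℓ + 1)))) + 1)) := by
      intro σ L h40 h41 hacc
      by_cases h : m ≤ (q 1 : Coord)
      · simp only [h, if_true] at hr' hS'
        obtain rfl : r₂ = r' := Option.some.inj (hr₂.symm.trans hr')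
        subst hS'
        refine (ih₂ _ _ σ L hS₂' hr₂' (fun J' hJ' => hLs J' ?_) h40 h41 hacc).mono
          fun σ' h' => h'.weaken le_rfl (fun _ _ _ => rfl) (fun _ => Iff.rfl) ?_ ?_
        · simp [IntervalTree.nodeSets, hJ']
        · exact Nat.mul_le_mul_right _ (le_max_right _ _)
        · gcongr; exact le_max_right _ _
      · simp only [h, if_false] at hr' hS'
        obtain rfl : r₁ = r' := Option.some.inj (hr₁.symm.trans hr')
        subst hS'
        refine (ih₁ _ _ σ L hS₁' hr₁' (fun J' hJ' => hLs J' ?_) h40 h41 hacc).mono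
          fun σ' h' => h'.weaken le_rfl (fun _ _ _ => rfl) (fun _ => Iff.rfl) ?_ ?_
        · simp [IntervalTree.nodeSets, hJ']
        · exact Nat.mul_le_mul_right _ (le_max_left _ _)
        · gcongr; exact le_max_left _ _
    refine WP.loop_step (by norm_num) (by omega) ?_
    refine WP.seq (WP.asg hw2 hM (by norm_num) (v := if m ≤ (q 1 : Coord) then 1 else 0)
      ⟨_, ⟨r, ⟨by norm_num, by simp [h40]⟩, 0, ⟨rfl, lit_lt_two_pow hw (by norm_num)⟩,
        _, hmed, rfl⟩, 2, ⟨rfl, lit_lt_two_pow hw (by norm_num)⟩, (cmpNat_lt_two _ _).symm⟩ ?_)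
    refine WP.seq (WP.asg hw2 hM (by norm_num) (v := dy.toNat)
      ⟨_, ⟨by norm_num, rfl⟩, 0, ⟨rfl, lit_lt_two_pow hw (by norm_num)⟩, ?_⟩ ?_)
    · change _ = if _ = _ then 1 else 0
      by_cases h : m ≤ (q 1 : Coord) <;> simp [hdy, h]
    have hbz : dz.toNat ≤ 1 := Bool.toNat_le dz
    have hby : dy.toNat ≤ 1 := Bool.toNat_le dy
    have hlit : 99 < 2 ^ w := lit_lt_two_pow hw (by norm_num)
    refine WP.seq (WP.asg hw2 hM (by norm_num) (v := s)
      ⟨r, ⟨by norm_num, by simp [h40]⟩, 3 + (2 * dz.toNat + dy.toNat),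
        ⟨3, ⟨rfl, lit_lt_two_pow hw (by norm_num)⟩, 2 * dz.toNat + dy.toNat,
          ⟨dz.toNat, ⟨by norm_num, by simp [h41]⟩, dz.toNat + dy.toNat,
            ⟨dz.toNat, ⟨by norm_num, by simp [h41]⟩, dy.toNat, ⟨by norm_num, by simp⟩, ?_⟩, ?_⟩, ?_⟩,
        hs⟩ ?_)
    · exact (Nat.mod_eq_of_lt (by omega)).symm
    · change _ = _ % _
      rw [Nat.mod_eq_of_lt (by omega)]
      omega
    · exact (Nat.mod_eq_of_lt (by omega)).symm
    refine WP.seq (WP.asg hw2 hM (by norm_num) (v := r')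
      ⟨r, ⟨by norm_num, by simp [h40]⟩, 1 + (if m ≤ (q 1 : Coord) then 1 else 0),
        ⟨1, ⟨rfl, lit_lt_two_pow hw (by norm_num)⟩, if m ≤ (q 1 : Coord) then 1 else 0,
          ⟨by norm_num, by simp⟩, ?_⟩, hr'⟩ ?_)
    · refine (Nat.mod_eq_of_lt ?_).symm
      split <;> omega
    refine WP.trav_seq (wp_spatialQuery (Ls := Ls) (pre := dy) (Λ := Λ) hw hM hT hB hn hK hlam hact
      ((Nat.clog_mono_right lam hlen).trans hΛ) hsp (hLs J (by simp [IntervalTree.nodeSets]) dy)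
      (by simp) ?_ (by simpa using hacc)) ?_ (by norm_num) ?_ ?_ ?_
      (N₂ := max t₁.depth t₂.depth * ((Λ + 1) * (lam * (ℓ + 1))))
      (T₂ := max t₁.depth t₂.depth * (440 * ((Λ + 1) * (lam * (ℓ + 1)))) + 1)
      (S₂ := fun i => i ∈ S' ∧ x i ≤ (q 0 : Coord) ∧
        (ylo i ≤ (q 1 : Coord) ∧ (q 1 : Coord) < yhi i) ∧
        cornerCond dz (if dz then zlo else zhi) (q 2) i) ?_ ?_
    · by_cases h : m ≤ (q 1 : Coord) <;> simp [hdy, h]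
    · intro σ₁ L hacc₁ hf
      refine sub σ₁ L ?_ ?_ hacc₁
      · rw [hf 40 (by norm_num) (by norm_num)]
        simp
      · rw [hf 41 (by norm_num) (by norm_num)]
        simp [h41]
    · intro k hk hk'
      simp (disch := omega) [AState.upd_env, if_neg]
    · rintro i ⟨h1, -⟩ ⟨h2, -⟩
      have h3 := ((hJ i).1 h1).2
      by_cases h : m ≤ (q 1 : Coord)
      · simp only [h, if_true] at hS'
        subst hS'
        exact h3.1.not_gt ((hS₂ i).1 h2).2
      · simp only [h, if_false] at hS'
        subst hS'
        exact h3.2.not_ge ((hS₁ i).1 h2).2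
    · intro i
      by_cases hiJ : i ∈ J
      · have h3 := (hJ i).1 hiJ
        have h4 := interval_mem_iff (r := q 1) h3.2
        rw [h4]
        have h5 : i ∉ S' := by
          intro h2
          by_cases h : m ≤ (q 1 : Coord)
          · simp only [h, if_true] at hS'
            subst hS'
            exact h3.2.1.not_gt ((hS₂ i).1 h2).2
          · simp only [h, if_false] at hS'
            subst hS'
            exact h3.2.2.not_ge ((hS₁ i).1 h2).2
        simp only [hiJ, h5, h3.1, true_and, false_and, or_false]
        rfl
      · simp only [hiJ, false_and, false_or]
        -- An interval that contains the query coordinate but not the median lies on the query's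
        -- side of the median, hence in the subtree on the path.
        have h5 : (ylo i ≤ (q 1 : Coord) ∧ (q 1 : Coord) < yhi i) → (i ∈ S ↔ i ∈ S') := by
          rintro ⟨h6, h7⟩
          by_cases h : m ≤ (q 1 : Coord)
          · simp only [h, if_true] at hS'
            subst hS'
            rw [hS₂]
            refine ⟨fun h8 => ⟨h8, ?_⟩, fun h8 => h8.1⟩
            by_contra h9
            exact hiJ ((hJ i).2 ⟨h8, not_lt.1 h9, h.trans_lt h7⟩)
          · simp only [h, if_false] at hS'
            subst hS'
            rw [hS₁]
            refine ⟨fun h8 => ⟨h8, ?_⟩, fun h8 => h8.1⟩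
            by_contra h9
            exact hiJ ((hJ i).2 ⟨h8, h6.trans (not_le.1 h).le, not_le.1 h9⟩)
        tauto
    · simp only [IntervalTree.depth]
      exact le_of_eq (by ring)
    · have hX : 2 ≤ (Λ + 1) * (lam * (ℓ + 1)) :=
        hlam.trans ((Nat.le_mul_of_pos_right _ (by omega)).trans
          (Nat.le_mul_of_pos_left _ (by omega)))
      simp only [IntervalTree.depth]
      rw [add_mul (max _ _), one_mul]
      generalize max t₁.depth t₂.depth * (440 * ((Λ + 1) * (lam * (ℓ + 1)))) = U
      generalize (Λ + 1) * (lam * (ℓ + 1)) = Y at *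
      simp [RExpr.cost]
      omega

/-- The argument of the middle layer one dimension up: on each level of the path, one middle-layer
query handles the intervals assigned to the node, with the z-corner chosen by the comparison with
the median. -/
theorem wp_topQuery (hw : 8 ≤ w) (hM : M.length ≤ 2 ^ w) (hT : HasTable M b) (hB : 2 ≤ B)
    (hn : n < 2 ^ w) (hK : ℓ < B ^ K) (hlam : 2 ≤ lam)
    (hact : IsAction M q (101 * (K * B) + 20) a c act Acc) {Λ D : ℕ}
    (hΛ : Nat.clog lam n ≤ Λ) (hlt : ∀ i, ylo i < yhi i)
    (hD : ∀ I, (intervalTree ylo yhi I).depth ≤ D) (tree : IntervalTree (Fin n)) :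
    ∀ (S : Finset (Fin n)) (r : ℕ) (σ₀ : AState) (L₀ : List (List (Fin n))),
      IsIntervalTree zlo zhi tree S → TopAt M b B lam ℓ x ylo yhi zlo zhi tree r →
      (∀ I ∈ tree.nodeSets, ∀ J ∈ (intervalTree ylo yhi I).nodeSets, ∀ dz dy : Bool,
        ∀ P ∈ dominanceLists lam x (if dy then ylo else yhi) (if dz then zlo else zhi) J, P ∈ Ls) →
      σ₀.env 50 = r → Acc (σ₀.env 99) σ₀.out L₀ →
      WP M q (topQuery act) σ₀ (Traversed Ls a c Acc 52 σ₀ L₀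
        (fun i => i ∈ S ∧ x i ≤ (q 0 : Coord) ∧ (ylo i ≤ (q 1 : Coord) ∧ (q 1 : Coord) < yhi i) ∧
          (zlo i ≤ (q 2 : Coord) ∧ (q 2 : Coord) < zhi i))
        (tree.depth * (D * ((Λ + 1) * (lam * (ℓ + 1)))))
        (tree.depth * (D * (440 * ((Λ + 1) * (lam * (ℓ + 1)))) + 50) + 1)) := by
  classical
  have hw2 : 2 ≤ w := by omega
  induction tree with
  | nil =>
    rintro S r σ₀ L₀ hS hr - h50 hacc
    have hS : S = ∅ := hS
    have hr : r = 0 := hr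
    refine WP.loop_done (by norm_num) (by omega) (Traversed.nil ?_ (fun _ _ _ => rfl) hacc ?_)
    · simp [hS]
    · simp
  | node m J t₁ t₂ ih₁ ih₂ =>
    rintro S r σ₀ L₀ hS hr hLs h50 hacc
    obtain ⟨hJ, ⟨S₁, hS₁, hS₁'⟩, S₂, hS₂, hS₂'⟩ := hS
    obtain ⟨hr0, hmed, ⟨r₁, hr₁, hr₁'⟩, ⟨r₂, hr₂, hr₂'⟩, s, hs, hmid⟩ := hr
    set dz : Bool := decide (¬ m ≤ (q 2 : Coord)) with hdz
    obtain ⟨r', S', hr', hS'⟩ : ∃ r' S', wordAt M (r + (1 +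
        (if m ≤ (q 2 : Coord) then 1 else 0))) = some r' ∧
        S' = if m ≤ (q 2 : Coord) then S₂ else S₁ := by
      by_cases h : m ≤ (q 2 : Coord)
      · simp only [h, if_true]
        exact ⟨_, _, hr₂, rfl⟩
      · simp only [h, if_false]
        exact ⟨_, _, hr₁, rfl⟩
    have sub : ∀ σ L, σ.env 50 = r' → Acc (σ.env 99) σ.out L →
        WP M q (topQuery act) σ (Traversed Ls a c Acc 52 σ L
          (fun i => i ∈ S' ∧ x i ≤ (q 0 : Coord) ∧ (ylo i ≤ (q 1 : Coord) ∧ (q 1 : Coord) < yhi i) ∧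
            (zlo i ≤ (q 2 : Coord) ∧ (q 2 : Coord) < zhi i))
          (max t₁.depth t₂.depth * (D * ((Λ + 1) * (lam * (ℓ + 1)))))
          (max t₁.depth t₂.depth * (D * (440 * ((Λ + 1) * (lam * (ℓ + 1)))) + 50) + 1)) := by
      intro σ L h50 hacc
      by_cases h : m ≤ (q 2 : Coord)
      · simp only [h, if_true] at hr' hS'
        obtain rfl : r₂ = r' := Option.some.inj (hr₂.symm.trans hr')
        subst hS'
        refine (ih₂ _ _ σ L hS₂' hr₂' (fun J' hJ' => hLs J' ?_) h50 hacc).mono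
          fun σ' h' => h'.weaken le_rfl (fun _ _ _ => rfl) (fun _ => Iff.rfl) ?_ ?_
        · simp [IntervalTree.nodeSets, hJ']
        · exact Nat.mul_le_mul_right _ (le_max_right _ _)
        · gcongr; exact le_max_right _ _
      · simp only [h, if_false] at hr' hS'
        obtain rfl : r₁ = r' := Option.some.inj (hr₁.symm.trans hr')
        subst hS'
        refine (ih₁ _ _ σ L hS₁' hr₁' (fun J' hJ' => hLs J' ?_) h50 hacc).mono
          fun σ' h' => h'.weaken le_rfl (fun _ _ _ => rfl) (fun _ => Iff.rfl) ?_ ?_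
        · simp [IntervalTree.nodeSets, hJ']
        · exact Nat.mul_le_mul_right _ (le_max_left _ _)
        · gcongr; exact le_max_left _ _
    refine WP.loop_step (by norm_num) (by omega) ?_
    refine WP.seq (WP.asg hw2 hM (by norm_num) (v := if m ≤ (q 2 : Coord) then 1 else 0)
      ⟨_, ⟨r, ⟨by norm_num, by simp [h50]⟩, 0, ⟨rfl, lit_lt_two_pow hw (by norm_num)⟩,
        _, hmed, rfl⟩, 2, ⟨rfl, lit_lt_two_pow hw (by norm_num)⟩, (cmpNat_lt_two _ _).symm⟩ ?_)
    refine WP.seq (WP.asg hw2 hM (by norm_num) (v := dz.toNat)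
      ⟨_, ⟨by norm_num, rfl⟩, 0, ⟨rfl, lit_lt_two_pow hw (by norm_num)⟩, ?_⟩ ?_)
    · change _ = if _ = _ then 1 else 0
      by_cases h : m ≤ (q 2 : Coord) <;> simp [hdz, h]
    have hlit : 99 < 2 ^ w := lit_lt_two_pow hw (by norm_num)
    refine WP.seq (WP.asg hw2 hM (by norm_num) (val_ld_reg_lit hw (by norm_num) (by norm_num)
      (by simpa using h50) hs) ?_)
    refine WP.seq (WP.asg hw2 hM (by norm_num) (v := r')
      ⟨r, ⟨by norm_num, by simp [h50]⟩, 1 + (if m ≤ (q 2 : Coord) then 1 else 0),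
        ⟨1, ⟨rfl, lit_lt_two_pow hw (by norm_num)⟩, if m ≤ (q 2 : Coord) then 1 else 0,
          ⟨by norm_num, by simp⟩, ?_⟩, hr'⟩ ?_)
    · refine (Nat.mod_eq_of_lt ?_).symm
      split <;> omega
    refine WP.trav_seq (wp_midQuery (Ls := Ls) (dz := dz) (Λ := Λ) hw hM hT hB hn hK hlam hact
      hΛ _ J _ _ _ (isIntervalTree_intervalTree hlt J) hmid
      (fun J' hJ' dy => hLs J (by simp [IntervalTree.nodeSets]) J' hJ' dz dy)
      (by simp) (by simp) (by simpa using hacc)) ?_ (by norm_num) ?_ ?_ ?_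
      (N₂ := max t₁.depth t₂.depth * (D * ((Λ + 1) * (lam * (ℓ + 1)))))
      (T₂ := max t₁.depth t₂.depth * (D * (440 * ((Λ + 1) * (lam * (ℓ + 1)))) + 50) + 1)
      (S₂ := fun i => i ∈ S' ∧ x i ≤ (q 0 : Coord) ∧
        (ylo i ≤ (q 1 : Coord) ∧ (q 1 : Coord) < yhi i) ∧
        (zlo i ≤ (q 2 : Coord) ∧ (q 2 : Coord) < zhi i)) ?_ ?_
    · intro σ₁ L hacc₁ hf
      refine sub σ₁ L ?_ hacc₁
      rw [hf 50 (by norm_num) (by norm_num)]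
      simp
    · intro k hk hk'
      simp (disch := omega) [AState.upd_env, if_neg]
    · rintro i ⟨h1, -⟩ ⟨h2, -⟩
      have h3 := ((hJ i).1 h1).2
      by_cases h : m ≤ (q 2 : Coord)
      · simp only [h, if_true] at hS'
        subst hS'
        exact h3.1.not_gt ((hS₂ i).1 h2).2
      · simp only [h, if_false] at hS'
        subst hS'
        exact h3.2.not_ge ((hS₁ i).1 h2).2
    · intro i
      by_cases hiJ : i ∈ J
      · have h3 := (hJ i).1 hiJ
        have h4 := interval_mem_iff (r := q 2) h3.2
        rw [h4]
        have h5 : i ∉ S' := by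
          intro h2
          by_cases h : m ≤ (q 2 : Coord)
          · simp only [h, if_true] at hS'
            subst hS'
            exact h3.2.1.not_gt ((hS₂ i).1 h2).2
          · simp only [h, if_false] at hS'
            subst hS'
            exact h3.2.2.not_ge ((hS₁ i).1 h2).2
        simp only [hiJ, h5, h3.1, true_and, false_and, or_false]
        rfl
      · simp only [hiJ, false_and, false_or]
        have h5 : (zlo i ≤ (q 2 : Coord) ∧ (q 2 : Coord) < zhi i) → (i ∈ S ↔ i ∈ S') := by
          rintro ⟨h6, h7⟩
          by_cases h : m ≤ (q 2 : Coord)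
          · simp only [h, if_true] at hS'
            subst hS'
            rw [hS₂]
            refine ⟨fun h8 => ⟨h8, ?_⟩, fun h8 => h8.1⟩
            by_contra h9
            exact hiJ ((hJ i).2 ⟨h8, not_lt.1 h9, h.trans_lt h7⟩)
          · simp only [h, if_false] at hS'
            subst hS'
            rw [hS₁]
            refine ⟨fun h8 => ⟨h8, ?_⟩, fun h8 => h8.1⟩
            by_contra h9
            exact hiJ ((hJ i).2 ⟨h8, h6.trans (not_le.1 h).le, not_le.1 h9⟩)
        tauto
    · simp only [IntervalTree.depth]
      rw [add_mul (max _ _), one_mul, add_comm]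
      gcongr
      exact hD J
    · simp only [IntervalTree.depth]
      rw [add_mul (max _ _), one_mul]
      have hDJ := Nat.mul_le_mul_right (440 * ((Λ + 1) * (lam * (ℓ + 1)))) (hD J)
      generalize max t₁.depth t₂.depth * (D * (440 * ((Λ + 1) * (lam * (ℓ + 1)))) + 50) = U
      generalize D * (440 * ((Λ + 1) * (lam * (ℓ + 1)))) = Y at *
      generalize (intervalTree ylo yhi J).depth * (440 * ((Λ + 1) * (lam * (ℓ + 1)))) = Z at *
      simp [RExpr.cost]
      omega

end layers

/-! ### The three programs -/

/-- Find an entry of a list. -/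
def pointProg : Prog := decode ;; .emit 2

/-- Run a traversal of the whole structure. -/
def stabQuery (act : Prog) : Prog :=
  asg 50 (.ld (.lit 1) (.lit 0)) ;; topQuery act

/-- Add the length of a prefix. -/
def countAct : Prog := asg 99 (.op .add (.reg 99) (.reg 9))

/-- Output the entries of a prefix. -/
def reportAct : Prog :=
  asg 10 (.reg 9) ;;
  .loop 10 (
    asg 0 (.reg 8) ;;
    asg 1 (.op .sub (.reg 9) (.reg 10)) ;;
    decode ;;
    .emit 2 ;;
    asg 10 (.op .sub (.reg 10) (.lit 1)))

def countProg : Prog := stabQuery countAct ;; .emit 99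

def reportProg : Prog := stabQuery reportAct

section programs
variable {w n : ℕ} {M : List (Cell w)} {q : Fin 3 → ℝ}

/-- The counter is described modulo `2 ^ w`; it becomes exact at the end, when the total is known to
be at most `n`. -/
theorem isAction_count (hw : 8 ≤ w) (hM : M.length ≤ 2 ^ w) {T : ℕ} :
    IsAction (n := n) M q T 10 0 countAct
      (fun v out L => out = [] ∧ v = L.flatten.length % 2 ^ w) := by
  rintro σ L h P i - - hi h8 h9 ⟨ho, hv⟩
  refine WP.asg (by omega) hM (by norm_num) (v := (L.flatten.length + i) % 2 ^ w)
    ⟨_, ⟨by norm_num, rfl⟩, i, ⟨by norm_num, by simp [h9]⟩, ?_⟩ ?_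
  · change _ = _ % _
    rw [hv, Nat.mod_add_mod]
  · refine ⟨fun r hr hr' => by simp [AState.upd_env, hr'], ⟨by simp [ho], ?_⟩, by simp [RExpr.cost]⟩
    simp [Nat.min_eq_left hi]

/-- Every entry of the prefix is decoded afresh from the node, which costs `T` per entry, in the
order of the list. -/
theorem isAction_report (hw : 8 ≤ w) (hM : M.length ≤ 2 ^ w) {T : ℕ} :
    IsAction (n := n) M q T 10 (T + 30) reportAct
      (fun _ out L => out = L.flatten.map fun i : Fin n => (i : ℕ)) := by
  rintro σ L h P i hP - hi h8 h9 ho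
  have hw2 : 2 ≤ w := by omega
  refine WP.seq (WP.asg hw2 hM (by norm_num) (v := i) ⟨by norm_num, by simp [h9]⟩ ?_)
  have key : ∀ (m k : ℕ) (τ : AState), k + m = i → τ.env 10 = m → τ.env 8 = h → τ.env 9 = i →
      τ.out = (L ++ [P.take k]).flatten.map (fun i : Fin n => (i : ℕ)) →
      WP M q (.loop 10 (
        asg 0 (.reg 8) ;;
        asg 1 (.op .sub (.reg 9) (.reg 10)) ;;
        decode ;;
        .emit 2 ;;
        asg 10 (.op .sub (.reg 10) (.lit 1)))) τ fun σ' =>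
        (∀ r, 12 ≤ r → σ'.env r = τ.env r) ∧
        σ'.out = (L ++ [P.take i]).flatten.map (fun i : Fin n => (i : ℕ)) ∧
        σ'.time ≤ τ.time + 1 + (T + 30) * m := by
    intro m
    induction m with
    | zero =>
      intro k τ hk h10 _ _ hout
      refine WP.loop_done (by norm_num) h10 ⟨fun _ _ => rfl, ?_, by simp⟩
      rw [AState.tick_out, hout, ← hk, add_zero]
    | succ m ih =>
      intro k τ hk h10 h8 h9 hout
      refine WP.loop_step (by norm_num) (by omega) ?_
      refine WP.seq (WP.asg hw2 hM (by norm_num) (v := h) ⟨by norm_num, by simp [h8]⟩ ?_)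
      refine WP.seq (WP.asg hw2 hM (by norm_num) (v := k)
        ⟨i, ⟨by norm_num, by simp [h9]⟩, m + 1, ⟨by norm_num, by simp [h10]⟩, ?_⟩ ?_)
      · change _ = _ - _ ∧ _ ≤ _
        omega
      have hkP : k < P.length := by omega
      refine WP.seq ((hP q k P[k] _ (List.getElem?_eq_getElem hkP) (by simp) (by simp)).mono ?_)
      rintro σ₁ ⟨f1, o1, e1, t1⟩
      refine WP.seq (WP.emit (by norm_num) ?_)
      refine WP.asg hw2 hM (by norm_num) (v := m)
        ⟨m + 1, ⟨by norm_num, by simp [f1, h10]⟩, 1,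
          ⟨rfl, lit_lt_two_pow hw (by norm_num)⟩, ?_⟩ ?_
      · change _ = _ - _ ∧ _ ≤ _
        omega
      refine (ih (k + 1) _ (by omega) (by simp) (by simp [f1, h8]) (by simp [f1, h9]) ?_).mono ?_
      · have h1 : P.take (k + 1) = P.take k ++ [P[k]] := (List.take_append_getElem hkP).symm
        rw [h1]
        simp [o1, e1, hout, -List.take_append_getElem]
      · rintro σ' ⟨g1, g2, g3⟩
        refine ⟨fun r hr => ?_, g2, ?_⟩
        · rw [g1 r hr]
          simp (disch := omega) only [AState.upd_env, if_neg]
          rw [f1 r (by omega)]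
          simp (disch := omega) [AState.upd_env, if_neg]
        · simp [RExpr.cost] at t1 g3
          rw [mul_add]
          omega
  refine (key i 0 _ (by omega) (by simp) (by simp [h8]) (by simp [h9]) (by simp [ho])).mono ?_
  rintro σ' ⟨g1, g2, g3⟩
  refine ⟨fun r hr _ => ?_, g2, ?_⟩
  · rw [g1 r hr]
    simp (disch := omega) [AState.upd_env, if_neg]
  · simp [RExpr.cost] at g3
    omega

end programs

/-! ### The structure for a family of boxes -/

section boxes
variable {w n : ℕ} {M : List (Cell w)} {q : Fin 3 → ℝ} {b B lam K ℓ Λ D : ℕ}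

/-- The memory holds the stabbing structure of the boxes. -/
structure HoldsBoxes (M : List (Cell w)) (b B lam ℓ : ℕ) (Bx : Fin n → CanonicalBox) : Prop where
  table : HasTable M b
  top : ∃ r, wordAt M (1 + 0) = some r ∧ TopAt M b B lam ℓ (fun i => ((Bx i).x₁ : Coord))
    (fun i => ((Bx i).y₁ : Coord)) (fun i => (Bx i).y₂) (fun i => ((Bx i).z₁ : Coord))
    (fun i => (Bx i).z₂) (intervalTree (fun i => ((Bx i).z₁ : Coord)) (fun i => (Bx i).z₂)
      Finset.univ) r

variable {Bx : Fin n → CanonicalBox}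

theorem wp_stabQuery (hw : 8 ≤ w) (hM : M.length ≤ 2 ^ w) (hB : 2 ≤ B)
    (hn : n < 2 ^ w) (hK : ℓ < B ^ K) (hlam : 2 ≤ lam) {a c : ℕ} {act : Prog}
    {Acc : ℕ → List ℕ → List (List (Fin n)) → Prop}
    (hact : IsAction M q (101 * (K * B) + 20) a c act Acc)
    (hΛ : Nat.clog lam n ≤ Λ) (hD : 2 * Nat.size n ≤ D) (hS : HoldsBoxes M b B lam ℓ Bx)
    {σ : AState} (hacc : Acc (σ.env 99) σ.out []) :
    WP M q (stabQuery act) σ (Traversed (bottomLists lam Bx) a c Acc 52 σ []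
      (fun i => (Bx i).Contains q) (D * (D * ((Λ + 1) * (lam * (ℓ + 1)))))
      (D * (D * (440 * ((Λ + 1) * (lam * (ℓ + 1)))) + 50) + 20)) := by
  classical
  obtain ⟨hT, r, hr, htop⟩ := hS
  have hcard : ∀ I : Finset (Fin n), 2 * Nat.size I.card ≤ D := fun I =>
    (Nat.mul_le_mul_left _ (Nat.size_le_size (by simpa using I.card_le_univ))).trans hD
  have hDy : ∀ I : Finset (Fin n), (intervalTree (fun i => ((Bx i).y₁ : Coord))
      (fun i => (Bx i).y₂) I).depth ≤ D := fun I =>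
    (depth_intervalTree_le (fun i => (Bx i).y_lt) I).trans (hcard I)
  have hDz : (intervalTree (fun i => ((Bx i).z₁ : Coord))
      (fun i => (Bx i).z₂) Finset.univ).depth ≤ D :=
    (depth_intervalTree_le (fun i => (Bx i).z_lt) _).trans (hcard _)
  refine WP.seq (WP.asg (by omega) hM (by norm_num) (v := r)
    ⟨1, ⟨rfl, lit_lt_two_pow hw (by norm_num)⟩, 0, ⟨rfl, lit_lt_two_pow hw (by norm_num)⟩, hr⟩ ?_)
  refine (wp_topQuery hw hM hT hB hn hK hlam hact hΛ (fun i => (Bx i).y_lt) hDy _ Finset.univ r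
    _ [] (isIntervalTree_intervalTree (fun i => (Bx i).z_lt) _) htop ?_ (by simp)
    (by simpa using hacc)).mono fun σ' h' => h'.weaken le_rfl ?_ ?_ ?_ ?_
  · intro I hI J hJ dz dy P hP
    refine mem_bottomLists.2 ⟨I, hI, J, hJ, dz, dy, ?_⟩
    cases dz <;> cases dy <;> simpa using hP
  · intro k hk hk'
    simp (disch := omega) [AState.upd_env, if_neg]
  · intro i
    simp [CanonicalBox.Contains]
  · exact Nat.mul_le_mul_right _ hDz
  · have := Nat.mul_le_mul_right (D * (440 * ((Λ + 1) * (lam * (ℓ + 1)))) + 50) hDz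
    generalize D * (D * (440 * ((Λ + 1) * (lam * (ℓ + 1)))) + 50) = U at *
    simp [RExpr.cost]
    omega

theorem stabCount_eq_length {L : List (Fin n)} (hL : L.Nodup)
    (h : ∀ i, i ∈ L ↔ (Bx i).Contains q) : stabCount Bx q = L.length := by
  classical
  rw [stabCount, ← List.toFinset_card_of_nodup hL]
  congr 1
  ext i
  simp [h]

theorem outputs_count (hw : 8 ≤ w) (hM : M.length ≤ 2 ^ w) (hB : 2 ≤ B)
    (hn : n < 2 ^ w) (hK : ℓ < B ^ K) (hlam : 2 ≤ lam)
    (hΛ : Nat.clog lam n ≤ Λ) (hD : 2 * Nat.size n ≤ D) (hS : HoldsBoxes M b B lam ℓ Bx) :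
    Outputs M q countProg [] ((D * (D * (440 * ((Λ + 1) * (lam * (ℓ + 1)))) + 50) + 30 +
      10 * (D * (D * ((Λ + 1) * (lam * (ℓ + 1))))) : ℕ) : ℝ) [stabCount Bx q] := by
  refine WP.outputs (WP.seq ((wp_stabQuery hw hM hB hn hK hlam
    (isAction_count hw hM) hΛ hD hS (by simp)).mono ?_))
  rintro σ ⟨-, L, hL, ⟨ho, hv⟩, ht⟩
  refine WP.emit (by norm_num) ⟨?_, ?_⟩
  · have := Nat.mul_le_mul_left 10 hL.len
    generalize D * (D * (440 * ((Λ + 1) * (lam * (ℓ + 1)))) + 50) = U at *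
    simp only [zero_add, zero_mul, add_zero] at ht ⊢
    omega
  · rw [List.nil_append] at hv
    -- The collected boxes are distinct, so their number is at most `n < 2 ^ w` and the counter has
    -- not wrapped around.
    rw [ho, hv, stabCount_eq_length hL.nodup hL.mem, List.nil_append, Nat.mod_eq_of_lt]
    have := hL.nodup.length_le_card
    rw [Fintype.card_fin] at this
    omega

theorem outputs_report (hw : 8 ≤ w) (hM : M.length ≤ 2 ^ w) (hB : 2 ≤ B)
    (hn : n < 2 ^ w) (hK : ℓ < B ^ K) (hlam : 2 ≤ lam)
    (hΛ : Nat.clog lam n ≤ Λ) (hD : 2 * Nat.size n ≤ D) (hS : HoldsBoxes M b B lam ℓ Bx) :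
    ∃ L, Collects (bottomLists lam Bx) (fun i => (Bx i).Contains q)
      (D * (D * ((Λ + 1) * (lam * (ℓ + 1))))) L ∧
    Outputs M q reportProg [] ((D * (D * (440 * ((Λ + 1) * (lam * (ℓ + 1)))) + 50) + 20 +
      10 * (D * (D * ((Λ + 1) * (lam * (ℓ + 1))))) +
      (101 * (K * B) + 50) * stabCount Bx q : ℕ) : ℝ) (L.flatten.map fun i : Fin n => (i : ℕ)) := by
  -- The list of prefixes only appears in the postcondition, so the triple is applied to the initial
  -- state directly and not through `WP.outputs`, which needs the result in advance.
  obtain ⟨t, s', σ', h1, h2, h3, -, L, hL, ho, ht⟩ := wp_stabQuery (q := q) hw hM hB hn hK hlam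
    (isAction_report hw hM) hΛ hD hS (σ := ⟨fun r => (([] : List (BitVec w)).getD r 0).toNat, [], 0⟩)
    (by simp) ⟨fun r => ([] : List (BitVec w)).getD r 0, []⟩ ⟨fun _ _ => rfl, rfl⟩
  refine ⟨L, hL, t, s', h1, ?_, h2.2.trans (by simpa using ho)⟩
  have := Nat.mul_le_mul_left 10 hL.len
  rw [stabCount_eq_length hL.nodup hL.mem]
  simp only [zero_add] at h3 ht
  rw [show 101 * (K * B) + 20 + 30 = 101 * (K * B) + 50 by ring] at ht
  exact_mod_cast (by omega : t ≤ _)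

/-! ### Handles for all bottom lists -/

theorem TreeAt.addr_lt {x y : Fin n → Coord} {W : List (Fin n)} {H : ℕ} {addr : ℕ → ℕ → ℕ}
    (hA : TreeAt M b x y W B H addr) (hM : M.length ≤ 2 ^ w) {h t : ℕ} (hh : h ≤ H)
    (ht : t * 2 ^ h < W.length) : addr h t < 2 ^ w := by
  cases h with
  | zero =>
    have := wordAt_addr_lt (hA.leaf t (by simpa using ht)).flag
    omega
  | succ j =>
    obtain ⟨jp, bits, ones, hN, -⟩ := hA.inner j hh t ht
    have := wordAt_addr_lt hN.flag
    omega

theorem exists_handle_dominance (hw : 8 ≤ w) (hM : M.length ≤ 2 ^ w) (hT : HasTable M b)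
    (hB : 2 ≤ B) (hn : n < 2 ^ w) (hK : ℓ < B ^ K) (hlam : 1 ≤ lam)
    {x y z : Fin n → Coord} {pre : Bool} {J : Finset (Fin n)}
    {r : ℕ} (hS : HoldsSpatial M b B lam x y z pre J ℓ r) {P : List (Fin n)}
    (hP : P ∈ dominanceLists lam x y z J) :
    P.length ≤ n ∧ ∃ a < 2 ^ w, Handle M (101 * (K * B) + 20) a P := by
  obtain ⟨A, m, starts, counts, ptr, rec, hS⟩ := hS
  obtain ⟨j, t, hj, ht, hP⟩ := (mem_dominanceLists hlam).1 hP
  obtain ⟨-, A, m, addr, hpl⟩ := hS.recs j hj t ht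
  obtain ⟨h, s, hh, hs, rfl⟩ := mem_planarLists.1 hP
  rw [← length_sortByKey y] at hs
  refine ⟨?_, _, hpl.tree.addr_lt hM hh hs, hpl.tree.handle hw hM hT hB hn (nodup_sortByKey y _)
    (hpl.height.trans_lt hK) hh hs⟩
  have h1 : ∀ S, (sortByKey x S).length ≤ n := fun S => by
    have := (nodup_sortByKey x S).length_le_card
    rwa [Fintype.card_fin] at this
  exact h1 _

theorem MidAt.holdsSpatial {x ylo yhi zlo zhi : Fin n → Coord} {tree : IntervalTree (Fin n)}
    {J : Finset (Fin n)} (hJ : J ∈ tree.nodeSets) (dz dy : Bool) :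
    ∀ r, MidAt M b B lam ℓ x ylo yhi zlo zhi tree r →
      ∃ s, HoldsSpatial M b B lam x (if dy then ylo else yhi) (if dz then zlo else zhi) dz J ℓ s := by
  induction tree with
  | nil => simp [IntervalTree.nodeSets] at hJ
  | node m J' t₁ t₂ ih₁ ih₂ =>
    rintro r ⟨-, -, ⟨r₁, -, h₁⟩, ⟨r₂, -, h₂⟩, h⟩
    simp only [IntervalTree.nodeSets, List.mem_cons, List.mem_append] at hJ
    rcases hJ with rfl | hJ | hJ
    · obtain ⟨s, -, hs⟩ := h dz dy
      exact ⟨s, hs⟩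
    · exact ih₁ hJ _ h₁
    · exact ih₂ hJ _ h₂

theorem TopAt.midAt {x ylo yhi zlo zhi : Fin n → Coord} {tree : IntervalTree (Fin n)}
    {I : Finset (Fin n)} (hI : I ∈ tree.nodeSets) :
    ∀ r, TopAt M b B lam ℓ x ylo yhi zlo zhi tree r →
      ∃ s, MidAt M b B lam ℓ x ylo yhi zlo zhi (intervalTree ylo yhi I) s := by
  induction tree with
  | nil => simp [IntervalTree.nodeSets] at hI
  | node m I' t₁ t₂ ih₁ ih₂ =>
    rintro r ⟨-, -, ⟨r₁, -, h₁⟩, ⟨r₂, -, h₂⟩, s, -, h⟩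
    simp only [IntervalTree.nodeSets, List.mem_cons, List.mem_append] at hI
    rcases hI with rfl | hI | hI
    · exact ⟨s, h⟩
    · exact ih₁ hI _ h₁
    · exact ih₂ hI _ h₂

theorem holdsLists_of_holdsBoxes (hw : 8 ≤ w) (hM : M.length ≤ 2 ^ w) (hB : 2 ≤ B)
    (hn : n < 2 ^ w) (hK : ℓ < B ^ K) (hlam : 1 ≤ lam) (hS : HoldsBoxes M b B lam ℓ Bx) :
    HoldsLists M pointProg ((101 * (K * B) + 21 : ℕ) : ℝ) (bottomLists lam Bx) := by
  intro P hP
  obtain ⟨I, hI, J, hJ, dz, dy, hP⟩ := mem_bottomLists.1 hP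
  obtain ⟨hT, r, -, htop⟩ := hS
  obtain ⟨s, hs⟩ := htop.midAt hI
  obtain ⟨s', hs'⟩ := hs.holdsSpatial hJ dz dy
  obtain ⟨hlen, a, ha, hH⟩ := exists_handle_dominance hw hM hT hB hn hK hlam hs' (P := P)
    (by cases dz <;> cases dy <;> simpa using hP)
  refine ⟨BitVec.ofNat w a, fun i hi q => WP.outputs (WP.seq ((hH q i P[i] _
    (List.getElem?_eq_getElem hi) ?_ ?_).mono ?_))⟩
  · simp [Nat.mod_eq_of_lt ha]
  · simp [Nat.mod_eq_of_lt (by omega : i < 2 ^ w)]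
  · rintro σ ⟨-, h2, h3, h4⟩
    refine WP.emit (by norm_num) ⟨?_, ?_⟩
    · simp at h4 ⊢
      omega
    · simp [h2, h3]

end boxes

/-! ### Laying out memory -/

/-- All cells of `M` other than cell `1` are cells of `M'`. -/
def MemExt {w : ℕ} (M M' : List (Cell w)) : Prop := ∀ a c, a ≠ 1 → M[a]? = some c → M'[a]? = some c

theorem MemExt.refl {w : ℕ} (M : List (Cell w)) : MemExt M M := fun _ _ _ h => h

theorem MemExt.trans {w : ℕ} {M M' M'' : List (Cell w)} (h : MemExt M M') (h' : MemExt M' M'') :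
    MemExt M M'' := fun a c ha hc => h' a c ha (h a c ha hc)

/-- Any memory can be extended by at most `c` cells, within a total of `N` cells, such that for some
value (an address, say) the property `P` holds and remains true when more cells are added. -/
def Alloc {w : ℕ} {α : Type} (N c : ℕ) (P : α → List (Cell w) → Prop) : Prop :=
  ∀ M : List (Cell w), 2 ≤ M.length → M.length + c ≤ N → ∃ (M' : List (Cell w)) (v : α),
    MemExt M M' ∧ M.length ≤ M'.length ∧ M'.length ≤ M.length + c ∧ ∀ M'', MemExt M' M'' → P v M''

section alloc
variable {w : ℕ} {α β : Type} {N c c₁ c₂ : ℕ}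

theorem Alloc.pure {P : α → List (Cell w) → Prop} (v : α) (h : ∀ M, P v M) : Alloc N c P :=
  fun M _ _ => ⟨M, v, MemExt.refl M, le_rfl, Nat.le_add_right _ _, fun M'' _ => h M''⟩

/-- The second allocation may use facts about `v` that do not depend on the memory, such as a bound
for an address; for these a memory satisfying `P₁ v` suffices. The property `P₁ v` itself survives
because it is stable under extension. -/
theorem Alloc.bind {P₁ : α → List (Cell w) → Prop} {P₂ : β → List (Cell w) → Prop}
    (h₁ : Alloc N c₁ P₁)
    (h₂ : ∀ v, (∃ M, P₁ v M) → Alloc N c₂ (fun u M => P₁ v M → P₂ u M)) (hc : c₁ + c₂ ≤ c) :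
    Alloc N c P₂ := by
  intro M h2 hN
  obtain ⟨M₁, v, e₁, l₁, l₁', p₁⟩ := h₁ M h2 (by omega)
  obtain ⟨M₂, u, e₂, l₂, l₂', p₂⟩ := h₂ v ⟨M₁, p₁ M₁ (MemExt.refl _)⟩ M₁ (by omega) (by omega)
  exact ⟨M₂, u, e₁.trans e₂, by omega, by omega, fun M'' h => p₂ M'' h (p₁ M'' (e₂.trans h))⟩

theorem Alloc.mono {P : α → List (Cell w) → Prop} {P' : β → List (Cell w) → Prop}
    (h : Alloc N c₁ P) (f : α → β) (hP : ∀ v M, P v M → P' (f v) M) (hc : c₁ ≤ c) :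
    Alloc N c P' :=
  h.bind (c₂ := 0) (fun v _ => Alloc.pure (f v) fun M hM => hP v M hM) (by omega)

theorem Alloc.family [Inhabited α] {P : ℕ → α → List (Cell w) → Prop} {f : ℕ → ℕ} :
    ∀ m, (∀ k < m, Alloc N (f k) (P k)) →
      Alloc N (∑ k ∈ Finset.range m, f k) (fun (v : ℕ → α) M => ∀ k < m, P k (v k) M) := by
  intro m
  induction m with
  | zero => exact fun _ => Alloc.pure (fun _ => default) fun M k hk => absurd hk (by omega)
  | succ m ih =>
    intro h
    refine (ih fun k hk => h k (by omega)).bind (fun v _ => (h m (by omega)).mono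
      (fun u k => if k < m then v k else u) ?_ le_rfl) (by rw [Finset.sum_range_succ])
    intro u M hu hv k hk
    by_cases hkm : k < m
    · simpa [hkm] using hv k hkm
    · obtain rfl : k = m := by omega
      simpa using hu

theorem Alloc.bool {P : Bool → α → List (Cell w) → Prop} (h : ∀ d, Alloc N c (P d)) :
    Alloc N (2 * c) (fun (v : Bool → α) M => ∀ d, P d (v d) M) := by
  refine (h false).bind (fun v _ => (h true).mono (fun u d => if d then u else v) ?_ le_rfl)
    (by omega)
  intro u M hu hv d
  cases d
  · simpa using hv
  · simpa using hu

/-- New cells are appended at the end. As the memory has at least two cells before, no allocated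
address is `0`, which can therefore serve as the null pointer. -/
theorem Alloc.cells (cs : List (Cell w)) : Alloc N cs.length (fun (a : ℕ) M =>
    0 < a ∧ a + cs.length ≤ N ∧ ∀ k < cs.length, M[a + k]? = cs[k]?) := by
  intro M h2 hN
  refine ⟨M ++ cs, M.length, ?_, by simp, by simp, ?_⟩
  · intro a c _ h
    rw [List.getElem?_append_left (List.getElem?_eq_some_iff.1 h).1, h]
  · intro M'' hM
    refine ⟨by omega, hN, fun k hk => ?_⟩
    rw [List.getElem?_eq_getElem hk]
    refine hM _ _ (by omega) ?_
    rw [List.getElem?_append_right (by omega), Nat.add_sub_cancel_left, List.getElem?_eq_getElem hk]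

theorem wordAt_of_getElem? {M : List (Cell w)} {a v : ℕ} (hv : v < 2 ^ w)
    (h : M[a]? = some (.word (BitVec.ofNat w v))) : wordAt M a = some v := by
  simp [wordAt, h, Nat.mod_eq_of_lt hv]

theorem coordAt_of_getElem? {M : List (Cell w)} {a : ℕ} {v : Coord}
    (h : M[a]? = some (.coord v)) : coordAt M a = some v := by
  simp [coordAt, h]

theorem Alloc.words (len : ℕ) (f : ℕ → ℕ) (hf : ∀ k < len, f k < 2 ^ w) :
    Alloc N len (fun (a : ℕ) (M : List (Cell w)) =>
      0 < a ∧ a + len ≤ N ∧ WordArray M a len f) := by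
  refine (Alloc.cells ((List.range len).map fun k => .word (BitVec.ofNat w (f k)))).mono id ?_
    (by simp)
  rintro a M ⟨h1, h2, h3⟩
  simp only [List.length_map, List.length_range] at h2 h3
  refine ⟨h1, h2, fun k hk => wordAt_of_getElem? (hf k hk) ?_⟩
  rw [id, h3 k hk]
  simp [hk]

theorem Alloc.coords (len : ℕ) (f : ℕ → Coord) :
    Alloc N len (fun (a : ℕ) (M : List (Cell w)) =>
      0 < a ∧ a + len ≤ N ∧ CoordArray M a len f) := by
  refine (Alloc.cells ((List.range len).map fun k => .coord (f k))).mono id ?_ (by simp)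
  rintro a M ⟨h1, h2, h3⟩
  simp only [List.length_map, List.length_range] at h2 h3
  refine ⟨h1, h2, fun k hk => coordAt_of_getElem? ?_⟩
  rw [id, h3 k hk]
  simp [hk]

end alloc

/-- The cell that holds the word `v`. -/
def Cell.ofNat (w v : ℕ) : Cell w := .word (BitVec.ofNat w v)

/-! ### Laying out binary range trees -/

section tree
variable {w n : ℕ} {N b : ℕ} {x y : Fin n → Coord} {W : List (Fin n)}

theorem cntSym_lt (hn : n < 2 ^ w) (j d t c i : ℕ) : cntSym x W j d t c i < 2 ^ w := by
  refine lt_of_le_of_lt ?_ hn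
  have h1 : (nodeList x W (j + d) t).length ≤ n := by
    have := (nodup_sortByKey x (W.block (2 ^ (j + d)) t).toFinset).length_le_card
    rwa [Fintype.card_fin] at this
  refine List.countP_le_length.trans ?_
  rw [List.length_take]
  exact (min_le_right _ _).trans h1

theorem alloc_leaf (hn : n < 2 ^ w) {t : ℕ} (ht : t < W.length) :
    Alloc N 7 (fun (a : ℕ) (M : List (Cell w)) => a ≤ N ∧ LeafAt M y W t a) := by
  refine (Alloc.cells [.ofNat w 0, .ofNat w (W[t] : ℕ), .ofNat w 0, .ofNat w 0, .ofNat w 0,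
    .ofNat w 0, .coord (y W[t])]).mono id ?_ (by simp)
  rintro a M ⟨-, h2, h3⟩
  refine ⟨by simp at h2 ⊢; omega, ⟨?_, ?_, ?_⟩⟩
  · exact wordAt_of_getElem? (by positivity) (h3 0 (by norm_num))
  · intro i hi
    rw [List.getElem?_eq_getElem ht] at hi
    obtain rfl := Option.some.inj hi
    exact wordAt_of_getElem? ((W[t].isLt).trans hn) (h3 1 (by norm_num))
  · intro i hi
    rw [List.getElem?_eq_getElem ht] at hi
    obtain rfl := Option.some.inj hi
    exact coordAt_of_getElem? (h3 6 (by norm_num))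

/-- The size of a jump record. -/
def jumpCost (b j d e : ℕ) : ℕ :=
  7 + (2 ^ (j + d) / e + 1) + 2 ^ d + (2 ^ (j + d) / (2 ^ d * b) + 1) * 2 ^ d

theorem alloc_jump (hN : N < 2 ^ w) (hn : n < 2 ^ w) (hb : 1 ≤ b) {addr : ℕ → ℕ → ℕ}
    (haddr : ∀ j t, addr j t ≤ N) {j d t e g : ℕ} (epos : 1 ≤ e) (gpos : 1 ≤ g)
    (egw : e * g < w) (bg : 2 ^ (2 * d) * b ≤ 2 ^ g) :
    Alloc N (jumpCost b j d e) (fun (jp : ℕ) (M : List (Cell w)) => jp ≠ 0 ∧ jp ≤ N ∧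
      ∃ fields child cnt, JumpAt M b x W addr j d t jp e g fields child cnt) := by
  have hs := length_nodeList_le (x := x) (W := W) (j + d) t
  have hgw : g < w := (Nat.le_mul_of_pos_left g (by omega)).trans_lt egw
  have hww : w < 2 ^ w := Nat.lt_two_pow_self
  have hew : e < 2 ^ w := ((Nat.le_mul_of_pos_right e gpos).trans_lt egw).trans hww
  have h2g : 2 ^ g < 2 ^ w := Nat.pow_lt_pow_right (by norm_num) hgw
  have h2d : 2 ^ d * b < 2 ^ w := by
    refine lt_of_le_of_lt (le_trans ?_ bg) h2g
    exact Nat.mul_le_mul_right _ (Nat.pow_le_pow_right (by norm_num) (by omega))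
  have h2d' : 2 ^ d < 2 ^ w := (Nat.le_mul_of_pos_right _ hb).trans_lt h2d
  refine (Alloc.words ((nodeList x W (j + d) t).length / e + 1)
    (fun k => packDigits (2 ^ g) e fun r => jumpField x W j d t (2 ^ d * b) (k * e + r))
    (fun k _ => ?_)).bind (fun fields hf => ?_) (c₂ := 2 ^ d +
      ((2 ^ (j + d) / (2 ^ d * b) + 1) * 2 ^ d + 7)) ?_
  · refine (packDigits_lt (fun r => (jumpField_lt j d t _ hb).trans_le bg) e).trans ?_
    rw [← pow_mul, mul_comm]
    exact Nat.pow_lt_pow_right (by norm_num) egw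
  refine (Alloc.words (2 ^ d) (fun c => addr j (t * 2 ^ d + c))
    (fun k _ => (haddr _ _).trans_lt hN)).bind (fun child hc => ?_) le_rfl
  refine (Alloc.words (((nodeList x W (j + d) t).length / (2 ^ d * b) + 1) * 2 ^ d)
    (fun k => cntSym x W j d t (k % 2 ^ d) (k / 2 ^ d * (2 ^ d * b)))
    (fun k _ => cntSym_lt hn _ _ _ _ _)).bind (fun cnt hct => ?_) (c₂ := 7) ?_
  · refine (Alloc.cells [.ofNat w (2 ^ d * b), .ofNat w e, .ofNat w g, .ofNat w (2 ^ d),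
      .ofNat w fields, .ofNat w child, .ofNat w cnt]).mono id ?_ (by simp)
    rintro jp M ⟨h1, h2, h3⟩ ⟨-, c2, c3⟩ ⟨-, b2, b3⟩ ⟨-, a2, a3⟩
    simp only [List.length_cons, List.length_nil, id] at h2 a2 b2 c2 ⊢
    refine ⟨by omega, by omega, fields, child, cnt, epos, egw, bg, ?_, ?_, ?_,
      ?_, ?_, ?_, ?_, a3, b3, c3⟩
    · exact wordAt_of_getElem? h2d (h3 0 (by norm_num))
    · exact wordAt_of_getElem? hew (h3 1 (by norm_num))
    · exact wordAt_of_getElem? (hgw.trans hww) (h3 2 (by norm_num))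
    · exact wordAt_of_getElem? h2d' (h3 3 (by norm_num))
    · exact wordAt_of_getElem? (lt_of_le_of_lt (le_trans (Nat.le_add_right _ _) a2) hN) (h3 4 (by norm_num))
    · exact wordAt_of_getElem? (lt_of_le_of_lt (le_trans (Nat.le_add_right _ _) b2) hN) (h3 5 (by norm_num))
    · exact wordAt_of_getElem? (lt_of_le_of_lt (le_trans (Nat.le_add_right _ _) c2) hN) (h3 6 (by norm_num))
  · gcongr
  · have : (nodeList x W (j + d) t).length / e ≤ 2 ^ (j + d) / e := Nat.div_le_div_right hs
    unfold jumpCost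
    omega

/-- The number of records per word at a node from which `d` levels are jumped. -/
def fieldsPerWord (K b d : ℕ) : ℕ := b / ((K + 2) * d) + 1

/-- A bound for the size of a node at height `h`. -/
noncomputable def nodeCost (K B b h : ℕ) : ℕ :=
  18 + 2 * (2 ^ h / b) + 2 ^ h / fieldsPerWord K b (jumpLen B h) + 2 ^ jumpLen B h +
    (2 ^ h / (2 ^ jumpLen B h * b) + 1) * 2 ^ jumpLen B h

variable {K B H : ℕ}

/-- Bits and rank samples take two arrays of about `2 ^ (j + 1) / b` words. A jump record is laid
out only for jumps over more than one level, where the fields are wide enough for the counters. -/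
theorem alloc_inner (hN : N < 2 ^ w) (hn : n < 2 ^ w) (hb : 1 ≤ b) (hB : 2 ≤ B)
    (hbK : b ≤ 2 ^ (K * B)) (hw : b + (K + 2) * H < w) {addr : ℕ → ℕ → ℕ}
    (haddr : ∀ j t, addr j t ≤ N) {j t : ℕ} (hj : j + 1 ≤ H) :
    Alloc N (nodeCost K B b (j + 1)) (fun (a : ℕ) (M : List (Cell w)) => a ≤ N ∧
      ∃ jp bits ones, InnerAt M b x y W addr j t a jp bits ones ∧
        ((jumpLen B (j + 1) = 1 ∧ jp = 0) ∨ (jp ≠ 0 ∧ ∃ j' e g fields child cnt,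
          j' + jumpLen B (j + 1) = j + 1 ∧
          JumpAt M b x W addr j' (jumpLen B (j + 1)) t jp e g fields child cnt))) := by
  have hs := length_nodeList_le (x := x) (W := W) (j + 1) t
  have hbw : b < w := by omega
  set d := jumpLen B (j + 1) with hd
  have hd1 : 1 ≤ d := jumpLen_pos hB (by omega)
  have hdj : d ≤ j + 1 := jumpLen_le hB (by omega)
  have hdH : (K + 2) * d ≤ (K + 2) * H := Nat.mul_le_mul_left _ (by omega)
  have hg1 : 1 ≤ (K + 2) * d := Nat.one_le_iff_ne_zero.2 (by positivity)
  have jump : Alloc N (jumpCost b (j + 1 - d) d (fieldsPerWord K b d))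
      (fun (jp : ℕ) (M : List (Cell w)) => jp ≤ N ∧ ((d = 1 ∧ jp = 0) ∨ (jp ≠ 0 ∧
        ∃ j' e g fields child cnt, j' + d = j + 1 ∧
          JumpAt M b x W addr j' d t jp e g fields child cnt))) := by
    by_cases h1 : d = 1
    · exact Alloc.pure 0 fun M => ⟨Nat.zero_le _, Or.inl ⟨h1, rfl⟩⟩
    · refine (alloc_jump (x := x) (W := W) (j := j + 1 - d) (d := d) (t := t)
        (e := fieldsPerWord K b d) (g := (K + 2) * d) hN hn hb haddr (by simp [fieldsPerWord])
        hg1 ?_ ?_).mono id ?_ le_rfl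
      -- The fields of a word take at most `b` bits plus one more field, and the word length exceeds
      -- `b` by more than the longest field.
      · rw [fieldsPerWord, add_mul, one_mul]
        have := Nat.div_mul_le_self b ((K + 2) * d)
        omega
      -- A jump over more than one level has length at least `B`, so `b ≤ 2 ^ (K * B) ≤ 2 ^ (K *
      -- d)`: the factor `b` in the field size costs only `K * d` bits.
      · have h2 : B ≤ d := base_le_jumpLen hB (by omega) h1
        have h3 : b ≤ 2 ^ (K * d) :=
          hbK.trans (Nat.pow_le_pow_right (by norm_num) (Nat.mul_le_mul_left _ h2))
        calc 2 ^ (2 * d) * b ≤ 2 ^ (2 * d) * 2 ^ (K * d) := Nat.mul_le_mul_left _ h3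
          _ = 2 ^ ((K + 2) * d) := by rw [← pow_add]; congr 1; ring
      · rintro jp M ⟨h2, h3, fields, child, cnt, h4⟩
        exact ⟨h3, Or.inr ⟨h2, _, _, _, fields, child, cnt, by omega, h4⟩⟩
  refine jump.bind (fun jp hjp => ?_) (c₂ := 2 * (2 ^ (j + 1) / b + 1) + 7) ?_
  swap
  · rw [jumpCost, nodeCost, ← hd, Nat.sub_add_cancel hdj]
    omega
  obtain ⟨-, hjpN, -⟩ := hjp
  refine (Alloc.words ((nodeList x W (j + 1) t).length / b + 1)
    (fun k => packDigits 2 b fun r => symAt x W j 1 t (k * b + r)) (fun k _ => ?_)).bind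
    (fun bits hbits => ?_) (c₂ := (2 ^ (j + 1) / b + 1) + 7) ?_
  · refine (packDigits_lt (fun r => ?_) b).trans (Nat.pow_lt_pow_right (by norm_num) hbw)
    exact symAt_lt j 1 t _
  · refine (Alloc.words ((nodeList x W (j + 1) t).length / b + 1)
      (fun k => cntSym x W j 1 t 1 (k * b)) (fun k _ => cntSym_lt hn _ _ _ _ _)).bind
      (fun ones hones => ?_) (c₂ := 7) ?_
    · refine (Alloc.cells [.ofNat w 1, .ofNat w jp, .ofNat w (addr j (2 * t)),
        .ofNat w (addr j (2 * t + 1)), .ofNat w bits, .ofNat w ones,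
        .coord ((W[(2 * t + 1) * 2 ^ j]?).elim ⊤ y)]).mono id ?_ (by simp)
      rintro a M ⟨h1, h2, h3⟩ ⟨-, b2, b3⟩ ⟨-, a2, a3⟩ ⟨-, hjump⟩
      simp only [List.length_cons, List.length_nil, id] at h2 a2 b2 ⊢
      refine ⟨by omega, jp, bits, ones, ⟨?_, ?_, ?_, ?_, ?_, ?_, ?_, a3, b3⟩, hjump⟩
      · exact wordAt_of_getElem? (Nat.one_lt_two_pow (by omega)) (h3 0 (by norm_num))
      · exact wordAt_of_getElem? (hjpN.trans_lt hN) (h3 1 (by norm_num))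
      · exact wordAt_of_getElem? ((haddr _ _).trans_lt hN) (h3 2 (by norm_num))
      · exact wordAt_of_getElem? ((haddr _ _).trans_lt hN) (h3 3 (by norm_num))
      · exact wordAt_of_getElem? (((Nat.le_add_right _ _).trans a2).trans_lt hN) (h3 4 (by norm_num))
      · exact wordAt_of_getElem? (((Nat.le_add_right _ _).trans b2).trans_lt hN) (h3 5 (by norm_num))
      · exact coordAt_of_getElem? (h3 6 (by norm_num))
    · gcongr
  · have : (nodeList x W (j + 1) t).length / b ≤ 2 ^ (j + 1) / b := Nat.div_le_div_right hs
    omega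

theorem JumpAt.congr {M : List (Cell w)} {addr addr' : ℕ → ℕ → ℕ} {j d t jp e g f c k : ℕ}
    (h : JumpAt M b x W addr j d t jp e g f c k) (ha : addr j = addr' j) :
    JumpAt M b x W addr' j d t jp e g f c k :=
  { h with childArr := by simpa only [ha] using h.childArr }

theorem InnerAt.congr {M : List (Cell w)} {addr addr' : ℕ → ℕ → ℕ} {j t a jp bits ones : ℕ}
    (h : InnerAt M b x y W addr j t a jp bits ones) (ha : addr j = addr' j) :
    InnerAt M b x y W addr' j t a jp bits ones :=
  { h with left := ha ▸ h.left, right := ha ▸ h.right }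

/-- The tree is laid out upwards, height by height, because a node stores addresses of lower nodes.
At each height the address function is extended by the new records, and the records below keep their
meaning since they only refer to addresses at lower heights. Nonexistent nodes get the address `0`.
-/
theorem alloc_tree (hN : N < 2 ^ w) (hn : n < 2 ^ w) (hb : 1 ≤ b) (hB : 2 ≤ B)
    (hbK : b ≤ 2 ^ (K * B)) (hw : b + (K + 2) * H < w) (hH : W.length ≤ 2 ^ H) : ∀ h, h ≤ H →
    Alloc N (W.length * 7 + ∑ k ∈ Finset.range h, 2 ^ (H - (k + 1)) * nodeCost K B b (k + 1))
      (fun (addr : ℕ → ℕ → ℕ) (M : List (Cell w)) => (∀ j t, addr j t ≤ N) ∧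
        TreeAt M b x y W B h addr) := by
  intro h
  induction h with
  | zero =>
    intro _
    refine (Alloc.family (f := fun _ => 7) W.length fun t ht =>
      alloc_leaf (y := y) (N := N) hn ht).mono
      (fun v j t => if j = 0 ∧ t < W.length then v t else 0) ?_ (by simp)
    intro v M hv
    refine ⟨fun j t => ?_, fun t ht => ?_, fun j hj => absurd hj (by omega)⟩
    · dsimp only
      split
      next h => exact (hv t h.2).1
      next => exact Nat.zero_le _
    · simpa [ht] using (hv t ht).2
  | succ h ih =>
    intro hh
    refine (ih (by omega)).bind (fun addr ⟨_, haddr, _⟩ => ?_)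
      (c₂ := 2 ^ (H - (h + 1)) * nodeCost K B b (h + 1))
      (by rw [Finset.sum_range_succ, add_assoc])
    refine (Alloc.family (f := fun _ => nodeCost K B b (h + 1)) (2 ^ (H - (h + 1))) fun t _ =>
      alloc_inner (x := x) (y := y) (W := W) (t := t) hN hn hb hB hbK hw haddr hh).mono
      (fun v j t => if j = h + 1 then (if t < 2 ^ (H - (h + 1)) then v t else 0) else addr j t)
      ?_ (by simp)
    rintro v M hv ⟨-, htree⟩
    set addr' : ℕ → ℕ → ℕ := fun j t =>
      if j = h + 1 then (if t < 2 ^ (H - (h + 1)) then v t else 0) else addr j t with haddr'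
    have heq : ∀ j, j ≤ h → addr j = addr' j := fun j hj => by
      funext t
      simp [haddr', show j ≠ h + 1 by omega]
    refine ⟨fun j t => ?_, fun t ht => ?_, fun j hj t ht => ?_⟩
    · simp only [haddr']
      split
      · split
        next h => exact (hv t h).1
        next => exact Nat.zero_le _
      · exact haddr j t
    · rw [← heq 0 (Nat.zero_le _)]
      exact htree.leaf t ht
    · rcases Nat.lt_or_ge j h with hjh | hjh
      · obtain ⟨jp, bits, ones, h1, h2⟩ := htree.inner j hjh t ht
        rw [← heq (j + 1) hjh]
        refine ⟨jp, bits, ones, h1.congr (heq j hjh.le), h2.imp_right ?_⟩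
        rintro ⟨h3, j', e, g, f, c, k, h4, h5⟩
        have := jumpLen_pos (B := B) (j := j + 1) hB (by omega)
        exact ⟨h3, j', e, g, f, c, k, h4, h5.congr (heq j' (by omega))⟩
      · obtain rfl : j = h := by omega
        have ht' : t < 2 ^ (H - (j + 1)) := by
          have h1 : t * 2 ^ (j + 1) < 2 ^ (H - (j + 1)) * 2 ^ (j + 1) := by
            rw [← pow_add, Nat.sub_add_cancel hh]
            exact ht.trans_le hH
          exact lt_of_mul_lt_mul_right h1 (Nat.zero_le _)
        obtain ⟨-, jp, bits, ones, h1, h2⟩ := hv t ht'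
        have e1 : addr' (j + 1) t = v t := by simp [haddr', ht']
        rw [e1]
        refine ⟨jp, bits, ones, h1.congr (heq j le_rfl), h2.imp_right ?_⟩
        rintro ⟨h3, j', e, g, f, c, k, h4, h5⟩
        have := jumpLen_pos (B := B) (j := j + 1) hB (by omega)
        exact ⟨h3, j', e, g, f, c, k, h4, h5.congr (heq j' (by omega))⟩

/-- Multiplying by `b` turns the rounded quotients into sizes in bits: a constant number per entry
for bits and samples, `(K + 2) * d` per entry for the fields, and whole words for headers and
descendant tables. -/
theorem nodeCost_mul_le (hB : 2 ≤ B) {h : ℕ} (hh : h ≤ H) (h1 : 1 ≤ h) :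
    2 ^ (H - h) * nodeCost K B b h * b ≤ 18 * b * 2 ^ (H - h) + 3 * 2 ^ H +
      2 ^ H * (K + 2) * jumpLen B h + 2 * b * (2 ^ (H - h) * 2 ^ jumpLen B h) := by
  set d := jumpLen B h with hd
  have hd1 : 1 ≤ d := jumpLen_pos hB (by omega)
  have hHh : 2 ^ (H - h) * 2 ^ h = 2 ^ H := by rw [← pow_add, Nat.sub_add_cancel hh]
  have e1 : 2 ^ h / b * b ≤ 2 ^ h := Nat.div_mul_le_self _ _
  have e2 : 2 ^ h / fieldsPerWord K b d * b ≤ 2 ^ h * ((K + 2) * d) := by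
    -- The additional field per word makes a word hold at least `b` bits of fields, so at least a
    -- fraction of `b / ((K + 2) * d)` entries.
    have h2 : b ≤ fieldsPerWord K b d * ((K + 2) * d) := by
      rw [fieldsPerWord, mul_comm]
      exact (Nat.lt_mul_div_succ b (by positivity)).le
    calc 2 ^ h / fieldsPerWord K b d * b
        ≤ 2 ^ h / fieldsPerWord K b d * (fieldsPerWord K b d * ((K + 2) * d)) :=
          Nat.mul_le_mul_left _ h2
      _ = (2 ^ h / fieldsPerWord K b d * fieldsPerWord K b d) * ((K + 2) * d) := by ring
      _ ≤ 2 ^ h * ((K + 2) * d) := Nat.mul_le_mul_right _ (Nat.div_mul_le_self _ _)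
  have e3 : 2 ^ h / (2 ^ d * b) * 2 ^ d * b ≤ 2 ^ h := by
    rw [mul_assoc]
    exact Nat.div_mul_le_self _ _
  have e4 : nodeCost K B b h * b ≤ 18 * b + 2 * 2 ^ h + 2 ^ h * ((K + 2) * d) + 2 ^ d * b +
      (2 ^ h + 2 ^ d * b) := by
    have : nodeCost K B b h * b = 18 * b + 2 * (2 ^ h / b * b) +
        2 ^ h / fieldsPerWord K b d * b + 2 ^ d * b +
        (2 ^ h / (2 ^ d * b) * 2 ^ d * b + 2 ^ d * b) := by
      rw [nodeCost, ← hd]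
      ring
    omega
  calc 2 ^ (H - h) * nodeCost K B b h * b = 2 ^ (H - h) * (nodeCost K B b h * b) := by ring
    _ ≤ 2 ^ (H - h) * (18 * b + 2 * 2 ^ h + 2 ^ h * ((K + 2) * d) + 2 ^ d * b +
      (2 ^ h + 2 ^ d * b)) := Nat.mul_le_mul_left _ e4
    _ = 18 * b * 2 ^ (H - h) + 3 * (2 ^ (H - h) * 2 ^ h) +
      (2 ^ (H - h) * 2 ^ h) * (K + 2) * d + 2 * b * (2 ^ (H - h) * 2 ^ d) := by ring
    _ = _ := by rw [hHh]

theorem sum_pow_sub (H : ℕ) : ∑ h ∈ Finset.Icc 1 H, 2 ^ (H - h) ≤ 2 ^ H := by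
  have : ∀ H, ∑ h ∈ Finset.Icc 1 H, 2 ^ (H - h) + 1 = 2 ^ H := by
    intro H
    induction H with
    | zero => simp
    | succ H ih =>
      rw [Finset.sum_Icc_succ_top (by omega)]
      have : ∑ h ∈ Finset.Icc 1 H, 2 ^ (H + 1 - h) = 2 * ∑ h ∈ Finset.Icc 1 H, 2 ^ (H - h) := by
        rw [Finset.mul_sum]
        refine Finset.sum_congr rfl fun h hh => ?_
        rw [Finset.mem_Icc] at hh
        rw [Nat.succ_sub hh.2, pow_succ, mul_comm]
      rw [this, pow_succ, Nat.sub_self, pow_zero]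
      omega
  have := this H
  omega

/-- A constant such that a binary range tree over `m` points has at most `treeConst K * m` words. -/
def treeConst (K : ℕ) : ℕ := 2 * (24 + 2 * K * (K + 2) + 4 * K) + 7

/-- Although there are `H` heights, the height-dependent terms sum to `O(H * 2 ^ H)` bits, and `H ≤
2 * b` turns this into `O(2 ^ H)` words. Headers and descendant tables are geometric sums. -/
theorem tree_cost_le (hb : 1 ≤ b) (hB : 2 ≤ B) (hH : H < B ^ K) (hHb : H ≤ 2 * b) {m : ℕ}
    (hm : 2 ^ H ≤ 2 * m) :
    m * 7 + ∑ k ∈ Finset.range H, 2 ^ (H - (k + 1)) * nodeCost K B b (k + 1) ≤ treeConst K * m := by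
  have h1 : ∑ k ∈ Finset.range H, 2 ^ (H - (k + 1)) * nodeCost K B b (k + 1) =
      ∑ h ∈ Finset.Icc 1 H, 2 ^ (H - h) * nodeCost K B b h := by
    rw [Finset.range_eq_Ico, Finset.sum_Ico_add' (fun h => 2 ^ (H - h) * nodeCost K B b h) 0 H 1]
    rfl
  rw [h1]
  have h2 : (∑ h ∈ Finset.Icc 1 H, 2 ^ (H - h) * nodeCost K B b h) * b ≤
      (2 ^ H * (24 + 2 * K * (K + 2) + 4 * K)) * b := by
    rw [Finset.sum_mul]
    calc ∑ h ∈ Finset.Icc 1 H, 2 ^ (H - h) * nodeCost K B b h * b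
        ≤ ∑ h ∈ Finset.Icc 1 H, (18 * b * 2 ^ (H - h) + 3 * 2 ^ H +
          2 ^ H * (K + 2) * jumpLen B h + 2 * b * (2 ^ (H - h) * 2 ^ jumpLen B h)) := by
          refine Finset.sum_le_sum fun h hh => ?_
          rw [Finset.mem_Icc] at hh
          exact nodeCost_mul_le hB hh.2 hh.1
      _ = 18 * b * ∑ h ∈ Finset.Icc 1 H, 2 ^ (H - h) + H * (3 * 2 ^ H) +
          2 ^ H * (K + 2) * ∑ h ∈ Finset.Icc 1 H, jumpLen B h +
          2 * b * ∑ h ∈ Finset.Icc 1 H, 2 ^ (H - h) * 2 ^ jumpLen B h := by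
          simp only [Finset.sum_add_distrib, Finset.mul_sum, Finset.sum_const, Nat.card_Icc,
            smul_eq_mul, Nat.add_sub_cancel]
      _ ≤ 18 * b * 2 ^ H + (2 * b) * (3 * 2 ^ H) + 2 ^ H * (K + 2) * (K * (2 * b)) +
          2 * b * (K * 2 ^ (H + 1)) := by
          gcongr
          · exact sum_pow_sub H
          · exact (sum_jumpLen hB hH).trans (Nat.mul_le_mul_left _ hHb)
          · exact sum_pow_jumpLen hB hH
      _ = _ := by ring
  have h3 := Nat.le_of_mul_le_mul_right h2 hb
  have h4 := Nat.mul_le_mul_right (24 + 2 * K * (K + 2) + 4 * K) hm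
  calc _ ≤ m * 7 + 2 * m * (24 + 2 * K * (K + 2) + 4 * K) := by omega
    _ = treeConst K * m := by rw [treeConst]; ring

end tree

/-! ### Laying out dominance structures -/

/-- The relations between the parameters of the layout: the number `n` of boxes, the word length,
the memory size, the block length, the base and the number of digits of heights, and a bound for
the heights of binary trees. -/
structure LayoutParams (n w N b B K ℓ : ℕ) : Prop where
  memory : N < 2 ^ w
  boxes : n < 2 ^ w
  block : 1 ≤ b
  base : 2 ≤ B
  block_le : b ≤ 2 ^ (K * B)
  word : b + (K + 2) * ℓ < w
  height : ℓ < B ^ K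
  clog_le : Nat.clog 2 n ≤ ℓ
  size_le : Nat.size n ≤ ℓ
  clog_le_block : Nat.clog 2 n ≤ 2 * b

theorem two_pow_size_le (m : ℕ) : 2 ^ Nat.size m ≤ 2 * m + 1 := by
  cases h : Nat.size m with
  | zero => simp
  | succ s =>
    have : 2 ^ s ≤ m := Nat.lt_size.1 (by omega)
    rw [pow_succ]
    omega

theorem two_pow_clog_le {m : ℕ} (hm : 1 ≤ m) : 2 ^ Nat.clog 2 m ≤ 2 * m := by
  rcases hm.lt_or_eq with h | h
  · have h1 := Nat.pow_pred_clog_lt_self (b := 2) (by norm_num) h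
    have h2 := Nat.clog_pos (b := 2) (by norm_num) h
    obtain ⟨k, hk⟩ : ∃ k, Nat.clog 2 m = k + 1 := ⟨_, (Nat.succ_pred_eq_of_pos h2).symm⟩
    rw [hk] at h1 ⊢
    rw [Nat.pred_succ] at h1
    rw [pow_succ]
    omega
  · subst h
    simp

section layout
variable {w n : ℕ} {N b B K ℓ lam : ℕ} {x y z : Fin n → Coord}

theorem alloc_keys {key : Fin n → Coord} {Z : List (Fin n)} {m : ℕ} (hZ : Z.length < 2 ^ m) :
    Alloc N (2 ^ m) (fun (A : ℕ) (M : List (Cell w)) => A + 2 ^ m ≤ N ∧ SortedKeys M A m key Z) := by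
  refine (Alloc.coords (2 ^ m) (fun k => (Z[k - 1]?).elim ⊤ key)).mono id ?_ le_rfl
  rintro A M ⟨-, h2, h3⟩
  exact ⟨h2, hZ, fun k hk => h3 (k + 1) hk⟩

theorem alloc_planar (hP : LayoutParams n w N b B K ℓ) {V : Finset (Fin n)} (hV : 1 ≤ V.card) :
    Alloc N ((treeConst K + 6) * V.card) (fun (r : ℕ) (M : List (Cell w)) => r ≤ N ∧
      ∃ A m addr, PlanarAt M b B x y V ℓ r A m addr) := by
  have hVn : V.card ≤ n := by simpa using V.card_le_univ
  set H := Nat.clog 2 V.card with hH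
  have hHn : H ≤ Nat.clog 2 n := Nat.clog_mono_right 2 hVn
  have hHl : H ≤ ℓ := hHn.trans hP.clog_le
  have hlen : (sortByKey y V).length = V.card := length_sortByKey y V
  have hsize := two_pow_size_le V.card
  refine (alloc_tree (x := x) (y := y) (W := sortByKey y V) (H := H) (K := K) (B := B) (b := b)
    hP.memory hP.boxes hP.block hP.base hP.block_le
    (lt_of_le_of_lt (Nat.add_le_add_left (Nat.mul_le_mul_left _ hHl) _) hP.word)
    (by rw [hlen]; exact Nat.le_pow_clog (by norm_num) _) H le_rfl).bind
    (fun addr ⟨_, haddr, _⟩ => ?_) (c₂ := 2 ^ Nat.size V.card + 3) ?_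
  · refine (alloc_keys (key := x) (Z := nodeList x (sortByKey y V) H 0) (m := Nat.size V.card)
      ?_).bind (fun A hA => ?_) le_rfl
    · refine lt_of_le_of_lt ?_ (Nat.lt_size_self V.card)
      rw [nodeList, length_sortByKey]
      refine (List.toFinset_card_le _).trans ?_
      rw [List.block, List.length_take, List.length_drop, hlen]
      omega
    · refine (Alloc.cells [.ofNat w (addr H 0), .ofNat w A, .ofNat w (2 ^ Nat.size V.card / 2)]).mono
        id ?_ (by simp)
      rintro r M ⟨h1, h2, h3⟩ ⟨a2, a3⟩ ⟨-, htree⟩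
      simp only [List.length_cons, List.length_nil, id] at h2 a2 ⊢
      refine ⟨by omega, A, Nat.size V.card, addr, ?_, ?_, ?_, a3, htree, hHl,
        (Nat.size_le_size hVn).trans hP.size_le⟩
      · exact wordAt_of_getElem? ((haddr _ _).trans_lt hP.memory) (h3 0 (by norm_num))
      · exact wordAt_of_getElem? (((Nat.le_add_right _ _).trans a2).trans_lt hP.memory)
          (h3 1 (by norm_num))
      · exact wordAt_of_getElem? ((((Nat.div_le_self _ _).trans (Nat.le_add_left _ _)).trans
          a2).trans_lt hP.memory) (h3 2 (by norm_num))
  · have := tree_cost_le (K := K) (B := B) (b := b) (H := H) (m := V.card) hP.block hP.base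
      (hHl.trans_lt hP.height) (hHn.trans hP.clog_le_block) (two_pow_clog_le hV)
    rw [hlen, add_mul]
    omega

/-- The blocks are the fibres of position divided by `k`; indices past the last block contribute
nothing. -/
theorem sum_card_block {Z : List (Fin n)} (hZ : Z.Nodup) {k : ℕ} (hk : 1 ≤ k) :
    ∑ t ∈ Finset.range Z.length, (Z.block k t).toFinset.card = Z.length := by
  classical
  have h := Finset.card_eq_sum_card_fiberwise (s := Z.toFinset) (f := fun i => Z.idxOf i / k)
    (t := Finset.range Z.length) fun i hi => by
      have : i ∈ Z := by simpa using hi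
      simp only [Finset.coe_range, Set.mem_Iio]
      exact (Nat.div_le_self _ _).trans_lt (List.idxOf_lt_length_iff.2 this)
  rw [List.toFinset_card_of_nodup hZ] at h
  refine Eq.trans (Finset.sum_congr rfl fun t _ => ?_) h.symm
  congr 1
  ext i
  simp [List.mem_block hZ hk]

/-- The planar structures of all nodes at one height of a range tree, and an array of pointers. -/
theorem alloc_planars (hP : LayoutParams n w N b B K ℓ) {Z : List (Fin n)} (hZ : Z.Nodup) {k : ℕ}
    (hk : 1 ≤ k) : Alloc N ((treeConst K + 7) * Z.length)
      (fun (v : ℕ × (ℕ → ℕ)) (M : List (Cell w)) => v.1 + Z.length ≤ N ∧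
        ∀ t, t * k < Z.length → wordAt M (v.1 + t) = some (v.2 t) ∧ ∃ A m addr,
          PlanarAt M b B x y (Z.block k t).toFinset ℓ (v.2 t) A m addr) := by
  refine (Alloc.family (α := ℕ) (N := N) (P := fun t r (M : List (Cell w)) => r ≤ N ∧
    (t * k < Z.length → ∃ A m addr, PlanarAt M b B x y (Z.block k t).toFinset ℓ r A m addr))
    (f := fun t => (treeConst K + 6) * (Z.block k t).toFinset.card) Z.length
    (fun t _ => ?_)).bind (fun rec ⟨_, hrec⟩ => ?_) (c₂ := Z.length) ?_
  · by_cases ht : t * k < Z.length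
    · refine (alloc_planar (x := x) (y := y) hP ?_).mono id (fun r M h => ⟨h.1, fun _ => h.2⟩) le_rfl
      refine Finset.card_pos.2 ⟨Z[t * k], ?_⟩
      rw [List.mem_toFinset, List.mem_block hZ hk]
      refine ⟨List.getElem_mem _, ?_⟩
      rw [hZ.idxOf_getElem, Nat.mul_div_cancel _ hk]
    · exact Alloc.pure 0 fun M => ⟨Nat.zero_le _, fun h => absurd h ht⟩
  · refine (Alloc.words Z.length rec fun t ht => (hrec t ht).1.trans_lt hP.memory).mono
      (fun a => (a, rec)) ?_ le_rfl
    rintro a M ⟨-, h2, h3⟩ h4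
    refine ⟨h2, fun t ht => ?_⟩
    have ht' : t < Z.length := (Nat.le_mul_of_pos_right t hk).trans_lt ht
    exact ⟨h3 t ht', (h4 t ht').2 ht⟩
  · rw [← Finset.mul_sum, sum_card_block hZ hk]
    exact le_of_eq (by ring)

/-- A canonical decomposition with normalized empty runs. -/
theorem exists_runs {d m H p : ℕ} (hd : 2 ≤ d) (hm : m ≤ d ^ H) (hp : p ≤ m) (pre : Bool) :
    ∃ lo hi, Runs d m H (if pre then (· < p) else (p ≤ ·)) lo hi ∧
      ∀ j ≤ H, lo j ≤ hi j ∧ hi j ≤ m := by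
  obtain ⟨lo, hi, h⟩ : ∃ lo hi, Runs d m H (if pre then (· < p) else (p ≤ ·)) lo hi := by
    cases pre
    · simpa using exists_runs_suffix (p := p) hd hm
    · simpa using exists_runs_prefix hd hm hp
  have key : ∀ j s, (min (lo j) (hi j) ≤ s ∧ s < hi j) ↔ (lo j ≤ s ∧ s < hi j) := by
    intro j s
    omega
  -- An empty run might start anywhere; moving its start down to its end keeps all starts within the
  -- array of pointers, so that the stored start addresses fit into words.
  refine ⟨fun j => min (lo j) (hi j), hi, ⟨h.valid, fun j => ?_, fun x hx => ?_, ?_⟩,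
    fun j hj => ⟨min_le_right _ _, ?_⟩⟩
  · have := h.le j
    omega
  · simpa only [key] using h.cover x hx
  · simpa only [key] using h.unique
  · by_contra hlt
    have h1 := h.valid j hj (hi j - 1) (by omega)
    have h2 : hi j - 1 ≤ (hi j - 1) * d ^ j := Nat.le_mul_of_pos_right _ (by positivity)
    omega

/-- A constant such that a dominance structure over `m` points with heights at most `Λ` takes at
most `spatialConst K * ((Λ + 1) * (m + 1))` words. -/
def spatialConst (K : ℕ) : ℕ := treeConst K + 20

/-- At each height the blocks partition the points, so their planar structures have total size
linear in the number of points. The tables of runs have one entry per rank and height, which is of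
the same order. -/
theorem alloc_spatial (hP : LayoutParams n w N b B K ℓ) (hlam : 2 ≤ lam) {Λ : ℕ}
    (hΛ : Nat.clog lam n ≤ Λ) (hΛw : Λ + 1 < 2 ^ w) (pre : Bool) (J : Finset (Fin n)) :
    Alloc N (spatialConst K * ((Λ + 1) * (J.card + 1))) (fun (r : ℕ) (M : List (Cell w)) =>
      r ≤ N ∧ HoldsSpatial M b B lam x y z pre J ℓ r) := by
  have hJn : J.card ≤ n := by simpa using J.card_le_univ
  set H := Nat.clog lam J.card with hH
  have hHΛ : H ≤ Λ := (Nat.clog_mono_right lam hJn).trans hΛ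
  set Z := sortByKey z J with hZ
  have hZn : Z.Nodup := nodup_sortByKey z J
  have hlen : Z.length = J.card := length_sortByKey z J
  have hsize := two_pow_size_le J.card
  have hruns : ∀ p, ∃ lh : (ℕ → ℕ) × (ℕ → ℕ), p ≤ J.card →
      Runs lam J.card H (if pre then (· < p) else (p ≤ ·)) lh.1 lh.2 ∧
      ∀ j ≤ H, lh.1 j ≤ lh.2 j ∧ lh.2 j ≤ J.card := by
    intro p
    by_cases hp : p ≤ J.card
    · obtain ⟨lo, hi, h⟩ := exists_runs hlam (Nat.le_pow_clog (by omega) J.card) hp pre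
      exact ⟨(lo, hi), fun _ => h⟩
    · exact ⟨(id, id), fun h => absurd h hp⟩
  choose lh hlh using hruns
  refine (Alloc.family (α := ℕ × (ℕ → ℕ)) (N := N) (f := fun _ => (treeConst K + 7) * Z.length)
    (H + 1) (fun j _ => alloc_planars (x := x) (y := y) (k := lam ^ j) hP hZn
      (Nat.one_le_pow _ _ (by omega)))).bind (fun v ⟨_, hv⟩ => ?_)
      (c₂ := 2 ^ Nat.size J.card +
        ((J.card + 1) * (H + 1) + ((J.card + 1) * (H + 1) + 5))) ?_
  swap
  · rw [Finset.sum_const, Finset.card_range, smul_eq_mul, hlen]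
    have e1 : (J.card + 1) * (H + 1) ≤ (Λ + 1) * (J.card + 1) := by
      rw [mul_comm]
      exact Nat.mul_le_mul_right _ (by omega)
    have e2 : (H + 1) * ((treeConst K + 7) * J.card) ≤
        (treeConst K + 7) * ((Λ + 1) * (J.card + 1)) := by
      rw [Nat.mul_left_comm]
      exact Nat.mul_le_mul_left _ (Nat.mul_le_mul (by omega) (by omega))
    have e3 : J.card + 1 ≤ (Λ + 1) * (J.card + 1) := Nat.le_mul_of_pos_left _ (by omega)
    rw [spatialConst, show treeConst K + 20 = (treeConst K + 7) + 13 by ring,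
      add_mul (treeConst K + 7)]
    generalize (H + 1) * ((treeConst K + 7) * J.card) = U at *
    generalize (Λ + 1) * (J.card + 1) = X at *
    generalize (J.card + 1) * (H + 1) = Y at *
    omega
  refine (alloc_keys (key := z) (Z := Z) (m := Nat.size J.card)
    (by rw [hlen]; exact Nat.lt_size_self _)).bind (fun A hA => ?_) le_rfl
  have hidx : ∀ k < (J.card + 1) * (H + 1), k / (H + 1) ≤ J.card ∧ k % (H + 1) ≤ H := by
    intro k hk
    have h1 : k / (H + 1) < J.card + 1 := (Nat.div_lt_iff_lt_mul (by omega)).2 hk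
    have h2 := Nat.mod_lt k (show 0 < H + 1 by omega)
    omega
  refine (Alloc.words ((J.card + 1) * (H + 1))
    (fun k => (v (k % (H + 1))).1 + (lh (k / (H + 1))).1 (k % (H + 1))) (fun k hk => ?_)).bind
    (fun starts hst => ?_) le_rfl
  · obtain ⟨h1, h2⟩ := hidx k hk
    have h3 := (hlh _ h1).2 _ h2
    have h4 := (hv (k % (H + 1)) (by omega)).1
    have := hP.memory
    omega
  refine (Alloc.words ((J.card + 1) * (H + 1))
    (fun k => (lh (k / (H + 1))).2 (k % (H + 1)) - (lh (k / (H + 1))).1 (k % (H + 1)))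
    (fun k hk => ?_)).bind (fun counts hct => ?_) le_rfl
  · obtain ⟨h1, h2⟩ := hidx k hk
    have h3 := (hlh _ h1).2 _ h2
    have := hP.boxes
    omega
  refine (Alloc.cells [.ofNat w A, .ofNat w (2 ^ Nat.size J.card / 2), .ofNat w starts,
    .ofNat w counts, .ofNat w (H + 1)]).mono id ?_ (by simp)
  rintro r M ⟨h1, h2, h3⟩ ⟨-, d2, d3⟩ ⟨-, c2, c3⟩ ⟨a2, a3⟩ hrec
  simp only [List.length_cons, List.length_nil, id] at h2 a2 c2 d2 ⊢
  have hdm : ∀ p j, j ≤ H → (p * (H + 1) + j) / (H + 1) = p ∧ (p * (H + 1) + j) % (H + 1) = j := by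
    intro p j hj
    rw [mul_comm, Nat.mul_add_div (by omega), Nat.mul_add_mod, Nat.div_eq_of_lt (by omega),
      Nat.mod_eq_of_lt (by omega)]
    exact ⟨rfl, rfl⟩
  have hlt : ∀ p j, p ≤ J.card → j ≤ H → p * (H + 1) + j < (J.card + 1) * (H + 1) := by
    intro p j hp hj
    have := Nat.mul_le_mul_right (H + 1) hp
    rw [add_mul, one_mul]
    omega
  refine ⟨by omega, A, Nat.size J.card, starts, counts, fun j => (v j).1, fun j => (v j).2,
    ?_, ?_, ?_, ?_, ?_, a3, (Nat.size_le_size hJn).trans hP.size_le, ?_, ?_⟩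
  · exact wordAt_of_getElem? (((Nat.le_add_right _ _).trans a2).trans_lt hP.memory)
      (h3 0 (by norm_num))
  · exact wordAt_of_getElem? ((((Nat.div_le_self _ _).trans (Nat.le_add_left _ _)).trans
      a2).trans_lt hP.memory) (h3 1 (by norm_num))
  · exact wordAt_of_getElem? (((Nat.le_add_right _ _).trans c2).trans_lt hP.memory)
      (h3 2 (by norm_num))
  · exact wordAt_of_getElem? (((Nat.le_add_right _ _).trans d2).trans_lt hP.memory)
      (h3 3 (by norm_num))
  · exact wordAt_of_getElem? (lt_of_le_of_lt (by omega) hΛw) (h3 4 (by norm_num))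
  · intro p hp
    refine ⟨(lh p).1, (lh p).2, (hlh p hp).1, fun j hj => ?_⟩
    rw [← hH] at hj ⊢
    have e1 := c3 _ (hlt p j hp hj)
    have e2 := d3 _ (hlt p j hp hj)
    dsimp only at e1 e2
    rw [(hdm p j hj).1, (hdm p j hj).2] at e1 e2
    exact ⟨e1, e2⟩
  · intro j hj t ht
    rw [← hH] at hj
    exact (hrec j (by omega)).2 t (by rwa [hlen])

variable {ylo yhi zlo zhi : Fin n → Coord}

theorem alloc_mid (hP : LayoutParams n w N b B K ℓ) (hlam : 2 ≤ lam) {Λ : ℕ}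
    (hΛ : Nat.clog lam n ≤ Λ) (hΛw : Λ + 1 < 2 ^ w) (tree : IntervalTree (Fin n)) :
    Alloc N (tree.cost fun J => 4 * (spatialConst K * ((Λ + 1) * (J.card + 1))) + 7)
      (fun (r : ℕ) (M : List (Cell w)) => r ≤ N ∧ MidAt M b B lam ℓ x ylo yhi zlo zhi tree r) := by
  induction tree with
  | nil => exact Alloc.pure 0 fun M => ⟨Nat.zero_le _, rfl⟩
  | node med J t₁ t₂ ih₁ ih₂ =>
    refine ih₁.bind (fun r₁ ⟨_, hr₁, _⟩ => ?_) (c₂ := (t₂.cost fun J =>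
      4 * (spatialConst K * ((Λ + 1) * (J.card + 1))) + 7) +
      (4 * (spatialConst K * ((Λ + 1) * (J.card + 1))) + 7)) ?_
    · refine ih₂.bind (fun r₂ ⟨_, hr₂, _⟩ => ?_) le_rfl
      refine (Alloc.bool fun dz => Alloc.bool fun dy => alloc_spatial (N := N) (x := x)
        (y := if dy then ylo else yhi) (z := if dz then zlo else zhi) hP hlam hΛ hΛw dz J).bind
        (fun s ⟨_, hs⟩ => ?_) (c₂ := 7) (by omega)
      refine (Alloc.cells [.coord med, .ofNat w r₁, .ofNat w r₂, .ofNat w (s false false),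
        .ofNat w (s false true), .ofNat w (s true false), .ofNat w (s true true)]).mono
        id ?_ (by simp)
      rintro r M ⟨h1, h2, h3⟩ h4 ⟨-, h5⟩ ⟨-, h6⟩
      simp only [List.length_cons, List.length_nil, id] at h2 ⊢
      refine ⟨by omega, by omega, ?_, ⟨r₁, ?_, h6⟩, ⟨r₂, ?_, h5⟩, fun dz dy => ⟨s dz dy, ?_,
        (h4 dz dy).2⟩⟩
      · exact coordAt_of_getElem? (h3 0 (by norm_num))
      · exact wordAt_of_getElem? (hr₁.trans_lt hP.memory) (h3 1 (by norm_num))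
      · exact wordAt_of_getElem? (hr₂.trans_lt hP.memory) (h3 2 (by norm_num))
      · have hsN := (hs dz dy).1.trans_lt hP.memory
        cases dz <;> cases dy
        · exact wordAt_of_getElem? hsN (h3 3 (by norm_num))
        · exact wordAt_of_getElem? hsN (h3 4 (by norm_num))
        · exact wordAt_of_getElem? hsN (h3 5 (by norm_num))
        · exact wordAt_of_getElem? hsN (h3 6 (by norm_num))
    · simp only [IntervalTree.cost]
      omega

theorem alloc_top (hP : LayoutParams n w N b B K ℓ) (hlam : 2 ≤ lam) {Λ : ℕ}
    (hΛ : Nat.clog lam n ≤ Λ) (hΛw : Λ + 1 < 2 ^ w) (tree : IntervalTree (Fin n)) :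
    Alloc N (tree.cost fun I => ((intervalTree ylo yhi I).cost fun J =>
        4 * (spatialConst K * ((Λ + 1) * (J.card + 1))) + 7) + 4)
      (fun (r : ℕ) (M : List (Cell w)) => r ≤ N ∧ TopAt M b B lam ℓ x ylo yhi zlo zhi tree r) := by
  induction tree with
  | nil => exact Alloc.pure 0 fun M => ⟨Nat.zero_le _, rfl⟩
  | node med I t₁ t₂ ih₁ ih₂ =>
    refine ih₁.bind (fun r₁ ⟨_, hr₁, _⟩ => ?_) (c₂ := (t₂.cost fun I =>
      ((intervalTree ylo yhi I).cost fun J =>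
        4 * (spatialConst K * ((Λ + 1) * (J.card + 1))) + 7) + 4) +
      (((intervalTree ylo yhi I).cost fun J =>
        4 * (spatialConst K * ((Λ + 1) * (J.card + 1))) + 7) + 4)) ?_
    · refine ih₂.bind (fun r₂ ⟨_, hr₂, _⟩ => ?_) le_rfl
      refine (alloc_mid (N := N) (x := x) (ylo := ylo) (yhi := yhi) (zlo := zlo) (zhi := zhi)
        hP hlam hΛ hΛw (intervalTree ylo yhi I)).bind (fun s ⟨_, hs, _⟩ => ?_) le_rfl
      refine (Alloc.cells [.coord med, .ofNat w r₁, .ofNat w r₂, .ofNat w s]).mono id ?_ (by simp)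
      rintro r M ⟨h1, h2, h3⟩ ⟨-, h4⟩ ⟨-, h5⟩ ⟨-, h6⟩
      simp only [List.length_cons, List.length_nil, id] at h2 ⊢
      refine ⟨by omega, by omega, ?_, ⟨r₁, ?_, h6⟩, ⟨r₂, ?_, h5⟩, s, ?_, h4⟩
      · exact coordAt_of_getElem? (h3 0 (by norm_num))
      · exact wordAt_of_getElem? (hr₁.trans_lt hP.memory) (h3 1 (by norm_num))
      · exact wordAt_of_getElem? (hr₂.trans_lt hP.memory) (h3 2 (by norm_num))
      · exact wordAt_of_getElem? (hs.trans_lt hP.memory) (h3 3 (by norm_num))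
    · simp only [IntervalTree.cost]
      omega

/-- The structure for `n` boxes, without the table, takes at most `boxesConst K * ((Λ + 1) * n)`
words. -/
def boxesConst (K : ℕ) : ℕ := 12 * spatialConst K + 29

/-- The initial memory holds the block length, a placeholder for the root and a popcount table of `2
^ b ≤ n` words. The budget for the rest comes from applying the cost bound for interval trees twice,
once for each layer. -/
theorem exists_memory (hP : LayoutParams n w N b B K ℓ) (hlam : 2 ≤ lam) {Λ : ℕ}
    (hΛ : Nat.clog lam n ≤ Λ) (hΛw : Λ + 1 < 2 ^ w) (hbn : 2 ^ b ≤ n)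
    (hN : boxesConst K * ((Λ + 1) * n) + n + 2 ≤ N) (Bx : Fin n → CanonicalBox) :
    ∃ M : List (Cell w), M.length ≤ N ∧ HoldsBoxes M b B lam ℓ Bx := by
  have hcost : ((intervalTree (fun i => ((Bx i).z₁ : Coord)) (fun i => (Bx i).z₂)
      Finset.univ).cost fun I => ((intervalTree (fun i => ((Bx i).y₁ : Coord))
        (fun i => (Bx i).y₂) I).cost fun J =>
        4 * (spatialConst K * ((Λ + 1) * (J.card + 1))) + 7) + 4) ≤
      boxesConst K * ((Λ + 1) * n) := by
    refine (cost_intervalTree_le (fun i => (Bx i).z_lt) (c := 4)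
      (a := 12 * (spatialConst K * (Λ + 1)) + 14) (fun I => ?_) _).trans ?_
    · refine Nat.add_le_add_right ((cost_intervalTree_le (fun i => (Bx i).y_lt)
        (a := 4 * (spatialConst K * (Λ + 1))) (c := 4 * (spatialConst K * (Λ + 1)) + 7)
        (fun J => le_of_eq (by ring)) _).trans (le_of_eq ?_)) _
      ring
    · have h1 : 12 * (spatialConst K * (Λ + 1)) + 14 + 2 * 4 ≤ boxesConst K * (Λ + 1) := by
        rw [boxesConst, add_mul, mul_assoc]
        omega
      rw [Finset.card_univ, Fintype.card_fin, ← mul_assoc (boxesConst K)]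
      exact Nat.mul_le_mul_right _ h1
  set table : List (Cell w) := (List.range (2 ^ b)).map fun v => .ofNat w (popcount b v) with htab
  have hbw : b < w := by have := hP.word; omega
  obtain ⟨M', r, e, h1, h2, h3⟩ := alloc_top (N := N) (x := fun i => ((Bx i).x₁ : Coord))
    (ylo := fun i => ((Bx i).y₁ : Coord)) (yhi := fun i => (Bx i).y₂)
    (zlo := fun i => ((Bx i).z₁ : Coord)) (zhi := fun i => (Bx i).z₂) hP hlam hΛ hΛw
    (intervalTree (fun i => ((Bx i).z₁ : Coord)) (fun i => (Bx i).z₂) Finset.univ)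
    (.ofNat w b :: .ofNat w 0 :: table) (by simp) (by simp [htab]; omega)
  have hlen : (.ofNat w b :: .ofNat w 0 :: table).length = 2 ^ b + 2 := by simp [htab]
  rw [hlen] at h1 h2
  have h1' : 1 < M'.length := (Nat.lt_add_left _ (by norm_num)).trans_le h1
  -- The root address is known only after everything is allocated, so it is written into the
  -- reserved cell `1`, the one cell whose content no stored property relies on.
  have hset : MemExt M' (M'.set 1 (.ofNat w r)) := by
    intro a c ha hc
    rwa [List.getElem?_set_ne ha.symm]
  refine ⟨M'.set 1 (.ofNat w r), by rw [List.length_set]; omega, ⟨hP.block, hbw, ?_, ?_⟩, r, ?_,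
    (h3 _ hset).2⟩
  · exact wordAt_of_getElem? (hbw.trans Nat.lt_two_pow_self) ((e.trans hset) 0 _ (by norm_num) rfl)
  · intro v hv
    refine wordAt_of_getElem? ((popcount_le b v).trans_lt (hbw.trans Nat.lt_two_pow_self))
      ((e.trans hset) (2 + v) _ (by omega) ?_)
    rw [show 2 + v = v + 1 + 1 by ring, List.getElem?_cons_succ, List.getElem?_cons_succ, htab]
    simp [hv, Cell.ofNat]
  · refine wordAt_of_getElem? ((h3 M' (MemExt.refl _)).1.trans_lt hP.memory) ?_
    rw [List.getElem?_set_self h1']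
    rfl

end layout

/-! ### Choice of the parameters -/

theorem size_le_log_add_one (n : ℕ) : Nat.size n ≤ Nat.log 2 n + 1 :=
  Nat.size_le.2 (Nat.lt_pow_succ_log_self (by norm_num) n)

theorem clog_le_log_add_one {d : ℕ} (hd : 2 ≤ d) (n : ℕ) : Nat.clog d n ≤ Nat.log d n + 1 :=
  Nat.clog_le_of_le_pow (Nat.lt_pow_succ_log_self (by omega) n).le

/-- The least multiple of `lg n` that is required of the word length. -/
def wordConst (K : ℕ) : ℕ := boxesConst K + K + 10

/-- The block length is `⌊lg n⌋`. The memory size is polynomial in `n` with an exponent that depends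
on `K` only, so a constant multiple of `lg n` bits addresses it. -/
theorem exists_layoutParams {n w K B Λ : ℕ} (hn : 2 ≤ n)
    (hw : wordConst K * (Nat.log 2 n + 1) ≤ w) (hB : 2 ≤ B) (hK : Nat.log 2 n + 1 < B ^ K)
    (hΛ : Λ ≤ n) : LayoutParams n w (boxesConst K * ((Λ + 1) * n) + n + 2) (Nat.log 2 n) B K
      (Nat.log 2 n + 1) := by
  set b := Nat.log 2 n with hb
  have hb1 : 1 ≤ b := Nat.log_pos (by norm_num) hn
  have hclog : Nat.clog 2 n ≤ b + 1 := clog_le_log_add_one le_rfl n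
  have hnb : n < 2 ^ (b + 1) := Nat.lt_pow_succ_log_self (by norm_num) n
  have hN : boxesConst K * ((Λ + 1) * n) + n + 2 < 2 ^ w := by
    set C := boxesConst K
    have h1 : (Λ + 1) * n ≤ n ^ 3 := by
      rw [show n ^ 3 = (n * n) * n by ring]
      refine Nat.mul_le_mul_right _ ?_
      have := Nat.mul_le_mul_right n hn
      omega
    have h2 : n + 2 ≤ 2 * n ^ 3 := by
      have : n ^ 1 ≤ n ^ 3 := Nat.pow_le_pow_right (by omega) (by norm_num)
      rw [pow_one] at this
      omega
    calc C * ((Λ + 1) * n) + n + 2 ≤ C * n ^ 3 + 2 * n ^ 3 := by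
          have := Nat.mul_le_mul_left C h1
          omega
      _ = (C + 2) * n ^ 3 := by ring
      -- The constant factor is absorbed into a power of `n ≥ 2`.
      _ ≤ 2 ^ (C + 2) * n ^ 3 := Nat.mul_le_mul_right _ Nat.lt_two_pow_self.le
      _ ≤ n ^ (C + 2) * n ^ 3 := Nat.mul_le_mul_right _ (Nat.pow_le_pow_left hn _)
      _ = n ^ (C + 5) := by ring
      _ < (2 ^ (b + 1)) ^ (C + 5) := Nat.pow_lt_pow_left hnb (by omega)
      _ = 2 ^ ((C + 5) * (b + 1)) := by rw [← pow_mul, mul_comm]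
      _ ≤ 2 ^ w := Nat.pow_le_pow_right (by norm_num)
          ((Nat.mul_le_mul_right _ (by simp only [wordConst, C]; omega)).trans hw)
  refine ⟨hN, by omega, hb1, hB, ?_, ?_, hK, hclog, size_le_log_add_one n, by omega⟩
  -- The block length is below `B ^ K`, and `B ≤ 2 ^ B` bounds this by `2 ^ (K * B)`.
  · have h1 : B ^ K ≤ (2 ^ B) ^ K := Nat.pow_le_pow_left Nat.lt_two_pow_self.le K
    rw [← pow_mul, mul_comm] at h1
    omega
  · have h1 : (K + 3) * (b + 1) ≤ (wordConst K - 1) * (b + 1) :=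
      Nat.mul_le_mul_right _ (by simp only [wordConst]; omega)
    have h2 : wordConst K * (b + 1) = (wordConst K - 1) * (b + 1) + (b + 1) := by
      rw [← Nat.succ_mul]
      congr 1
    have h3 : (K + 3) * (b + 1) = (K + 2) * (b + 1) + (b + 1) := by ring
    omega

/-- A base above `(⌊lg n⌋ + 1) ^ ε` has a `⌈1/ε⌉`-th power above `⌊lg n⌋ + 1`, so heights have a
bounded number of digits while each digit stays of order `lg^ε n`. -/
theorem exists_base {ε : ℝ} (hε : 0 < ε) {n : ℕ} (hn : 2 ≤ n) : ∃ B : ℕ, 2 ≤ B ∧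
    Nat.log 2 n + 1 < B ^ ⌈1 / ε⌉₊ ∧ (B : ℝ) ≤ (2 ^ ε + 2) * Real.logb 2 n ^ ε := by
  set b := Nat.log 2 n with hb
  set K := ⌈1 / ε⌉₊ with hK
  have hb1 : 1 ≤ b := Nat.log_pos (by norm_num) hn
  have hlog : (b : ℝ) ≤ Real.logb 2 n := by exact_mod_cast Real.natLog_le_logb n 2
  have hb1' : (1 : ℝ) ≤ b := by exact_mod_cast hb1
  have hl1 : 1 ≤ Real.logb 2 n := hb1'.trans hlog
  have hs : (1 : ℝ) ≤ ((b + 1 : ℕ) : ℝ) := by push_cast; linarith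
  set s : ℝ := ((b + 1 : ℕ) : ℝ) with hsdef
  have hsε : 0 ≤ s ^ ε := by positivity
  -- Adding `2` to the floor gives a base of at least `2` and a strict inequality; it is absorbed at
  -- the end by `1 ≤ lg^ε n`.
  refine ⟨⌊s ^ ε⌋₊ + 2, by omega, ?_, ?_⟩
  · have h1 : s ^ ε < ((⌊s ^ ε⌋₊ + 2 : ℕ) : ℝ) := by
      have := Nat.lt_floor_add_one (s ^ ε)
      push_cast
      linarith
    have hKε : 1 ≤ ε * K := by
      have := Nat.le_ceil (1 / ε)
      rw [div_le_iff₀ hε] at this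
      rw [mul_comm]
      exact this
    have hK0 : K ≠ 0 := by
      rintro h
      rw [h] at hKε
      norm_num at hKε
    have h2 : s < ((⌊s ^ ε⌋₊ + 2 : ℕ) : ℝ) ^ K := by
      calc s = s ^ (1 : ℝ) := (Real.rpow_one s).symm
        _ ≤ s ^ (ε * K) := Real.rpow_le_rpow_of_exponent_le hs hKε
        _ = (s ^ ε) ^ K := by rw [Real.rpow_mul (by linarith), Real.rpow_natCast]
        _ < _ := pow_lt_pow_left₀ h1 hsε hK0
    rw [hsdef] at h2
    exact_mod_cast h2
  · have h1 : ((⌊s ^ ε⌋₊ : ℕ) : ℝ) ≤ s ^ ε := Nat.floor_le hsε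
    have h2 : s ^ ε ≤ (2 * Real.logb 2 n) ^ ε := by
      refine Real.rpow_le_rpow (by linarith) ?_ hε.le
      rw [hsdef]
      push_cast
      linarith
    rw [Real.mul_rpow (by norm_num) (by linarith)] at h2
    have h3 : 1 ≤ Real.logb 2 n ^ ε := Real.one_le_rpow hl1 hε.le
    push_cast
    linarith

/-- The three bounds are `D ≤ 4 lg`, `Λ + 1 ≤ 3 L` and `b + 2 ≤ 3 lg`, with product `144`. The total
time is `450` such products and lower-order terms, and `450 * 144 + 230 ≤ 66000`. -/
theorem query_cost_le {lg L : ℝ} {lam b Λ D : ℕ} (hlg : 1 ≤ lg) (hL : 1 ≤ L) (hlam : 1 ≤ lam)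
    (hb : (b : ℝ) ≤ lg) (hΛ : (Λ : ℝ) ≤ L + 1) (hD : D = 2 * (b + 1)) :
    ((D * (D * ((Λ + 1) * (lam * (b + 1 + 1)))) : ℕ) : ℝ) ≤ 144 * (lam * lg ^ 3 * L) ∧
    ((D * (D * (440 * ((Λ + 1) * (lam * (b + 1 + 1)))) + 50) + 30 +
      10 * (D * (D * ((Λ + 1) * (lam * (b + 1 + 1))))) : ℕ) : ℝ) ≤
        66000 * (lam * lg ^ 3 * L) := by
  have hlam' : (1 : ℝ) ≤ lam := by exact_mod_cast hlam
  have hD' : (D : ℝ) ≤ 4 * lg := by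
    rw [hD]
    push_cast
    linarith
  have e1 : (D * (D * ((Λ + 1) * (lam * (b + 1 + 1)))) : ℝ) ≤ 144 * (lam * lg ^ 3 * L) := by
    calc (D * (D * ((Λ + 1) * (lam * (b + 1 + 1)))) : ℝ)
        ≤ (4 * lg) * ((4 * lg) * ((3 * L) * (lam * (3 * lg)))) := by
          gcongr
          · linarith
          · linarith
      _ = _ := by ring
  have e2 : lg ≤ lam * lg ^ 3 * L := by
    have h1 : lg ≤ lg ^ 3 := le_self_pow₀ hlg (by norm_num)
    have h2 : 0 ≤ lg ^ 3 := by positivity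
    calc lg ≤ 1 * lg ^ 3 * 1 := by linarith
      _ ≤ lam * lg ^ 3 * L := by gcongr
  refine ⟨by exact_mod_cast e1, ?_⟩
  push_cast
  have e3 : ((D : ℝ) * (D * (440 * ((Λ + 1) * (lam * (b + 1 + 1)))) + 50) + 30 +
      10 * (D * (D * ((Λ + 1) * (lam * (b + 1 + 1)))))) =
      450 * (D * (D * ((Λ + 1) * (lam * (b + 1 + 1))))) + 50 * D + 30 := by ring
  rw [e3]
  linarith

theorem report_cost_le {U V p k : ℕ} {A G X e : ℝ} (hU : ((U + 30 + V : ℕ) : ℝ) ≤ 66000 * X)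
    (hp : (101 * p : ℝ) + 50 ≤ A * e) (hX : 0 ≤ X) (hA : 0 ≤ A) (hG : 0 ≤ G) (he : 0 ≤ e) :
    ((U + 20 + V + (101 * p + 50) * k : ℕ) : ℝ) ≤ (66000 + A + (3 * G + 2)) * (X + k * e) := by
  have h1 : (101 * p + 50 : ℝ) * k ≤ (A * e) * k := mul_le_mul_of_nonneg_right hp (Nat.cast_nonneg k)
  have h2 : 0 ≤ (A + (3 * G + 2)) * X := by positivity
  have h3 : 0 ≤ (66000 + (3 * G + 2)) * (k * e) := by positivity
  push_cast at hU ⊢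
  linarith

/-- Logarithmic factors: `Real.logb 2 n` is `lg n`, and `Real.logb lam n` is `log_λ n`. The word
length `w` may be any number that is at least a constant multiple of `lg n`. -/
theorem mainTheorem7 (ε : ℝ) (hε : 0 < ε) :
    ∃ (c C : ℝ) (point count report : Prog),
      ∀ (n lam w : ℕ), 2 ≤ lam → lam ≤ n → c * Real.logb 2 n ≤ w →
      ∀ B : Fin n → CanonicalBox, ∃ M : List (Cell w),
        -- space
        (M.length : ℝ) ≤ C * (n * Real.logb lam n) ∧
        -- the memory holds the structure
        HoldsLists M point (C * Real.logb 2 n ^ ε) (bottomLists lam B) ∧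
        ∀ q : Fin 3 → ℝ,
          -- counting queries
          Outputs M q count [] (C * (lam * Real.logb 2 n ^ 3 * Real.logb lam n))
            [stabCount B q] ∧
          -- reporting queries, whose output is split into prefixes of bottom lists
          ∃ prefixes : List (List (Fin n)),
            (prefixes.length : ℝ) ≤ C * (lam * Real.logb 2 n ^ 3 * Real.logb lam n) ∧
            (∀ L ∈ prefixes, L ≠ [] ∧ ∃ P ∈ bottomLists lam B, L <+: P) ∧
            prefixes.Pairwise List.Disjoint ∧
            prefixes.flatten.Nodup ∧
            (∀ i, i ∈ prefixes.flatten ↔ (B i).Contains q) ∧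
            Outputs M q report []
              (C * (lam * Real.logb 2 n ^ 3 * Real.logb lam n +
                stabCount B q * Real.logb 2 n ^ ε))
              (prefixes.flatten.map fun i : Fin n => (i : ℕ)) := by
  set K := ⌈1 / ε⌉₊ with hK
  -- The decoding time `101 * (K * B) + 50`, with the bound for `B` inserted, is at most `A * lg^ε
  -- n`.
  set A : ℝ := 101 * K * (2 ^ ε + 2) + 50 with hA
  have hA0 : 0 ≤ A := by positivity
  -- The factor `2` passes from `⌊lg n⌋ + 1` to `lg n`. The three summands of the other constant
  -- cover the traversal time, the decoding time and the space.
  refine ⟨2 * wordConst K, 66000 + A + (3 * boxesConst K + 2), pointProg, countProg, reportProg,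
    fun n lam w hlam hlamn hw Bx => ?_⟩
  have hn2 : 2 ≤ n := hlam.trans hlamn
  obtain ⟨B, hB, hBK, hBε⟩ := exists_base hε hn2
  rw [← hK] at hBK
  set b := Nat.log 2 n with hb
  set lg := Real.logb 2 n with hlg
  set L := Real.logb lam n with hLdef
  set Λ := Nat.clog lam n with hΛ
  have hb1 : 1 ≤ b := Nat.log_pos (by norm_num) hn2
  have hblg : (b : ℝ) ≤ lg := by exact_mod_cast Real.natLog_le_logb n 2
  have hb1' : (1 : ℝ) ≤ b := by exact_mod_cast hb1
  have hlg1 : 1 ≤ lg := hb1'.trans hblg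
  have hlogL : ((Nat.log lam n : ℕ) : ℝ) ≤ L := Real.natLog_le_logb n lam
  have hL1 : 1 ≤ L := by
    have : 1 ≤ Nat.log lam n := Nat.log_pos (by omega) hlamn
    have : (1 : ℝ) ≤ (Nat.log lam n : ℕ) := by exact_mod_cast this
    linarith
  have hΛL : (Λ : ℝ) ≤ L + 1 := by
    have : (Λ : ℝ) ≤ ((Nat.log lam n + 1 : ℕ) : ℝ) := by
      exact_mod_cast clog_le_log_add_one hlam n
    push_cast at this
    linarith
  have hΛn : Λ ≤ n := by
    have h1 := clog_le_log_add_one hlam n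
    have h2 : Nat.log lam n < n := Nat.log_lt_self lam (by omega)
    omega
  have hwn : wordConst K * (b + 1) ≤ w := by
    have h1 : ((wordConst K * (b + 1) : ℕ) : ℝ) ≤ w := by
      refine le_trans ?_ hw
      push_cast
      have h2 : (0 : ℝ) ≤ wordConst K := by positivity
      nlinarith
    exact_mod_cast h1
  have hP := exists_layoutParams hn2 hwn hB hBK hΛn
  have hw8 : 8 ≤ w := by
    have : 10 * 1 ≤ wordConst K * (b + 1) :=
      Nat.mul_le_mul (by simp only [wordConst]; omega) (by omega)
    omega
  have hΛw : Λ + 1 < 2 ^ w := by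
    refine lt_of_le_of_lt ?_ hP.memory
    have h1 : (Λ + 1) * 1 ≤ (Λ + 1) * n := Nat.mul_le_mul_left _ (by omega)
    have h2 : 1 * ((Λ + 1) * n) ≤ boxesConst K * ((Λ + 1) * n) :=
      Nat.mul_le_mul_right _ (by simp only [boxesConst]; omega)
    omega
  obtain ⟨M, hMN, hM⟩ := exists_memory hP hlam le_rfl hΛw (Nat.pow_log_le_self 2 (by omega))
    le_rfl Bx
  have hMw : M.length ≤ 2 ^ w := hMN.trans hP.memory.le
  have hlgε : 1 ≤ lg ^ ε := Real.one_le_rpow hlg1 hε.le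
  have hKB : (101 * ((K * B : ℕ) : ℝ)) + 50 ≤ A * lg ^ ε := by
    have h1 : (101 * K : ℝ) * B ≤ (101 * K) * ((2 ^ ε + 2) * lg ^ ε) := by gcongr
    push_cast
    rw [hA, add_mul]
    linarith
  have hD : 2 * Nat.size n ≤ 2 * (b + 1) := Nat.mul_le_mul_left _ (size_le_log_add_one n)
  obtain ⟨hlen, hcost⟩ := query_cost_le (lam := lam) (Λ := Λ) hlg1 hL1 (by omega) hblg hΛL rfl
  set X : ℝ := lam * lg ^ 3 * L with hX
  have hX0 : 0 ≤ X := by positivity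
  have hbox : (0 : ℝ) ≤ boxesConst K := by positivity
  refine ⟨M, ?_, ?_, fun q => ⟨?_, ?_⟩⟩
  · have h1 : (M.length : ℝ) ≤ ((boxesConst K * ((Λ + 1) * n) + n + 2 : ℕ) : ℝ) := by
      exact_mod_cast hMN
    push_cast at h1
    have hn2' : (2 : ℝ) ≤ n := by exact_mod_cast hn2
    -- As `λ ≤ n`, the logarithm `L` is at least `1`, so the rounding in the number of heights costs
    -- only a constant factor.
    have h2 : ((Λ : ℝ) + 1) * n ≤ (3 * L) * n := by
      gcongr
      linarith
    have h3 : (n : ℝ) ≤ n * L := le_mul_of_one_le_right (by linarith) hL1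
    have h4 := mul_le_mul_of_nonneg_left h2 hbox
    have h5 : 0 ≤ (66000 + A) * (n * L) := by positivity
    rw [add_mul _ _ ((n : ℝ) * L)]
    linarith
  · have h := holdsLists_of_holdsBoxes (K := K) hw8 hMw hB hP.boxes hBK (by omega) hM
    intro P hP'
    obtain ⟨a, ha⟩ := h P hP'
    refine ⟨a, fun i hi q => ?_⟩
    obtain ⟨t, s, h1, h2, h3⟩ := ha i hi q
    refine ⟨t, s, h1, h2.trans ?_, h3⟩
    push_cast at hKB ⊢
    have : 0 ≤ (66000 + (3 * boxesConst K + 2)) * lg ^ ε := by positivity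
    linarith
  · obtain ⟨t, s, h1, h2, h3⟩ := outputs_count (q := q) hw8 hMw hB hP.boxes hBK hlam le_rfl hD hM
    refine ⟨t, s, h1, h2.trans (hcost.trans ?_), h3⟩
    gcongr
    linarith
  · obtain ⟨Ls, hLs, t, s, h1, h2, h3⟩ :=
      outputs_report (q := q) hw8 hMw hB hP.boxes hBK hlam le_rfl hD hM
    refine ⟨Ls, ?_, hLs.pref, (List.nodup_flatten.1 hLs.nodup).2, hLs.nodup, hLs.mem, t, s, h1,
      h2.trans ?_, h3⟩
    · have h4 : (Ls.length : ℝ) ≤ _ := (Nat.cast_le.2 hLs.len).trans hlen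
      refine h4.trans ?_
      gcongr
      linarith
    · exact report_cost_le hcost hKB hX0 hA0 hbox (by linarith)
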